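/- Let $n\ge 0$ products $\{1,\dots,n\}$ be given with prices $r_1\ge r_2\ge\dots\ge r_n\ge 0$ and attraction parameters $v_1,\dots,v_n\ge 0$. Under the multinomial logit (MNL) model with outside option of attraction $1$, a customer who is offered $S\subseteq\{1,\dots,n\}$ buys product $i$ with probability $\phi(i,S)=v_i/(1+\sum_{j\in S}v_j)$ if $i\in S$, and $\phi(i,S)=0$ otherwise; let $R(S)=\sum_{i\in S} r_i\,\phi(i,S)$. For a number of customers $T\ge 0$ and an inventory vector $\mathbf{c}\in\mathbb{Z}_{\ge 0}^n$, define $$f_{LP}(\mathbf{c},T)=\max_{y\ge 0}\Big\{T\sum_{S}y(S)R(S)\ :\ T\sum_{S}y(S)\phi(i,S)\le c_i\ \text{ for all } i,\ \ \sum_{S}y(S)=1\Big\},$$ where $S$ ranges over all subsets of $\{1,\dots,n\}$. The feasible region $\mathcal{F}\subseteq\mathbb{Z}_{\ge 0}^n$ is given either by a cardinality constraint $\sum_i c_i\le K$ with $K\in\mathbb{Z}_{\ge 0}$, or by a budget constraint $\sum_i b_ic_i\le B$ with $b_i\ge 0$ and $B\ge 0$. **Theorem.** Let $\epsilon\in(0,1)$.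 For each of the two kinds of feasible region there is an algorithm that, given any instance with rational data $r_i,v_i,T$ and $K$ (respectively $b_i,B$), outputs some $\mathbf{c}\in\mathcal{F}$ with $$f_{LP}(\mathbf{c},T)\ \ge\ \Big(1-\frac1e-\epsilon\Big)\max_{\mathbf{c}'\in\mathcal{F}}f_{LP}(\mathbf{c}',T),$$ in time polynomial in the length of the binary encoding of the instance (for fixed $\epsilon$). Here time is the logarithmic cost of a random access machine: a step is charged the bit lengths of the numbers it handles. -/

import Mathlib

/-! ### A random access machine over the rationals, with logarithmic cost -/

namespace RatRAM

/-- Number of bits of a rational number, written in lowest terms with binary numerator and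
denominator. -/
def bits (q : ℚ) : ℕ := Nat.size q.num.natAbs + Nat.size q.den

/-- Bit length of a list of rationals (one extra symbol per entry, as a separator). -/
def bitLength (l : List ℚ) : ℕ := (l.map fun q => bits q + 1).sum

/-- The memory: countably many arrays of rationals; `σ a i` is the entry `i` of the array `a`.
A program names only finitely many arrays, but addresses their entries by computed indices. -/
abbrev Memory : Type := ℕ → ℕ → ℚ

/-- Expressions. `get a i` reads the array `a` at the index given by the value of `i`. -/
inductive Expr : Type
  | const (q : ℚ) : Expr
  | get (a : ℕ) (i : Expr) : Expr
  | add (x y : Expr) : Expr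
  | sub (x y : Expr) : Expr
  | mul (x y : Expr) : Expr
  | div (x y : Expr) : Expr
  | floor (x : Expr) : Expr

/-- Value of an expression. Division by `0` gives `0`; an index is rounded down to a natural
number, negative ones to `0`. -/
def Expr.eval (σ : Memory) : Expr → ℚ
  | .const q => q
  | .get a i => σ a ⌊i.eval σ⌋₊
  | .add x y => x.eval σ + y.eval σ
  | .sub x y => x.eval σ - y.eval σ
  | .mul x y => x.eval σ * y.eval σ
  | .div x y => x.eval σ / y.eval σ
  | .floor x => (⌊x.eval σ⌋ : ℤ)

/-- Cost of evaluating an expression: every node is charged one unit plus the bit length of its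
value. The operands, and the addresses of memory accesses, are nodes themselves, so they
are charged too. -/
def Expr.cost (σ : Memory) : Expr → ℕ
  | .const q => 1 + bits q
  | .get a i => i.cost σ + (1 + bits ((Expr.get a i).eval σ))
  | .add x y => x.cost σ + y.cost σ + (1 + bits ((Expr.add x y).eval σ))
  | .sub x y => x.cost σ + y.cost σ + (1 + bits ((Expr.sub x y).eval σ))
  | .mul x y => x.cost σ + y.cost σ + (1 + bits ((Expr.mul x y).eval σ))
  | .div x y => x.cost σ + y.cost σ + (1 + bits ((Expr.div x y).eval σ))
  | .floor x => x.cost σ + (1 + bits ((Expr.floor x).eval σ))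

/-- Programs. `set a i e` stores the value of `e` in the array `a` at the index `i`;
`ite x y P Q` runs `P` if `x < y` and `Q` otherwise; `loop x y P` repeats `P` while `x < y`. -/
inductive Program : Type
  | skip : Program
  | set (a : ℕ) (i e : Expr) : Program
  | seq (P Q : Program) : Program
  | ite (x y : Expr) (P Q : Program) : Program
  | loop (x y : Expr) (P : Program) : Program

/-- The memory after storing `q` in the array `a` at the index `k`. -/
def store (σ : Memory) (a k : ℕ) (q : ℚ) : Memory :=
  Function.update σ a (Function.update (σ a) k q)

/-- `Exec P σ τ t`: started in the memory `σ`, the program `P` halts in the memory `τ`, and the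
total cost of the run is `t`. -/
inductive Exec : Program → Memory → Memory → ℕ → Prop
  | skip (σ : Memory) : Exec .skip σ σ 1
  | set (a : ℕ) (i e : Expr) (σ : Memory) :
      Exec (.set a i e) σ (store σ a ⌊i.eval σ⌋₊ (e.eval σ)) (1 + i.cost σ + e.cost σ)
  | seq {P Q : Program} {σ τ υ : Memory} {s t : ℕ} :
      Exec P σ τ s → Exec Q τ υ t → Exec (.seq P Q) σ υ (s + t)
  | ite_true {x y : Expr} {P Q : Program} {σ τ : Memory} {t : ℕ} :
      x.eval σ < y.eval σ → Exec P σ τ t →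
      Exec (.ite x y P Q) σ τ (1 + x.cost σ + y.cost σ + t)
  | ite_false {x y : Expr} {P Q : Program} {σ τ : Memory} {t : ℕ} :
      ¬ x.eval σ < y.eval σ → Exec Q σ τ t →
      Exec (.ite x y P Q) σ τ (1 + x.cost σ + y.cost σ + t)
  | loop_true {x y : Expr} {P : Program} {σ τ υ : Memory} {s t : ℕ} :
      x.eval σ < y.eval σ → Exec P σ τ s → Exec (.loop x y P) τ υ t →
      Exec (.loop x y P) σ υ (1 + x.cost σ + y.cost σ + s + t)
  | loop_false {x y : Expr} {P : Program} {σ : Memory} :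
      ¬ x.eval σ < y.eval σ → Exec (.loop x y P) σ σ (1 + x.cost σ + y.cost σ)

/-- The initial memory: the input is the beginning of the array `0`, everything else is `0`. -/
def initial (input : List ℚ) : Memory := fun a i => if a = 0 then input.getD i 0 else 0

/-- On the given input, `P` halts with total cost at most `t`, and then the array `1` begins with
the given output. -/
def Program.Computes (P : Program) (input output : List ℚ) (t : ℕ) : Prop :=
  ∃ (τ : Memory) (s : ℕ), Exec P (initial input) τ s ∧ s ≤ t ∧
    ∀ (i : ℕ) (hi : i < output.length), τ 1 i = output[i]

end RatRAM

/-! ### Maximization problems and polynomial time approximation -/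

/-- A maximization problem: instances, their encoding as lists of rationals, the candidate
solutions of each instance with their encoding, the feasible ones, and the objective. -/
structure MaxProblem where
  Inst : Type
  encode : Inst → List ℚ
  Sol : Inst → Type
  encodeSol : (I : Inst) → Sol I → List ℚ
  feasible : (I : Inst) → Set (Sol I)
  value : (I : Inst) → Sol I → ℝ

/-- One program, of cost at most a polynomial in the bit length of the instance, outputs for every
instance a feasible solution whose value is at least `ρ` times that of every feasible one. -/
def MaxProblem.PolyTimeApprox (M : MaxProblem) (ρ : ℝ) : Prop :=
  ∃ (P : RatRAM.Program) (p : Polynomial ℕ), ∀ I : M.Inst, ∃ s ∈ M.feasible I,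
    P.Computes (M.encode I) (M.encodeSol I s) (p.eval (RatRAM.bitLength (M.encode I))) ∧
    ∀ s' ∈ M.feasible I, ρ * M.value I s' ≤ M.value I s

/-! ### The choice-based deterministic linear program under the multinomial logit model -/

namespace Assortment

/-- Probability that a customer who is offered `S` buys product `i`, under the multinomial logit
model with attraction parameters `v` and outside option of attraction `1`. -/
noncomputable def choiceProb {n : ℕ} (v : Fin n → ℝ) (i : Fin n) (S : Finset (Fin n)) : ℝ :=
  if i ∈ S then v i / (∑ j ∈ S, v j + 1) else 0

/-- Expected revenue from one customer who is offered `S`. -/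
noncomputable def revenue {n : ℕ} (r v : Fin n → ℝ) (S : Finset (Fin n)) : ℝ :=
  ∑ i, r i * choiceProb v i S

/-- Feasible mixes of assortments for inventory `c` and horizon `T`. -/
def IsMix {n : ℕ} (v c : Fin n → ℝ) (T : ℝ) (y : Finset (Fin n) → ℝ) : Prop :=
  (∀ S, 0 ≤ y S) ∧ (∀ i, T * ∑ S, y S * choiceProb v i S ≤ c i) ∧ ∑ S, y S = 1

/-- Optimal value of the choice-based deterministic linear program. For nonnegative `v`, `c`, `T`
the feasible set is nonempty and compact, so that the supremum is a maximum. -/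
noncomputable def fLP {n : ℕ} (r v c : Fin n → ℝ) (T : ℝ) : ℝ :=
  sSup {x : ℝ | ∃ y, IsMix v c T y ∧ x = T * ∑ S, y S * revenue r v S}

/-- The products, sorted by descending price, with their prices and attraction parameters, and the
number of customers (any nonnegative number, for instance the mean of a random one). -/
structure Market where
  n : ℕ
  r : Fin n → ℚ
  v : Fin n → ℚ
  T : ℚ
  r_nonneg : ∀ i, 0 ≤ r i
  r_antitone : Antitone r
  v_nonneg : ∀ i, 0 ≤ v i
  T_nonneg : 0 ≤ T

/-- Fluid revenue of stocking `c i` units of each product `i`. -/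
noncomputable def Market.fluidRevenue (M : Market) (c : Fin M.n → ℕ) : ℝ :=
  fLP (fun i => (M.r i : ℝ)) (fun i => (M.v i : ℝ)) (fun i => (c i : ℝ)) (M.T : ℝ)

/-- The list `n, T, r₁, …, rₙ, v₁, …, vₙ`. -/
def Market.encode (M : Market) : List ℚ :=
  (M.n : ℚ) :: M.T :: (List.ofFn M.r ++ List.ofFn M.v)

/-- A market with a bound `K` on the total number of units. -/
structure CardInst extends Market where
  K : ℕ

/-- A market with unit costs `b` and a budget `B`. -/
structure BudgetInst extends Market where
  b : Fin n → ℚ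
  B : ℚ
  b_nonneg : ∀ i, 0 ≤ b i
  B_nonneg : 0 ≤ B

/-- Maximize the fluid revenue over integral inventories with at most `K` units in total. -/
noncomputable def cardProblem : MaxProblem where
  Inst := CardInst
  encode I := I.toMarket.encode ++ [(I.K : ℚ)]
  Sol I := Fin I.n → ℕ
  encodeSol _ c := List.ofFn fun i => (c i : ℚ)
  feasible I := {c | ∑ i, c i ≤ I.K}
  value I c := I.toMarket.fluidRevenue c

/-- Maximize the fluid revenue over integral inventories of total cost at most `B`. -/
noncomputable def budgetProblem : MaxProblem where
  Inst := BudgetInst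
  encode I := I.toMarket.encode ++ (List.ofFn I.b ++ [I.B])
  Sol I := Fin I.n → ℕ
  encodeSol _ c := List.ofFn fun i => (c i : ℚ)
  feasible I := {c | ∑ i, I.b i * (c i : ℚ) ≤ I.B}
  value I c := I.toMarket.fluidRevenue c

end Assortment

/-!
A mixture of assortments matters only through the expected sales `x i` of the products and `x₀` of
the outside option, and by selecting the products independently one attains every choice of sales
with `0 ≤ x i ≤ min (c i) (v i * x₀)` and `∑ i, x i + x₀ ≤ T`. So the fluid revenue is the maximum
of `∑ i, r i * x i` over these sales.

For fixed `x₀` this is a knapsack problem, in which sales `x i` call for an inventory `⌈x i⌉`. Guess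
`x₀` up to a factor `shrink N = 1 - 1 / N`, and guess the product that alone could bring in the most
revenue, which fixes a unit of revenue. Counting revenues in such units and capacities in slots, a
table over the products, the units and the slots holds the least cost of an inventory. Each of the
three roundings, of `x₀`, of the revenues and of the capacity, loses a factor `shrink N`, so that
every ratio below `1` is attained for a suitable `N`, in particular `1 - 1 / e - ε`.
-/

/-! ### Heights of rational numbers -/

namespace RatRAM

/-- The sum of the numerator and the denominator of `q` is at most `2 ^ m`. Unlike `bits q ≤ m`,
this bound is additive in `m` under each arithmetic operation. -/
def HeightLE (m : ℕ) (q : ℚ) : Prop := q.num.natAbs + q.den ≤ 2 ^ m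

section Height

variable {m m' : ℕ} {x y : ℚ}

theorem HeightLE.mono (hx : HeightLE m x) (h : m ≤ m') : HeightLE m' x :=
  hx.trans (Nat.pow_le_pow_right two_pos h)

theorem heightLE_div_natCast {a : ℤ} {b : ℕ} (hb : 0 < b) (h : a.natAbs + b ≤ 2 ^ m) :
    HeightLE m (a / b) := by
  have hb' : (b : ℤ) ≠ 0 := by exact_mod_cast hb.ne'
  have hq : (a / b : ℚ) = Rat.divInt a b := by simp [Rat.divInt_eq_div]
  have hden : (a / b : ℚ).den ≤ b :=
    Nat.le_of_dvd hb (by exact_mod_cast hq ▸ Rat.den_dvd a b)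
  have hnum : (a / b : ℚ).num.natAbs ≤ a.natAbs := by
    rcases eq_or_ne a 0 with rfl | ha
    · simp
    · exact Nat.le_of_dvd (Int.natAbs_pos.2 ha) (Int.natAbs_dvd_natAbs.2 (hq ▸ Rat.num_dvd a hb'))
  exact (add_le_add hnum hden).trans h

theorem heightLE_natCast {k : ℕ} : HeightLE m (k : ℚ) ↔ k + 1 ≤ 2 ^ m := by
  simp [HeightLE]

theorem heightLE_zero : HeightLE m 0 := by
  simpa [HeightLE] using Nat.one_le_two_pow

theorem heightLE_bits (q : ℚ) : HeightLE (bits q) q := by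
  have hnum := Nat.succ_le_of_lt (Nat.lt_size_self q.num.natAbs)
  have hden := Nat.succ_le_of_lt (Nat.lt_size_self q.den)
  unfold HeightLE bits
  rw [pow_add]
  exact le_trans (by rw [Nat.succ_mul_succ]; omega) (Nat.mul_le_mul hnum hden)

theorem HeightLE.bits_le (hx : HeightLE m x) : bits x ≤ 2 * m + 1 := by
  unfold HeightLE at hx
  have hpos := x.den_pos
  have hnum : x.num.natAbs.size ≤ m := Nat.size_le.2 (by omega)
  have hden : x.den.size ≤ m + 1 := Nat.size_le.2 (by rw [pow_succ]; omega)
  unfold bits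
  omega

theorem HeightLE.neg (hx : HeightLE m x) : HeightLE m (-x) := by
  simpa [HeightLE] using hx

theorem HeightLE.inv (hx : HeightLE m x) : HeightLE m x⁻¹ := by
  rcases eq_or_ne x 0 with rfl | h0
  · simpa using hx
  · have hnum : x.num ≠ 0 := Rat.num_ne_zero.2 h0
    simpa [HeightLE, hnum, Int.natAbs_mul, Int.natAbs_sign_of_ne_zero, add_comm] using hx

theorem HeightLE.add (hx : HeightLE m x) (hy : HeightLE m' y) : HeightLE (m + m') (x + y) := by
  have hdx : (x.den : ℚ) ≠ 0 := by exact_mod_cast x.den_nz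
  have hdy : (y.den : ℚ) ≠ 0 := by exact_mod_cast y.den_nz
  have hxy : x + y = ((x.num * y.den + y.num * x.den : ℤ) : ℚ) / (x.den * y.den : ℕ) := by
    conv_lhs => rw [← Rat.num_div_den x, ← Rat.num_div_den y]
    push_cast
    field_simp
  rw [hxy]
  refine heightLE_div_natCast (Nat.mul_pos x.den_pos y.den_pos) ?_
  have hnum := Int.natAbs_add_le (x.num * y.den) (y.num * x.den)
  simp only [Int.natAbs_mul, Int.natAbs_natCast] at hnum
  rw [pow_add]
  nlinarith [Nat.mul_le_mul hx hy, Nat.zero_le (x.num.natAbs * y.num.natAbs)]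

theorem HeightLE.sub (hx : HeightLE m x) (hy : HeightLE m' y) : HeightLE (m + m') (x - y) :=
  sub_eq_add_neg x y ▸ hx.add hy.neg

theorem HeightLE.mul (hx : HeightLE m x) (hy : HeightLE m' y) : HeightLE (m + m') (x * y) := by
  have hxy : x * y = ((x.num * y.num : ℤ) : ℚ) / (x.den * y.den : ℕ) := by
    conv_lhs => rw [← Rat.num_div_den x, ← Rat.num_div_den y, div_mul_div_comm]
    push_cast
    rfl
  rw [hxy]
  refine heightLE_div_natCast (Nat.mul_pos x.den_pos y.den_pos) ?_
  rw [Int.natAbs_mul, pow_add]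
  nlinarith [Nat.mul_le_mul hx hy, Nat.zero_le (x.num.natAbs * y.den),
    Nat.zero_le (x.den * y.num.natAbs)]

theorem HeightLE.div (hx : HeightLE m x) (hy : HeightLE m' y) : HeightLE (m + m') (x / y) :=
  div_eq_mul_inv x y ▸ hx.mul hy.inv

theorem HeightLE.floor (hx : HeightLE m x) : HeightLE m (⌊x⌋ : ℤ) := by
  have hfloor : ⌊x⌋.natAbs ≤ x.num.natAbs := by
    rw [Rat.floor_def']
    exact Int.natAbs_ediv_le_natAbs _ _
  unfold HeightLE at *
  rw [Rat.num_intCast, Rat.den_intCast]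
  have := x.den_pos
  omega

theorem HeightLE.ceil (hx : HeightLE m x) : HeightLE m (⌈x⌉ : ℤ) := by
  simpa [Int.floor_neg] using hx.neg.floor.neg

theorem HeightLE.pow (hx : HeightLE m x) (k : ℕ) : HeightLE (k * m + 1) (x ^ k) := by
  induction k with
  | zero => simp [HeightLE]
  | succ k ih =>
    rw [pow_succ]
    exact (ih.mul hx).mono (by ring_nf; rfl)

theorem heightLE_sum_range {f : ℕ → ℚ} {k : ℕ} (hf : ∀ i < k, HeightLE m (f i)) :
    HeightLE (k * m) (∑ i ∈ Finset.range k, f i) := by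
  induction k with
  | zero => simpa using heightLE_zero
  | succ k ih =>
    rw [Finset.sum_range_succ, Nat.succ_mul]
    exact (ih fun i hi => hf i (by omega)).add (hf k (by omega))

end Height

end RatRAM

/-! ### Running times -/

namespace RatRAM

open Polynomial

/-- All entries of the memory have height at most `2 ^ β`. -/
def Small (β : ℕ) (σ : Memory) : Prop := ∀ a i, HeightLE β (σ a i)

/-- The height of the value of an expression, in multiples of the height `β + 1` of the memory. -/
def Expr.weight : Expr → ℕ
  | .const q => bits q
  | .get _ _ => 1
  | .add x y | .sub x y | .mul x y | .div x y => x.weight + y.weight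
  | .floor x => x.weight

/-- The cost of an expression, in multiples of the height `β + 1` of the memory. -/
def Expr.costRate : Expr → ℕ
  | .const q => 1 + bits q
  | .get _ i => i.costRate + 4
  | .add x y | .sub x y | .mul x y | .div x y =>
    x.costRate + y.costRate + (2 + 2 * (x.weight + y.weight))
  | .floor x => x.costRate + (2 + 2 * x.weight)

/-- The cost of a program, in multiples of the height `β + 1` of the memory, as a polynomial in a
bound on the number of iterations of each loop. -/
noncomputable def Program.costPoly : Program → Polynomial ℕ
  | .skip => 1
  | .set _ i e => C (1 + i.costRate + e.costRate)
  | .seq P Q => P.costPoly + Q.costPoly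
  | .ite x y P Q => C (1 + x.costRate + y.costRate) + P.costPoly + Q.costPoly
  | .loop x y P => (X + 1) * (C (1 + x.costRate + y.costRate) + P.costPoly)

/-- `P` writes to the array `a`. -/
def Program.writes : Program → ℕ → Bool
  | .skip, _ => false
  | .set b _ _, a => a == b
  | .seq P Q, a | .ite _ _ P Q, a => P.writes a || Q.writes a
  | .loop _ _ P, a => P.writes a

/-- Started in `σ`, the program `P` halts in a memory of small entries that satisfies `Q`, and its
cost is within the bound of `Program.costPoly` for loops of at most `R` iterations. -/
def Halts (R β : ℕ) (P : Program) (σ : Memory) (Q : Memory → Prop) : Prop :=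
  ∃ τ s, Exec P σ τ s ∧ s ≤ P.costPoly.eval R * (β + 1) ∧ Small β τ ∧ Q τ

section

variable {R β : ℕ} {P P' : Program} {σ τ : Memory} {Q Q' : Memory → Prop}

theorem store_apply (σ : Memory) (a k : ℕ) (q : ℚ) (b i : ℕ) :
    store σ a k q b i = if b = a ∧ i = k then q else σ b i := by
  by_cases hb : b = a
  · subst hb
    by_cases hi : i = k <;> simp [store, hi]
  · simp [store, hb]

theorem Small.store (hσ : Small β σ) {a k : ℕ} {q : ℚ} (hq : HeightLE β q) :
    Small β (store σ a k q) := fun b i => by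
  rw [store_apply]
  split_ifs
  exacts [hq, hσ b i]

theorem Expr.heightLE_eval (hσ : Small β σ) (e : Expr) :
    HeightLE (e.weight * (β + 1)) (e.eval σ) := by
  induction e with
  | const q => exact (heightLE_bits q).mono (Nat.le_mul_of_pos_right _ β.succ_pos)
  | get a i => exact (hσ a _).mono (by simp [weight])
  | add x y hx hy => simpa only [weight, eval, add_mul] using hx.add hy
  | sub x y hx hy => simpa only [weight, eval, add_mul] using hx.sub hy
  | mul x y hx hy => simpa only [weight, eval, add_mul] using hx.mul hy
  | div x y hx hy => simpa only [weight, eval, add_mul] using hx.div hy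
  | floor x hx => exact hx.floor

theorem Expr.cost_le (hσ : Small β σ) (e : Expr) : e.cost σ ≤ e.costRate * (β + 1) := by
  have hvalue := (e.heightLE_eval hσ).bits_le
  induction e with
  | const q =>
    simp only [cost, costRate]
    exact Nat.le_mul_of_pos_right _ β.succ_pos
  | get a i hi | floor i hi =>
    have := hi (i.heightLE_eval hσ).bits_le
    simp only [cost, costRate, weight] at *
    linarith
  | add x y hx hy | sub x y hx hy | mul x y hx hy | div x y hx hy =>
    have := hx (x.heightLE_eval hσ).bits_le
    have := hy (y.heightLE_eval hσ).bits_le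
    simp only [cost, costRate, weight] at *
    linarith

theorem Exec.eq_of_not_writes {t : ℕ} (h : Exec P σ τ t) {a : ℕ} (ha : P.writes a = false) :
    τ a = σ a := by
  induction h with
  | skip | loop_false => rfl
  | set b i e σ =>
    have hab : a ≠ b := by simpa [Program.writes] using ha
    simp [store, hab]
  | seq _ _ ih₁ ih₂ =>
    simp only [Program.writes, Bool.or_eq_false_iff] at ha
    rw [ih₂ ha.2, ih₁ ha.1]
  | ite_true _ _ ih =>
    simp only [Program.writes, Bool.or_eq_false_iff] at ha
    exact ih ha.1
  | ite_false _ _ ih =>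
    simp only [Program.writes, Bool.or_eq_false_iff] at ha
    exact ih ha.2
  | loop_true _ _ _ ih₁ ih₂ =>
    simp only [Program.writes] at ha
    rw [ih₂ ha, ih₁ ha]

namespace Halts

theorem mono (h : Halts R β P σ Q) (hQ : ∀ τ, Small β τ → Q τ → Q' τ) : Halts R β P σ Q' :=
  let ⟨τ, s, hexec, hs, hτ, hQτ⟩ := h
  ⟨τ, s, hexec, hs, hτ, hQ τ hτ hQτ⟩

theorem frame (h : Halts R β P σ Q) :
    Halts R β P σ fun τ => (∀ a, P.writes a = false → τ a = σ a) ∧ Q τ :=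
  let ⟨τ, s, hexec, hs, hτ, hQτ⟩ := h
  ⟨τ, s, hexec, hs, hτ, fun _ ha => hexec.eq_of_not_writes ha, hQτ⟩

theorem skip (hσ : Small β σ) (h : Q σ) : Halts R β .skip σ Q :=
  ⟨σ, 1, .skip σ, by simp [Program.costPoly], hσ, h⟩

theorem set {a : ℕ} {i e : Expr} (hσ : Small β σ) (he : HeightLE β (e.eval σ))
    (h : Q (store σ a ⌊i.eval σ⌋₊ (e.eval σ))) : Halts R β (.set a i e) σ Q := by
  refine ⟨_, _, .set a i e σ, ?_, hσ.store he, h⟩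
  have := i.cost_le hσ
  have := e.cost_le hσ
  simp only [Program.costPoly, eval_C]
  linarith

theorem seq (h : Halts R β P σ fun τ => Halts R β P' τ Q) : Halts R β (.seq P P') σ Q := by
  obtain ⟨τ, s, hexec, hs, -, υ, t, hexec', ht, hυ, hQ⟩ := h
  refine ⟨υ, s + t, .seq hexec hexec', ?_, hυ, hQ⟩
  simp only [Program.costPoly, eval_add]
  linarith

theorem ite {x y : Expr} (hσ : Small β σ) (hlt : x.eval σ < y.eval σ → Halts R β P σ Q)
    (hge : y.eval σ ≤ x.eval σ → Halts R β P' σ Q) : Halts R β (.ite x y P P') σ Q := by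
  have := x.cost_le hσ
  have := y.cost_le hσ
  have := Nat.zero_le (P.costPoly.eval R * (β + 1))
  have := Nat.zero_le (P'.costPoly.eval R * (β + 1))
  by_cases h : x.eval σ < y.eval σ
  · obtain ⟨τ, s, hexec, hs, hτ, hQ⟩ := hlt h
    refine ⟨τ, _, .ite_true h hexec, ?_, hτ, hQ⟩
    simp only [Program.costPoly, eval_C, eval_add]
    linarith
  · obtain ⟨τ, s, hexec, hs, hτ, hQ⟩ := hge (not_lt.1 h)
    refine ⟨τ, _, .ite_false h hexec, ?_, hτ, hQ⟩
    simp only [Program.costPoly, eval_C, eval_add]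
    linarith

theorem loop_of_iterations_left {x y : Expr} {I : ℕ → Memory → Prop} {N : ℕ}
    (hstep : ∀ k σ, Small β σ → I k σ → x.eval σ < y.eval σ → k < N ∧ Halts R β P σ (I (k + 1)))
    (d k : ℕ) (σ : Memory) (hkd : k + d = N) (hσ : Small β σ) (hI : I k σ) :
    ∃ τ s, Exec (.loop x y P) σ τ s ∧
      s ≤ (d + 1) * ((1 + x.costRate + y.costRate + P.costPoly.eval R) * (β + 1)) ∧
      Small β τ ∧ (∃ k, I k τ) ∧ y.eval τ ≤ x.eval τ := by
  have hx := x.cost_le hσ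
  have hy := y.cost_le hσ
  have hP := Nat.zero_le (P.costPoly.eval R * (β + 1))
  by_cases h : x.eval σ < y.eval σ
  · obtain ⟨hkN, τ, s, hexec, hs, hτ, hIτ⟩ := hstep k σ hσ hI h
    obtain ⟨d, rfl⟩ : ∃ d', d = d' + 1 := ⟨d - 1, by omega⟩
    obtain ⟨υ, t, hloop, ht, hυ⟩ :=
      loop_of_iterations_left hstep d (k + 1) τ (by omega) hτ hIτ
    refine ⟨υ, _, .loop_true h hexec hloop, ?_, hυ⟩
    rw [Nat.succ_mul (d + 1)]
    linarith
  · refine ⟨σ, _, .loop_false h, ?_, hσ, ⟨k, hI⟩, not_lt.1 h⟩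
    rw [Nat.succ_mul]
    refine Nat.le_add_left_of_le ?_
    linarith

theorem loop {x y : Expr} (I : ℕ → Memory → Prop) {N : ℕ} (hN : N ≤ R) (hσ : Small β σ)
    (hzero : I 0 σ)
    (hstep : ∀ k σ, Small β σ → I k σ → x.eval σ < y.eval σ → k < N ∧ Halts R β P σ (I (k + 1)))
    (hend : ∀ k τ, I k τ → y.eval τ ≤ x.eval τ → Q τ) : Halts R β (.loop x y P) σ Q := by
  obtain ⟨τ, s, hexec, hs, hτ, ⟨k, hI⟩, hle⟩ :=
    loop_of_iterations_left hstep N 0 σ (by omega) hσ hzero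
  refine ⟨τ, s, hexec, hs.trans ?_, hτ, hend k τ hI hle⟩
  simp only [Program.costPoly, eval_C, eval_add, eval_mul, eval_X, eval_one]
  rw [mul_assoc]
  gcongr

end Halts

end

end RatRAM

namespace RatRAM

notation:60 P:61 ";;" Q:60 => Program.seq P Q

instance : Add Expr := ⟨.add⟩
instance : Sub Expr := ⟨.sub⟩
instance : Mul Expr := ⟨.mul⟩
instance : Div Expr := ⟨.div⟩
instance (k : ℕ) : OfNat Expr k := ⟨.const k⟩

/-- The entry `0` of an array, which serves as a scalar variable. -/
def Expr.var (a : ℕ) : Expr := .get a 0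

/-- The value rounded up. -/
def Expr.ceil (x : Expr) : Expr := 0 - .floor (0 - x)

/-- Assignment to a scalar variable. -/
def Program.assign (a : ℕ) (e : Expr) : Program := .set a 0 e

/-- Runs `P` for the values `0, 1, …` of the variable `a` while they are less than `y`. -/
def Program.forRange (a : ℕ) (y : Expr) (P : Program) : Program :=
  .assign a 0 ;; .loop (.var a) y (P ;; .assign a (.var a + 1))

section

variable {R β : ℕ} {P : Program} {σ : Memory} {Q : Memory → Prop}

@[simp] theorem Expr.eval_add (x y : Expr) : (x + y).eval σ = x.eval σ + y.eval σ := rfl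

@[simp] theorem Expr.eval_sub (x y : Expr) : (x - y).eval σ = x.eval σ - y.eval σ := rfl

@[simp] theorem Expr.eval_mul (x y : Expr) : (x * y).eval σ = x.eval σ * y.eval σ := rfl

@[simp] theorem Expr.eval_div (x y : Expr) : (x / y).eval σ = x.eval σ / y.eval σ := rfl

@[simp] theorem Expr.eval_const (q : ℚ) : (Expr.const q).eval σ = q := rfl

@[simp] theorem Expr.eval_floor (x : Expr) : (Expr.floor x).eval σ = (⌊x.eval σ⌋ : ℤ) := rfl

@[simp] theorem Expr.eval_get (a : ℕ) (i : Expr) : (Expr.get a i).eval σ = σ a ⌊i.eval σ⌋₊ := rfl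

@[simp] theorem Expr.eval_ofNat (k : ℕ) : (no_index (OfNat.ofNat k : Expr)).eval σ = k := rfl

@[simp] theorem Expr.eval_var (a : ℕ) : (Expr.var a).eval σ = σ a 0 := by
  simp [Expr.var]

@[simp] theorem Expr.eval_ceil (x : Expr) : (Expr.ceil x).eval σ = (⌈x.eval σ⌉ : ℤ) := by
  simp [Expr.ceil, Int.floor_neg]

theorem Expr.eval_get_of_eval_eq {a k : ℕ} {i : Expr} (h : i.eval σ = k) :
    (Expr.get a i).eval σ = σ a k := by
  rw [eval_get, h, Nat.floor_natCast]

theorem store_of_ne (σ : Memory) {a b : ℕ} (h : b ≠ a) (k : ℕ) (q : ℚ) : store σ a k q b = σ b :=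
  Function.update_of_ne h _ _

theorem dependsOn_of_imp {p : Memory → Prop} {s : Set ℕ}
    (h : ∀ σ τ, (∀ a ∈ s, σ a = τ a) → p σ → p τ) : DependsOn p s := fun σ τ hστ =>
  propext ⟨h σ τ hστ, h τ σ fun a ha => (hστ a ha).symm⟩

theorem dependsOn_and {p q : Memory → Prop} {s t : Set ℕ} (hp : DependsOn p s)
    (hq : DependsOn q t) : DependsOn (fun σ => p σ ∧ q σ) (s ∪ t) := fun σ τ h => by
  simp only [hp fun a ha => h a (.inl ha), hq fun a ha => h a (.inr ha)]

namespace Halts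

theorem keep (h : Halts R β P σ Q) {p : Memory → Prop} {s : Set ℕ} (hp : DependsOn p s)
    (hP : ∀ a ∈ s, P.writes a = false) (hσ : p σ) : Halts R β P σ fun τ => p τ ∧ Q τ :=
  h.frame.mono fun _ _ ⟨heq, hQ⟩ => ⟨(hp fun a ha => heq a (hP a ha)).mpr hσ, hQ⟩

theorem assign {a : ℕ} {e : Expr} (hσ : Small β σ) (he : HeightLE β (e.eval σ))
    (h : Q (store σ a 0 (e.eval σ))) : Halts R β (.assign a e) σ Q :=
  .set hσ he (by simpa using h)

theorem set_of_eval_eq {a k : ℕ} {i e : Expr} {q : ℚ} (hσ : Small β σ) (hi : i.eval σ = k)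
    (he : e.eval σ = q) (hq : HeightLE β q) (h : Small β (store σ a k q) → Q (store σ a k q)) :
    Halts R β (.set a i e) σ Q :=
  .set hσ (he ▸ hq) (by simpa only [hi, he, Nat.floor_natCast] using h (hσ.store hq))

theorem forRange {a N : ℕ} {y : Expr} (I : ℕ → Memory → Prop) (hN : N ≤ R) (hβ : N + 1 ≤ 2 ^ β)
    (hσ : Small β σ) (hP : P.writes a = false) {s : Set ℕ}
    (hI : ∀ k, DependsOn (I k) s) (ha : a ∉ s)
    (hy : ∀ k τ, I k τ → y.eval τ = N) (hzero : I 0 σ)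
    (hstep : ∀ k < N, ∀ τ, Small β τ → I k τ → τ a 0 = k → Halts R β P τ (I (k + 1))) :
    Halts R β (.forRange a y P) σ (I N) := by
  have hstore {k : ℕ} {τ : Memory} (q : ℚ) (hτ : I k τ) : I k (store τ a 0 q) :=
    (hI k fun b hb => store_of_ne τ (ne_of_mem_of_not_mem hb ha) 0 q).mpr hτ
  have hheight {k : ℕ} (hk : k ≤ N) : HeightLE β (k : ℚ) := heightLE_natCast.2 (by omega)
  have hcounter (τ : Memory) (q : ℚ) : store τ a 0 q a 0 = q := by simp [store_apply]
  have hσ₀ : HeightLE β (Expr.eval σ 0) := by simpa using hheight N.zero_le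
  refine seq (assign hσ hσ₀ (loop (fun k τ => k ≤ N ∧ I k τ ∧ τ a 0 = k) hN (hσ.store hσ₀)
    ⟨N.zero_le, hstore _ hzero, by simp [hcounter]⟩ ?_ ?_))
  · rintro k τ hτ ⟨-, hIτ, hk⟩ hlt
    have hkN : k < N := by
      rw [hy k τ hIτ, Expr.eval_var, hk] at hlt
      exact_mod_cast hlt
    refine ⟨hkN, seq ((hstep k hkN τ hτ hIτ hk).frame.mono fun υ hυ ⟨hframe, hIυ⟩ => ?_)⟩
    have hsucc : (Expr.var a + 1).eval υ = (k + 1 : ℕ) := by simp [hframe a hP, hk]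
    refine assign hυ (hsucc ▸ hheight hkN) ⟨hkN, hstore _ hIυ, ?_⟩
    rw [hcounter, hsucc]
  · rintro k τ ⟨hkN, hIτ, hk⟩ hle
    rw [hy k τ hIτ, Expr.eval_var, hk, Nat.cast_le] at hle
    rwa [hkN.antisymm hle] at hIτ

end Halts

end

end RatRAM

namespace Assortment

/-- The names of the arrays of the algorithm. The array `0` holds the input and the array `1` the
output, as the machine model demands. -/
inductive Register
  | input | output | price | attraction | unitCost | tableCost | tableUnits | count | horizon
  | budget | bound | outside | unit | leader | peak | product | units | slots | portion | record
  | level | remUnits | remSlots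
  deriving DecidableEq

namespace Register

/-- The number by which the machine addresses the array. -/
def index (a : Register) : ℕ := a.ctorIdx

instance : Coe Register ℕ := ⟨index⟩

theorem index_injective : Function.Injective index :=
  Function.LeftInverse.injective (g := Register.ofNat) ofNat_ctorIdx

@[simp] theorem index_inj {a b : Register} : a.index = b.index ↔ a = b := index_injective.eq_iff

end Register

end Assortment

/-! ### The sales formulation of the linear program -/

namespace Assortment

section Selection

variable {ι : Type*} [Fintype ι] [DecidableEq ι] {z : ι → ℝ}

/-- The probability that exactly the elements of `S` are selected if each `i` is selected
independently with probability `z i`. -/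
def selectionProb (z : ι → ℝ) (S : Finset ι) : ℝ := (∏ i ∈ S, z i) * ∏ i ∈ Sᶜ, (1 - z i)

theorem sum_prod_mul_prod_compl (f g : ι → ℝ) :
    ∑ S : Finset ι, (∏ i ∈ S, f i) * ∏ i ∈ Sᶜ, g i = ∏ i, (f i + g i) := by
  simp only [Finset.prod_add, Finset.powerset_univ, Finset.compl_eq_univ_sdiff]

theorem selectionProb_nonneg (h₀ : ∀ i, 0 ≤ z i) (h₁ : ∀ i, z i ≤ 1) (S : Finset ι) :
    0 ≤ selectionProb z S :=
  mul_nonneg (Finset.prod_nonneg fun i _ => h₀ i)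
    (Finset.prod_nonneg fun i _ => sub_nonneg.2 (h₁ i))

theorem sum_selectionProb (z : ι → ℝ) : ∑ S, selectionProb z S = 1 := by
  simp [selectionProb, sum_prod_mul_prod_compl]

theorem sum_selectionProb_of_mem (z : ι → ℝ) (i : ι) :
    ∑ S, (if i ∈ S then selectionProb z S else 0) = z i := by
  have hweight (S : Finset ι) : (if i ∈ S then selectionProb z S else 0) =
      (∏ l ∈ S, z l) * ∏ l ∈ Sᶜ, Function.update (fun l => 1 - z l) i 0 l := by
    split_ifs with hi
    · rw [selectionProb, Finset.prod_update_of_notMem (by simpa using hi)]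
    · rw [Finset.prod_eq_zero (Finset.mem_compl.2 hi) (by simp), mul_zero]
  simp_rw [hweight, sum_prod_mul_prod_compl]
  rw [Finset.prod_eq_single i] <;> simp +contextual

theorem sum_selectionProb_mul_sum (z a : ι → ℝ) :
    ∑ S, selectionProb z S * ∑ i ∈ S, a i = ∑ i, a i * z i := by
  calc ∑ S, selectionProb z S * ∑ i ∈ S, a i
      = ∑ S, ∑ i, a i * (if i ∈ S then selectionProb z S else 0) := by
        simp [Finset.mul_sum, mul_comm]
    _ = ∑ i, a i * z i := by
        rw [Finset.sum_comm]
        simp_rw [← Finset.mul_sum, sum_selectionProb_of_mem]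

end Selection

/-- Sales `x i` of the products in `s` and `x₀` of the outside option that an inventory `c` admits
for `T` customers. Choosing the assortments well, one attains any sales with `x i ≤ v i * x₀`. -/
structure IsSales {ι K : Type*} [Semiring K] [PartialOrder K] (s : Finset ι) (v c : ι → K) (T : K)
    (x : ι → K) (x₀ : K) : Prop where
  nonneg : ∀ i ∈ s, 0 ≤ x i
  le_inventory : ∀ i ∈ s, x i ≤ c i
  le_attraction : ∀ i ∈ s, x i ≤ v i * x₀
  outside_nonneg : 0 ≤ x₀
  total_le : ∑ i ∈ s, x i + x₀ ≤ T

section Rescaling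

variable {ι K : Type*} [CommRing K] [PartialOrder K] [IsOrderedRing K] {s : Finset ι}
  {v c x : ι → K} {T x₀ : K}

theorem IsSales.fill (hx : IsSales s v c T x x₀) (hv : ∀ i, 0 ≤ v i) :
    IsSales s v c T x (T - ∑ i ∈ s, x i) where
  nonneg := hx.nonneg
  le_inventory := hx.le_inventory
  le_attraction i hi := (hx.le_attraction i hi).trans
    (mul_le_mul_of_nonneg_left (le_sub_iff_add_le'.2 hx.total_le) (hv i))
  outside_nonneg := hx.outside_nonneg.trans (le_sub_iff_add_le'.2 hx.total_le)
  total_le := (add_sub_cancel _ _).le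

theorem IsSales.rescale (hx : IsSales s v c T x x₀) (hv : ∀ i, 0 ≤ v i) {θ x₀' : K} (hθ₀ : 0 ≤ θ)
    (hθ₁ : θ ≤ 1) (h₀ : θ * x₀ ≤ x₀') (h₁ : x₀' ≤ x₀) :
    IsSales s v c T (fun i => θ * x i) x₀' where
  nonneg i hi := mul_nonneg hθ₀ (hx.nonneg i hi)
  le_inventory i hi := (mul_le_of_le_one_left (hx.nonneg i hi) hθ₁).trans (hx.le_inventory i hi)
  le_attraction i hi := by
    refine (mul_le_mul_of_nonneg_left (hx.le_attraction i hi) hθ₀).trans ?_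
    rw [mul_left_comm]
    exact mul_le_mul_of_nonneg_left h₀ (hv i)
  outside_nonneg := (mul_nonneg hθ₀ hx.outside_nonneg).trans h₀
  total_le := by
    refine le_trans (add_le_add (Finset.sum_le_sum fun i hi => ?_) h₁) hx.total_le
    exact mul_le_of_le_one_left (hx.nonneg i hi) hθ₁

end Rescaling

section Sales

variable {n : ℕ} {r v c : Fin n → ℝ} {T : ℝ} {y : Finset (Fin n) → ℝ} {x : Fin n → ℝ} {x₀ : ℝ}

theorem sum_add_one_pos (hv : ∀ i, 0 ≤ v i) (S : Finset (Fin n)) : 0 < ∑ j ∈ S, v j + 1 :=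
  add_pos_of_nonneg_of_pos (Finset.sum_nonneg fun i _ => hv i) one_pos

theorem choiceProb_nonneg (hv : ∀ i, 0 ≤ v i) (i : Fin n) (S : Finset (Fin n)) :
    0 ≤ choiceProb v i S := by
  have := sum_add_one_pos hv S
  have := hv i
  unfold choiceProb
  split_ifs <;> positivity

theorem choiceProb_le (hv : ∀ i, 0 ≤ v i) (i : Fin n) (S : Finset (Fin n)) :
    choiceProb v i S ≤ v i / (∑ j ∈ S, v j + 1) := by
  have := sum_add_one_pos hv S
  have := hv i
  unfold choiceProb
  split_ifs
  exacts [le_rfl, by positivity]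

theorem sum_choiceProb_add (hv : ∀ i, 0 ≤ v i) (S : Finset (Fin n)) :
    ∑ i, choiceProb v i S + 1 / (∑ j ∈ S, v j + 1) = 1 := by
  simp only [choiceProb]
  rw [Finset.sum_ite_mem, Finset.univ_inter, ← Finset.sum_div, ← add_div,
    div_self (sum_add_one_pos hv S).ne']

theorem mul_sum_revenue (r v : Fin n → ℝ) (T : ℝ) (y : Finset (Fin n) → ℝ) :
    T * ∑ S, y S * revenue r v S = ∑ i, r i * (T * ∑ S, y S * choiceProb v i S) := by
  simp only [revenue, Finset.mul_sum]
  rw [Finset.sum_comm]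
  exact Finset.sum_congr rfl fun i _ => Finset.sum_congr rfl fun S _ => by ring

theorem IsMix.isSales (hy : IsMix v c T y) (hv : ∀ i, 0 ≤ v i) (hT : 0 ≤ T) :
    IsSales Finset.univ v c T (fun i => T * ∑ S, y S * choiceProb v i S)
      (T * ∑ S, y S * (1 / (∑ j ∈ S, v j + 1))) where
  nonneg i _ := mul_nonneg hT
    (Finset.sum_nonneg fun S _ => mul_nonneg (hy.1 S) (choiceProb_nonneg hv i S))
  le_inventory i _ := hy.2.1 i
  le_attraction i _ := by
    rw [mul_left_comm]
    refine mul_le_mul_of_nonneg_left ?_ hT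
    rw [Finset.mul_sum]
    refine Finset.sum_le_sum fun S _ => ?_
    rw [mul_left_comm, mul_one_div]
    exact mul_le_mul_of_nonneg_left (choiceProb_le hv i S) (hy.1 S)
  outside_nonneg := mul_nonneg hT
    (Finset.sum_nonneg fun S _ => mul_nonneg (hy.1 S) (one_div_pos.2 (sum_add_one_pos hv S)).le)
  total_le := by
    rw [← Finset.mul_sum, ← mul_add, Finset.sum_comm, ← Finset.sum_add_distrib]
    simp_rw [← Finset.mul_sum, ← mul_add, sum_choiceProb_add hv, mul_one, hy.2.2, mul_one]
    exact le_rfl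

/-- The assortment `S` is offered with the probability that it is selected, reweighted by
`∑ j ∈ S, v j + 1` so that the sales of product `i` become linear in its selection probability. -/
noncomputable def selectionMix (v z : Fin n → ℝ) (p : ℝ) (S : Finset (Fin n)) : ℝ :=
  p * selectionProb z S * (∑ j ∈ S, v j + 1)

theorem sum_selectionMix (v z : Fin n → ℝ) (p : ℝ) :
    ∑ S, selectionMix v z p S = p * (∑ i, v i * z i + 1) := by
  simp_rw [selectionMix, mul_assoc]
  rw [← Finset.mul_sum]
  simp_rw [mul_add_one]
  rw [Finset.sum_add_distrib, sum_selectionProb_mul_sum, sum_selectionProb]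
  ring

theorem sum_selectionMix_mul_choiceProb (hv : ∀ i, 0 ≤ v i) (z : Fin n → ℝ) (p : ℝ) (i : Fin n) :
    ∑ S, selectionMix v z p S * choiceProb v i S = p * (v i * z i) := by
  rw [← sum_selectionProb_of_mem z i, Finset.mul_sum, Finset.mul_sum]
  refine Finset.sum_congr rfl fun S _ => ?_
  have := (sum_add_one_pos hv S).ne'
  unfold selectionMix choiceProb
  split_ifs
  · field_simp
  · simp

theorem IsSales.exists_isMix (hx : IsSales Finset.univ v c T x x₀) (hv : ∀ i, 0 ≤ v i)
    (hT : 0 < T) (htotal : ∑ i, x i + x₀ = T) :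
    ∃ y, IsMix v c T y ∧ ∀ i, T * ∑ S, y S * choiceProb v i S = x i := by
  set z : Fin n → ℝ := fun i => x i / (v i * x₀)
  have hx₀ := hx.outside_nonneg
  have hvx i : 0 ≤ v i * x₀ := mul_nonneg (hv i) hx₀
  have hxz i : v i * z i * x₀ = x i := by
    rw [mul_right_comm]
    refine mul_div_cancel_of_imp' fun h => le_antisymm ?_ (hx.nonneg i (Finset.mem_univ i))
    exact h ▸ hx.le_attraction i (Finset.mem_univ i)
  have hsales i : T * ∑ S, selectionMix v z (x₀ / T) S * choiceProb v i S = x i := by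
    rw [sum_selectionMix_mul_choiceProb hv, ← hxz i]
    field_simp
  refine ⟨selectionMix v z (x₀ / T), ⟨fun S => ?_, fun i => ?_, ?_⟩, hsales⟩
  · have hprob := selectionProb_nonneg (z := z)
      (fun i => div_nonneg (hx.nonneg i (Finset.mem_univ i)) (hvx i))
      (fun i => div_le_one_of_le₀ (hx.le_attraction i (Finset.mem_univ i)) (hvx i)) S
    have := sum_add_one_pos hv S
    unfold selectionMix
    positivity
  · rw [hsales i]
    exact hx.le_inventory i (Finset.mem_univ i)
  · rw [sum_selectionMix, div_mul_eq_mul_div, mul_add_one, Finset.mul_sum]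
    simp_rw [mul_comm x₀, hxz]
    rw [htotal, div_self hT.ne']

theorem bddAbove_mix_revenue (hr : ∀ i, 0 ≤ r i) :
    BddAbove {a : ℝ | ∃ y, IsMix v c T y ∧ a = T * ∑ S, y S * revenue r v S} := by
  refine ⟨∑ i, r i * c i, ?_⟩
  rintro _ ⟨y, hy, rfl⟩
  rw [mul_sum_revenue]
  exact Finset.sum_le_sum fun i _ => mul_le_mul_of_nonneg_left (hy.2.1 i) (hr i)

theorem IsSales.exists_isMix_revenue (hx : IsSales Finset.univ v c T x x₀) (hv : ∀ i, 0 ≤ v i)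
    (r : Fin n → ℝ) :
    ∃ y, IsMix v c T y ∧ ∑ i, r i * x i = T * ∑ S, y S * revenue r v S := by
  have hx_nonneg i := hx.nonneg i (Finset.mem_univ i)
  have hsum : 0 ≤ ∑ i, x i := Finset.sum_nonneg fun i _ => hx_nonneg i
  have hx₀ := hx.outside_nonneg
  have htotal := hx.total_le
  rcases (add_nonneg hsum hx₀ |>.trans htotal).eq_or_lt with rfl | hT
  · have hzero i : x i = 0 := by
      have := Finset.single_le_sum (fun j _ => hx_nonneg j) (Finset.mem_univ i)
      linarith [hx_nonneg i]
    refine ⟨fun S => if S = ∅ then 1 else 0, ⟨fun S => by positivity, fun i => ?_, by simp⟩,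
      by simp [hzero]⟩
    simpa [hzero] using hx.le_inventory i (Finset.mem_univ i)
  · obtain ⟨y, hy, hsales⟩ := (hx.fill hv).exists_isMix hv hT (add_sub_cancel _ _)
    exact ⟨y, hy, by simp_rw [mul_sum_revenue, hsales]⟩

theorem IsSales.revenue_le_fLP (hx : IsSales Finset.univ v c T x x₀) (hr : ∀ i, 0 ≤ r i)
    (hv : ∀ i, 0 ≤ v i) : ∑ i, r i * x i ≤ fLP r v c T :=
  le_csSup (bddAbove_mix_revenue hr) (hx.exists_isMix_revenue hv r)

theorem fLP_le (hv : ∀ i, 0 ≤ v i) (hT : 0 ≤ T) {A : ℝ} (hA : 0 ≤ A)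
    (h : ∀ x x₀, IsSales Finset.univ v c T x x₀ → ∑ i, r i * x i ≤ A) : fLP r v c T ≤ A := by
  refine Real.sSup_le ?_ hA
  rintro _ ⟨y, hy, rfl⟩
  rw [mul_sum_revenue]
  exact h _ _ (hy.isSales hv hT)

end Sales

end Assortment

/-! ### Discretized plans -/

namespace Assortment

/-- A budgeted instance whose data are extended to sequences, as they are held in the memory of the
machine. -/
structure BudgetData where
  n : ℕ
  r : ℕ → ℚ
  v : ℕ → ℚ
  b : ℕ → ℚ
  T : ℚ
  B : ℚ
  r_nonneg : ∀ i, 0 ≤ r i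
  v_nonneg : ∀ i, 0 ≤ v i
  b_nonneg : ∀ i, 0 ≤ b i
  T_nonneg : 0 ≤ T
  B_nonneg : 0 ≤ B

/-- The inventory `c` admits the sales `x` of the products and `x₀` of the outside option. -/
abbrev BudgetData.AdmitsSales (D : BudgetData) (c : ℕ → ℕ) (x : ℕ → ℝ) (x₀ : ℝ) : Prop :=
  IsSales (Finset.range D.n) (fun i => (D.v i : ℝ)) (fun i => (c i : ℝ)) D.T x x₀

/-- A guess for the sales `x₀` of the outside option and a unit of revenue `g`. Relative to it,
revenues are counted in units of `g`, and the capacity `T - x₀` that is left for the products is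
divided into `N * n` slots. -/
structure Guess (D : BudgetData) (N : ℕ) where
  x₀ : ℚ
  g : ℚ
  one_lt : 1 < N
  x₀_nonneg : 0 ≤ x₀
  x₀_lt : x₀ < D.T
  g_pos : 0 < g

/-- The share of the sales that remains after each rounding by one part in `N`. -/
def shrink (N : ℕ) : ℚ := 1 - 1 / N

theorem shrink_pos {N : ℕ} (hN : 1 < N) : 0 < shrink N := by
  rw [shrink, sub_pos, div_lt_one (by positivity)]
  exact_mod_cast hN

theorem shrink_lt_one {N : ℕ} (hN : 1 < N) : shrink N < 1 :=
  sub_lt_self _ (by positivity)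

namespace Guess

variable {D : BudgetData} {N : ℕ} (G : Guess D N)

/-- The sales of product `i` that yield `p` units of revenue. -/
def amount (i p : ℕ) : ℚ := p * G.g / D.r i

/-- The number of slots, rounded down, that `p` units of revenue from product `i` take up. -/
def slots (i p : ℕ) : ℕ := ⌊G.amount i p * (N * D.n) / (D.T - G.x₀)⌋₊

/-- The cost of the inventory for `p` units of revenue from product `i`. -/
def cost (i p : ℕ) : ℚ := D.b i * ⌈G.amount i p⌉

/-- The attraction of product `i` suffices for `p` units of revenue. -/
def Attains (i p : ℕ) : Prop := p * G.g ≤ D.r i * (D.v i * G.x₀)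

/-- By means of `p i` units of revenue from each product `i < k`, one gets `P` units of revenue in
`S` slots. -/
structure IsPlan (k : ℕ) (p : ℕ → ℕ) (P S : ℕ) : Prop where
  attains : ∀ i < k, G.Attains i (p i)
  sum_units : ∑ i ∈ Finset.range k, p i = P
  sum_slots : ∑ i ∈ Finset.range k, G.slots i (p i) = S

/-- Every affordable plan that fits into the table of the dynamic program has revenue at most
`a`. -/
def Dominated (a : ℚ) : Prop :=
  ∀ p P S, G.IsPlan D.n p P S → P ≤ N * D.n * D.n → S ≤ N * D.n →
    ∑ i ∈ Finset.range D.n, G.cost i (p i) ≤ D.B → P * G.g ≤ a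

variable {G} {i p : ℕ}

theorem amount_nonneg : 0 ≤ G.amount i p :=
  div_nonneg (mul_nonneg p.cast_nonneg G.g_pos.le) (D.r_nonneg i)

theorem amount_le {x : ℝ} (hx : 0 ≤ x) (h : p * (G.g : ℝ) ≤ D.r i * x) :
    (G.amount i p : ℝ) ≤ x := by
  unfold amount
  push_cast
  exact div_le_of_le_mul₀ (by exact_mod_cast D.r_nonneg i) hx (h.trans_eq (mul_comm _ _))

theorem Attains.mul_amount (h : G.Attains i p) : D.r i * G.amount i p = p * G.g := by
  refine mul_div_cancel_of_imp' fun h₀ => ?_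
  rw [Attains, h₀, zero_mul] at h
  exact h.antisymm (mul_nonneg p.cast_nonneg G.g_pos.le)

theorem Attains.amount_le (h : G.Attains i p) : G.amount i p ≤ D.v i * G.x₀ :=
  div_le_of_le_mul₀ (D.r_nonneg i) (mul_nonneg (D.v_nonneg i) G.x₀_nonneg)
    (h.trans_eq (mul_comm _ _))

theorem sum_amount_mul_le (G : Guess D N) (p : ℕ → ℕ) :
    (∑ i ∈ Finset.range D.n, G.amount i (p i)) * (N * D.n) ≤
      ((∑ i ∈ Finset.range D.n, G.slots i (p i) : ℕ) + D.n) * (D.T - G.x₀) := by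
  have hterm i : G.amount i (p i) * (N * D.n) ≤ (G.slots i (p i) + 1) * (D.T - G.x₀) := by
    rw [← div_le_iff₀ (sub_pos.2 G.x₀_lt)]
    exact (Nat.lt_floor_add_one _).le
  rw [Finset.sum_mul]
  refine (Finset.sum_le_sum fun i _ => hterm i).trans_eq ?_
  simp [← Finset.sum_mul, Finset.sum_add_distrib]

theorem IsPlan.shrunk_sum_amount_le {p : ℕ → ℕ} {P S : ℕ} (h : G.IsPlan D.n p P S)
    (hS : S ≤ N * D.n) :
    shrink N * ∑ i ∈ Finset.range D.n, G.amount i (p i) ≤ D.T - G.x₀ := by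
  have hW := sub_pos.2 G.x₀_lt
  rcases D.n.eq_zero_or_pos with hn | hn
  · simp [hn, hW.le]
  have hn' : (0 : ℚ) < D.n := by exact_mod_cast hn
  have hN : (1 : ℚ) < N := by exact_mod_cast G.one_lt
  have hS' : (S : ℚ) ≤ N * D.n := by exact_mod_cast hS
  have hsum := G.sum_amount_mul_le p
  rw [h.sum_slots] at hsum
  set A := ∑ i ∈ Finset.range D.n, G.amount i (p i)
  set W := D.T - G.x₀
  have hA : A * N ≤ (N + 1) * W := by
    refine le_of_mul_le_mul_right ?_ hn'
    calc A * N * D.n = A * (N * D.n) := by ring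
      _ ≤ (S + D.n) * W := hsum
      _ ≤ (N * D.n + D.n) * W := by gcongr
      _ = (N + 1) * W * D.n := by ring
  have hA_le : A ≤ (1 + 1 / N) * W := by
    rw [one_add_div (by positivity), div_mul_eq_mul_div, le_div_iff₀ (by positivity)]
    exact hA
  have hθ := (shrink_pos G.one_lt).le
  calc shrink N * A ≤ shrink N * ((1 + 1 / N) * W) := by gcongr
    _ = (1 - (1 / N) ^ 2) * W := by
      rw [shrink]
      ring
    _ ≤ W := mul_le_of_le_one_left hW.le (sub_le_self _ (sq_nonneg _))

/-- The slots are rounded down, so that the amounts may exceed the capacity by one slot for each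
product; shrinking all of them makes up for that. -/
theorem IsPlan.isSales {p : ℕ → ℕ} {P S : ℕ} (h : G.IsPlan D.n p P S) (hS : S ≤ N * D.n) :
    IsSales (Finset.range D.n) D.v (fun i => (⌈G.amount i (p i)⌉₊ : ℚ)) D.T
      (fun i => shrink N * G.amount i (p i)) G.x₀ := by
  have hθ := (shrink_pos G.one_lt).le
  have hshrink i : shrink N * G.amount i (p i) ≤ G.amount i (p i) :=
    mul_le_of_le_one_left amount_nonneg (shrink_lt_one G.one_lt).le
  exact {
    nonneg := fun i _ => mul_nonneg hθ amount_nonneg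
    le_inventory := fun i _ => (hshrink i).trans (Nat.le_ceil _)
    le_attraction := fun i hi =>
      (hshrink i).trans (h.attains i (Finset.mem_range.1 hi)).amount_le
    outside_nonneg := G.x₀_nonneg
    total_le := by
      rw [← Finset.mul_sum, ← le_sub_iff_add_le]
      exact h.shrunk_sum_amount_le hS }

theorem IsPlan.revenue_eq {p : ℕ → ℕ} {P S : ℕ} (h : G.IsPlan D.n p P S) (θ : ℚ) :
    ∑ i ∈ Finset.range D.n, D.r i * (θ * G.amount i (p i)) = θ * (P * G.g) := by
  rw [← h.sum_units, Nat.cast_sum, Finset.sum_mul, Finset.mul_sum]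
  refine Finset.sum_congr rfl fun i hi => ?_
  rw [mul_left_comm, (h.attains i (Finset.mem_range.1 hi)).mul_amount]

section Rounding

variable {c : ℕ → ℕ} {x : ℕ → ℝ}

/-- The units of revenue, rounded down, that the sales `x` yield. -/
noncomputable def units (G : Guess D N) (x : ℕ → ℝ) (i : ℕ) : ℕ := ⌊D.r i * x i / G.g⌋₊

theorem units_mul_le (hx : 0 ≤ x i) : G.units x i * (G.g : ℝ) ≤ D.r i * x i := by
  have hg : (0 : ℝ) < G.g := by exact_mod_cast G.g_pos
  have hr : (0 : ℝ) ≤ D.r i := by exact_mod_cast D.r_nonneg i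
  rw [← le_div_iff₀ hg]
  exact Nat.floor_le (by positivity)

theorem amount_units_le (hx : 0 ≤ x i) : (G.amount i (G.units x i) : ℝ) ≤ x i :=
  amount_le hx (units_mul_le hx)

theorem revenue_le_sum_units (G : Guess D N) (x : ℕ → ℝ) :
    ∑ i ∈ Finset.range D.n, D.r i * x i ≤
      ((∑ i ∈ Finset.range D.n, G.units x i : ℕ) + D.n) * (G.g : ℝ) := by
  have hg : (0 : ℝ) < G.g := by exact_mod_cast G.g_pos
  have hterm i : D.r i * x i ≤ (G.units x i + 1) * (G.g : ℝ) := by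
    rw [← div_le_iff₀ hg]
    exact (Nat.lt_floor_add_one _).le
  refine (Finset.sum_le_sum fun i _ => hterm i).trans_eq ?_
  simp [← Finset.sum_mul, Finset.sum_add_distrib]

theorem isPlan_units (hx : D.AdmitsSales c x G.x₀) :
    G.IsPlan D.n (G.units x) (∑ i ∈ Finset.range D.n, G.units x i)
      (∑ i ∈ Finset.range D.n, G.slots i (G.units x i)) where
  attains i hi := by
    have hi' := Finset.mem_range.2 hi
    have hr : (0 : ℝ) ≤ D.r i := by exact_mod_cast D.r_nonneg i
    have h := (units_mul_le (G := G) (hx.nonneg i hi')).trans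
      (mul_le_mul_of_nonneg_left (hx.le_attraction i hi') hr)
    exact_mod_cast h
  sum_units := rfl
  sum_slots := rfl

theorem sum_units_le (hmax : ∀ i < D.n, D.r i * x i ≤ (N * D.n * G.g : ℚ)) :
    ∑ i ∈ Finset.range D.n, G.units x i ≤ N * D.n * D.n := by
  have hg : (0 : ℝ) < G.g := by exact_mod_cast G.g_pos
  refine (Finset.sum_le_card_nsmul _ _ (N * D.n) fun i hi => ?_).trans_eq ?_
  · refine Nat.floor_le_of_le ?_
    rw [div_le_iff₀ hg]
    exact_mod_cast hmax i (Finset.mem_range.1 hi)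
  · rw [Finset.card_range, smul_eq_mul, mul_comm]

theorem sum_slots_units_le (hx : D.AdmitsSales c x G.x₀) :
    ∑ i ∈ Finset.range D.n, G.slots i (G.units x i) ≤ N * D.n := by
  have hW : (0 : ℝ) < D.T - G.x₀ := by
    rw [sub_pos]
    exact_mod_cast G.x₀_lt
  have hterm i (hi : i ∈ Finset.range D.n) :
      (G.slots i (G.units x i) : ℝ) ≤ x i * ((N * D.n) / (D.T - G.x₀)) := by
    have hslots : (G.slots i (G.units x i) : ℚ) ≤
        G.amount i (G.units x i) * (N * D.n) / (D.T - G.x₀) :=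
      Nat.floor_le (div_nonneg (mul_nonneg amount_nonneg (by positivity))
        (sub_nonneg.2 G.x₀_lt.le))
    have hslots' : (G.slots i (G.units x i) : ℝ) ≤
        G.amount i (G.units x i) * ((N * D.n) / (D.T - G.x₀)) := by
      rw [← mul_div_assoc]
      exact_mod_cast hslots
    refine hslots'.trans ?_
    gcongr
    exact amount_units_le (hx.nonneg i hi)
  have hsum : ∑ i ∈ Finset.range D.n, x i ≤ D.T - G.x₀ := le_sub_iff_add_le.2 hx.total_le
  have h : ((∑ i ∈ Finset.range D.n, G.slots i (G.units x i) : ℕ) : ℝ) ≤ (N * D.n : ℕ) := by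
    push_cast
    refine (Finset.sum_le_sum hterm).trans ?_
    rw [← Finset.sum_mul, mul_div_assoc', div_le_iff₀ hW, mul_comm]
    gcongr
  exact_mod_cast h

theorem sum_cost_units_le (hx : D.AdmitsSales c x G.x₀) :
    ∑ i ∈ Finset.range D.n, G.cost i (G.units x i) ≤ ∑ i ∈ Finset.range D.n, D.b i * c i := by
  refine Finset.sum_le_sum fun i hi => mul_le_mul_of_nonneg_left ?_ (D.b_nonneg i)
  have h : (G.amount i (G.units x i) : ℝ) ≤ c i :=
    (amount_units_le (hx.nonneg i hi)).trans (hx.le_inventory i hi)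
  have hceil : ⌈G.amount i (G.units x i)⌉ ≤ (c i : ℤ) := Int.ceil_le.2 (by exact_mod_cast h)
  exact_mod_cast hceil

theorem Dominated.revenue_le {a : ℚ} (ha : G.Dominated a)
    (hx : D.AdmitsSales c x G.x₀)
    (hc : ∑ i ∈ Finset.range D.n, D.b i * c i ≤ D.B)
    (hmax : ∀ i < D.n, D.r i * x i ≤ (N * D.n * G.g : ℚ)) :
    ∑ i ∈ Finset.range D.n, D.r i * x i ≤ (a + D.n * G.g : ℚ) := by
  have h := ha _ _ _ (isPlan_units hx) (sum_units_le hmax) (sum_slots_units_le hx)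
    ((sum_cost_units_le hx).trans hc)
  refine (G.revenue_le_sum_units x).trans ?_
  have h' : ((∑ i ∈ Finset.range D.n, G.units x i : ℕ) + D.n) * G.g ≤ a + D.n * G.g := by
    linarith
  exact_mod_cast h'

end Rounding

end Guess

end Assortment

/-! ### Near-optimality of the guesses -/

namespace Assortment

namespace BudgetData

variable (D : BudgetData)

/-- The largest sales of product `j` alone that the attraction, the capacity `T - x₀` and the budget
allow. -/
def peak (j : ℕ) (x₀ : ℚ) : ℚ :=
  if D.B < D.b j * ⌈min (D.v j * x₀) (D.T - x₀)⌉ then ⌊D.B / D.b j⌋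
  else min (D.v j * x₀) (D.T - x₀)

/-- The unit of revenue that is guessed if product `j` has the largest peak revenue. -/
def unit (N j : ℕ) (x₀ : ℚ) : ℚ := D.r j * D.peak j x₀ / (N * D.n)

/-- The value `a` is at least the revenue of every affordable plan for the guess given by product
`j` and sales `x₀` of the outside option. -/
def Dominated (N j : ℕ) (x₀ a : ℚ) : Prop :=
  ∀ G : Guess D N, G.x₀ = x₀ → G.g = D.unit N j x₀ → G.Dominated a

variable {D} {N i j : ℕ} {x₀ : ℚ}

theorem b_pos_of_budget_lt {q : ℚ} (h : D.B < D.b j * q) : 0 < D.b j :=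
  (D.b_nonneg j).lt_of_ne fun h₀ => by
    rw [← h₀, zero_mul] at h
    exact absurd D.B_nonneg h.not_ge

theorem peak_le (D : BudgetData) (j : ℕ) (x₀ : ℚ) :
    D.peak j x₀ ≤ min (D.v j * x₀) (D.T - x₀) := by
  unfold peak
  split_ifs with h
  · have hlt : ⌊D.B / D.b j⌋ < ⌈min (D.v j * x₀) (D.T - x₀)⌉ := by
      rw [Int.floor_lt, div_lt_iff₀' (b_pos_of_budget_lt h)]
      exact h
    exact (Int.lt_ceil.1 hlt).le
  · exact le_rfl

theorem peak_nonneg (h₀ : 0 ≤ x₀) (hT : x₀ ≤ D.T) : 0 ≤ D.peak j x₀ := by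
  unfold peak
  split_ifs
  · exact_mod_cast Int.floor_nonneg.2 (div_nonneg D.B_nonneg (D.b_nonneg j))
  · exact le_min (mul_nonneg (D.v_nonneg j) h₀) (sub_nonneg.2 hT)

theorem mul_ceil_peak_le (D : BudgetData) (j : ℕ) (x₀ : ℚ) : D.b j * ⌈D.peak j x₀⌉ ≤ D.B := by
  unfold peak
  split_ifs with h
  · rw [Int.ceil_intCast, ← le_div_iff₀' (b_pos_of_budget_lt h)]
    exact Int.floor_le _
  · exact not_lt.1 h

theorem le_peak {c : ℕ} {x : ℝ} (hv : x ≤ D.v j * x₀) (hT : x ≤ D.T - x₀) (hc : x ≤ c)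
    (hB : D.b j * c ≤ D.B) : x ≤ D.peak j x₀ := by
  unfold peak
  split_ifs with h
  · have hfloor : (c : ℤ) ≤ ⌊D.B / D.b j⌋ := by
      rw [Int.le_floor, le_div_iff₀' (b_pos_of_budget_lt h)]
      exact_mod_cast hB
    exact hc.trans (by exact_mod_cast hfloor)
  · push_cast
    exact le_min hv hT

theorem AdmitsSales.le_peak {c : ℕ → ℕ} {x : ℕ → ℝ} (hx : D.AdmitsSales c x x₀)
    (hc : ∑ i ∈ Finset.range D.n, D.b i * c i ≤ D.B) (hi : i < D.n) : x i ≤ D.peak i x₀ := by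
  have hi' := Finset.mem_range.2 hi
  refine D.le_peak (hx.le_attraction i hi') ?_ (hx.le_inventory i hi') ?_
  · refine le_sub_iff_add_le.2 (le_trans ?_ hx.total_le)
    gcongr
    exact Finset.single_le_sum hx.nonneg hi'
  · exact (Finset.single_le_sum (f := fun i => D.b i * (c i : ℚ))
      (fun l _ => mul_nonneg (D.b_nonneg l) (Nat.cast_nonneg _)) hi').trans hc

theorem admitsSales_peak (h₀ : 0 ≤ x₀) (hT : x₀ ≤ D.T) :
    D.AdmitsSales (Pi.single j ⌈D.peak j x₀⌉₊) (Pi.single j (D.peak j x₀ : ℝ)) x₀ := by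
  have hpeak := D.peak_le j x₀
  have hpeak₀ := D.peak_nonneg (j := j) h₀ hT
  have hterm i : 0 ≤ (Pi.single j (D.peak j x₀) : ℕ → ℚ) i ∧
      (Pi.single j (D.peak j x₀) : ℕ → ℚ) i ≤ (Pi.single j ⌈D.peak j x₀⌉₊ : ℕ → ℕ) i ∧
      (Pi.single j (D.peak j x₀) : ℕ → ℚ) i ≤ D.v i * x₀ := by
    rcases eq_or_ne i j with rfl | hij
    · simpa [hpeak₀, Nat.le_ceil] using hpeak.trans (min_le_left _ _)
    · simpa [hij] using mul_nonneg (D.v_nonneg i) h₀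
  have hcast i : (Pi.single j (D.peak j x₀ : ℝ) : ℕ → ℝ) i =
      ((Pi.single j (D.peak j x₀) : ℕ → ℚ) i : ℚ) := by
    rcases eq_or_ne i j with rfl | hij <;> simp [*]
  have htotal : (∑ i ∈ Finset.range D.n, (Pi.single j (D.peak j x₀) : ℕ → ℚ) i) + x₀ ≤ D.T := by
    rw [Finset.sum_pi_single', ← le_sub_iff_add_le]
    split_ifs
    exacts [hpeak.trans (min_le_right _ _), sub_nonneg.2 hT]
  refine ⟨fun i _ => ?_, fun i _ => ?_, fun i _ => ?_, by exact_mod_cast h₀, ?_⟩ <;>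
    simp only [hcast]
  · exact_mod_cast (hterm i).1
  · exact_mod_cast (hterm i).2.1
  · exact_mod_cast (hterm i).2.2
  · exact_mod_cast htotal

theorem mul_unit (hN : N ≠ 0) (hn : D.n ≠ 0) (j : ℕ) (x₀ : ℚ) :
    N * D.n * D.unit N j x₀ = D.r j * D.peak j x₀ := by
  unfold unit
  field_simp

end BudgetData

variable {D : BudgetData} {N j : ℕ} {a : ℚ}

/-- Selling product `j` alone, one attains `N * n` units of revenue; at most `n` of them get lost by
rounding. -/
theorem Guess.Dominated.mul_unit_le {G : Guess D N} (ha : G.Dominated a) (hj : j < D.n)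
    (hg : G.g = D.unit N j G.x₀) : (N - 1) * (D.n * G.g) ≤ a := by
  have hunit := D.mul_unit (Nat.ne_zero_of_lt G.one_lt) (Nat.ne_zero_of_lt hj) j G.x₀
  rw [← hg] at hunit
  have hsales := D.admitsSales_peak (j := j) G.x₀_nonneg G.x₀_lt.le
  have hbudget : ∑ i ∈ Finset.range D.n, D.b i *
      ((Pi.single j ⌈D.peak j G.x₀⌉₊ : ℕ → ℕ) i : ℚ) ≤ D.B := by
    have hceil := D.mul_ceil_peak_le j G.x₀
    rw [← natCast_ceil_eq_intCast_ceil (D.peak_nonneg G.x₀_nonneg G.x₀_lt.le)] at hceil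
    simpa [Pi.single_apply, hj] using hceil
  have hrevenue := ha.revenue_le hsales hbudget fun i _ => by
    rcases eq_or_ne i j with rfl | hij
    · rw [hunit]
      simp
    · have := G.g_pos
      simpa [hij] using by positivity
  have hrevenue' : D.r j * D.peak j G.x₀ ≤ a + D.n * G.g := by
    simp only [Pi.single_apply, mul_ite, mul_zero, Finset.sum_ite_eq', Finset.mem_range, hj,
      if_true] at hrevenue
    exact_mod_cast hrevenue
  linarith

theorem Guess.Dominated.shrunk_revenue_le {G : Guess D N} (ha : G.Dominated a) (hj : j < D.n)
    (hg : G.g = D.unit N j G.x₀)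
    (hmax : ∀ i < D.n, D.r i * D.peak i G.x₀ ≤ D.r j * D.peak j G.x₀) {c : ℕ → ℕ} {x : ℕ → ℝ}
    (hx : D.AdmitsSales c x G.x₀) (hc : ∑ i ∈ Finset.range D.n, D.b i * c i ≤ D.B) :
    shrink N * ∑ i ∈ Finset.range D.n, D.r i * x i ≤ a := by
  have hN : (1 : ℚ) < N := by exact_mod_cast G.one_lt
  have hunit := D.mul_unit (Nat.ne_zero_of_lt G.one_lt) (Nat.ne_zero_of_lt hj) j G.x₀
  have hpeak i (hi : i < D.n) : D.r i * x i ≤ (N * D.n * G.g : ℚ) := by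
    rw [hg, hunit]
    refine le_trans ?_ (Rat.cast_le.2 (hmax i hi))
    push_cast
    exact mul_le_mul_of_nonneg_left (hx.le_peak hc hi) (by exact_mod_cast D.r_nonneg i)
  have hθ : (0 : ℝ) ≤ shrink N := by exact_mod_cast (shrink_pos G.one_lt).le
  have ha' : shrink N * (a + D.n * G.g) ≤ a := by
    have hloss := ha.mul_unit_le hj hg
    rw [shrink, one_sub_div (by positivity), div_mul_eq_mul_div, div_le_iff₀ (by positivity)]
    linarith
  calc shrink N * ∑ i ∈ Finset.range D.n, D.r i * x i
      ≤ shrink N * (a + D.n * G.g : ℚ) :=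
        mul_le_mul_of_nonneg_left (ha.revenue_le hx hc hpeak) hθ
    _ ≤ a := by exact_mod_cast ha'

namespace BudgetData

theorem exists_leader (D : BudgetData) (hn : D.n ≠ 0) (x₀ : ℚ) :
    ∃ j < D.n, ∀ i < D.n, D.r i * D.peak i x₀ ≤ D.r j * D.peak j x₀ := by
  obtain ⟨j, hj, hmax⟩ := Finset.exists_max_image (Finset.range D.n)
    (fun i => D.r i * D.peak i x₀) ⟨0, Finset.mem_range.2 (Nat.pos_of_ne_zero hn)⟩
  exact ⟨j, Finset.mem_range.1 hj, fun i hi => hmax i (Finset.mem_range.2 hi)⟩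

theorem AdmitsSales.shrunk_revenue_le {c : ℕ → ℕ} {x : ℕ → ℝ} {x₀ : ℚ}
    (hx : D.AdmitsSales c x x₀) (hN : 1 < N) (h₀ : 0 ≤ x₀) (hT : x₀ < D.T) (ha : 0 ≤ a)
    (hdom : ∀ j < D.n, D.Dominated N j x₀ a)
    (hc : ∑ i ∈ Finset.range D.n, D.b i * c i ≤ D.B) :
    shrink N * ∑ i ∈ Finset.range D.n, D.r i * x i ≤ a := by
  have ha' : (0 : ℝ) ≤ a := by exact_mod_cast ha
  rcases eq_or_ne D.n 0 with hn | hn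
  · simpa [hn] using ha
  obtain ⟨j, hj, hmax⟩ := D.exists_leader hn x₀
  rcases lt_or_ge 0 (D.unit N j x₀) with hg | hg
  · exact (hdom j hj ⟨x₀, _, hN, h₀, hT, hg⟩ rfl rfl).shrunk_revenue_le hj rfl hmax hx hc
  · have hzero i (hi : i ∈ Finset.range D.n) : D.r i * x i ≤ 0 := by
      have hpeak : D.r i * D.peak i x₀ ≤ 0 := by
        refine (hmax i (Finset.mem_range.1 hi)).trans ?_
        rw [← D.mul_unit (Nat.ne_zero_of_lt hN) hn j x₀]
        exact mul_nonpos_of_nonneg_of_nonpos (by positivity) hg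
      have hr : (0 : ℝ) ≤ D.r i := by exact_mod_cast D.r_nonneg i
      refine (mul_le_mul_of_nonneg_left (hx.le_peak hc (Finset.mem_range.1 hi)) hr).trans ?_
      exact_mod_cast hpeak
    exact (mul_nonpos_of_nonneg_of_nonpos (by exact_mod_cast (shrink_pos hN).le)
      (Finset.sum_nonpos hzero)).trans ha'

theorem AdmitsSales.horizon_le {c : ℕ → ℕ} {x : ℕ → ℝ} {x₀ : ℝ} (hx : D.AdmitsSales c x x₀)
    (htotal : ∑ i ∈ Finset.range D.n, x i + x₀ = D.T) :
    D.T ≤ x₀ * (1 + ∑ i ∈ Finset.range D.n, (D.v i : ℝ)) := by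
  have hsum : ∑ i ∈ Finset.range D.n, x i ≤ (∑ i ∈ Finset.range D.n, (D.v i : ℝ)) * x₀ := by
    rw [Finset.sum_mul]
    exact Finset.sum_le_sum hx.le_attraction
  linarith

theorem exists_outside_guess {θ : ℚ} (hθ₀ : 0 < θ) (hθ₁ : θ < 1) (hT : 0 < D.T) {V : ℚ}
    {x₀ W : ℝ} (hx₀ : x₀ ≤ D.T) (hW : D.T ≤ x₀ * W) (hV₀ : 0 ≤ W) (hV : W < V) :
    ∃ k : ℕ, D.T < D.T * θ ^ k * V ∧ θ * x₀ ≤ (D.T * θ ^ (k + 1) : ℚ) ∧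
      (D.T * θ ^ (k + 1) : ℚ) ≤ x₀ := by
  have hT' : (0 : ℝ) < D.T := by exact_mod_cast hT
  have hθ₀' : (0 : ℝ) < θ := by exact_mod_cast hθ₀
  have hx₀_pos : 0 < x₀ := pos_of_mul_pos_left (hT'.trans_le hW) hV₀
  obtain ⟨k, hlt, hle⟩ := exists_nat_pow_near_of_lt_one (div_pos hx₀_pos hT')
    ((div_le_one hT').2 hx₀) hθ₀' (by exact_mod_cast hθ₁)
  rw [lt_div_iff₀' hT'] at hlt
  rw [div_le_iff₀' hT'] at hle
  refine ⟨k, ?_, ?_, ?_⟩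
  · have h : (D.T : ℝ) < D.T * θ ^ k * V :=
      calc (D.T : ℝ) ≤ x₀ * W := hW
        _ < x₀ * V := mul_lt_mul_of_pos_left hV hx₀_pos
        _ ≤ D.T * θ ^ k * V := mul_le_mul_of_nonneg_right hle (hV₀.trans hV.le)
    exact_mod_cast h
  · push_cast
    rw [pow_succ', mul_left_comm]
    exact mul_le_mul_of_nonneg_left hle hθ₀'.le
  · push_cast
    exact hlt.le

/-- One factor `shrink N` is lost in the guess of the sales of the outside option, the other one in
rounding the revenues. -/
theorem AdmitsSales.revenue_le_of_dominated {c : ℕ → ℕ} {x : ℕ → ℝ} {x₀ : ℝ}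
    (hx : D.AdmitsSales c x x₀) (hN : 1 < N) (ha : 0 ≤ a) {V : ℚ}
    (hV : 1 + ∑ i ∈ Finset.range D.n, D.v i < V)
    (hdom : ∀ j < D.n, ∀ k : ℕ, D.T < D.T * shrink N ^ k * V →
      D.Dominated N j (D.T * shrink N ^ (k + 1)) a)
    (hc : ∑ i ∈ Finset.range D.n, D.b i * c i ≤ D.B) :
    shrink N ^ 2 * ∑ i ∈ Finset.range D.n, D.r i * x i ≤ a := by
  have hv i : (0 : ℝ) ≤ D.v i := by exact_mod_cast D.v_nonneg i
  have hθ₀ := shrink_pos hN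
  have hθ₁ := shrink_lt_one hN
  have hx' := hx.fill hv
  have hsum_nonneg := Finset.sum_nonneg hx.nonneg
  rcases D.T_nonneg.eq_or_lt with hT | hT
  · have hsum : ∑ i ∈ Finset.range D.n, x i ≤ 0 := by
      have := hx.total_le
      rw [← hT, Rat.cast_zero] at this
      linarith [hx.outside_nonneg]
    have hzero i (hi : i ∈ Finset.range D.n) : D.r i * x i = 0 := by
      rw [(Finset.sum_eq_zero_iff_of_nonneg hx.nonneg).1 (hsum.antisymm hsum_nonneg) i hi, mul_zero]
    rw [Finset.sum_eq_zero hzero, mul_zero]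
    exact_mod_cast ha
  · obtain ⟨k, hk, hle, hge⟩ := exists_outside_guess hθ₀ hθ₁ hT (sub_le_self _ hsum_nonneg)
      (AdmitsSales.horizon_le hx' (add_sub_cancel _ _))
      (add_nonneg zero_le_one (Finset.sum_nonneg fun i _ => hv i))
      (V := V) (by exact_mod_cast hV)
    have hrescaled := hx'.rescale hv (by exact_mod_cast hθ₀.le) (by exact_mod_cast hθ₁.le) hle hge
    have hrevenue := AdmitsSales.shrunk_revenue_le hrescaled hN (by positivity)
      (mul_lt_of_lt_one_right hT (pow_lt_one₀ hθ₀.le hθ₁ k.succ_ne_zero)) ha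
      (fun j hj => hdom j hj k hk) hc
    simp_rw [mul_left_comm _ (shrink N : ℝ), ← Finset.mul_sum] at hrevenue
    rwa [sq, mul_assoc]

end BudgetData

end Assortment

/-! ### The dynamic program -/

namespace Assortment.Guess

variable {D : BudgetData} {N : ℕ} (G : Guess D N)

instance (i p : ℕ) : Decidable (G.Attains i p) := inferInstanceAs (Decidable (_ ≤ _))

/-- The least cost of `P` units in `S` slots by means of fewer than `m` units of product `i`, where
`prev` holds the least costs for the preceding products, together with the number of units of
product `i`. The cost is `B + 1` if there is no cheaper way. -/
def relax (prev : ℕ → ℕ → ℚ) (i P S : ℕ) : ℕ → ℚ × ℕ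
  | 0 => (D.B + 1, 0)
  | p + 1 =>
    if G.Attains i p ∧ G.slots i p ≤ S ∧
        prev (P - p) (S - G.slots i p) + G.cost i p < (relax prev i P S p).1 then
      (prev (P - p) (S - G.slots i p) + G.cost i p, p)
    else relax prev i P S p

/-- The least cost of `P` units in `S` slots by means of the first `k` products, together with the
number of units of the last of them. -/
def best : ℕ → ℕ → ℕ → ℚ × ℕ
  | 0, P, S => (if P = 0 ∧ S = 0 then 0 else D.B + 1, 0)
  | k + 1, P, S => G.relax (fun P' S' => (best k P' S').1) k P S (P + 1)

/-- The plan of least cost, read off from `best`. -/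
def plan : ℕ → ℕ → ℕ → ℕ → ℕ
  | 0, _, _ => 0
  | k + 1, P, S =>
    let p := (G.best (k + 1) P S).2
    Function.update (plan k (P - p) (S - G.slots k p)) k p

variable {G} {prev : ℕ → ℕ → ℚ} {i k m p P S : ℕ}

theorem cost_nonneg : 0 ≤ G.cost i p :=
  mul_nonneg (D.b_nonneg i) (by exact_mod_cast Int.ceil_nonneg amount_nonneg)

theorem relax_eq_or (G : Guess D N) (prev : ℕ → ℕ → ℚ) (i P S m : ℕ) :
    G.relax prev i P S m = (D.B + 1, 0) ∨ ∃ p < m, G.Attains i p ∧ G.slots i p ≤ S ∧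
      G.relax prev i P S m = (prev (P - p) (S - G.slots i p) + G.cost i p, p) := by
  induction m with
  | zero => exact .inl rfl
  | succ m ih =>
    rw [relax]
    split_ifs with h
    · exact .inr ⟨m, m.lt_succ_self, h.1, h.2.1, rfl⟩
    · exact ih.imp_right fun ⟨p, hp, hp'⟩ => ⟨p, hp.trans m.lt_succ_self, hp'⟩

theorem relax_fst_le (hp : p < m) (hattains : G.Attains i p) (hslots : G.slots i p ≤ S) :
    (G.relax prev i P S m).1 ≤ prev (P - p) (S - G.slots i p) + G.cost i p := by
  induction m with
  | zero => omega
  | succ m ih =>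
    rw [relax]
    rcases Nat.lt_succ_iff_lt_or_eq.1 hp with hpm | rfl
    · split_ifs with h
      exacts [h.2.2.le.trans (ih hpm), ih hpm]
    · split_ifs with h
      exacts [le_rfl, not_lt.1 fun hlt => h ⟨hattains, hslots, hlt⟩]

theorem best_succ_snd_le (G : Guess D N) (k P S : ℕ) : (G.best (k + 1) P S).2 ≤ P := by
  rcases G.relax_eq_or (fun P' S' => (G.best k P' S').1) k P S (P + 1) with
    h | ⟨p, hp, -, -, h⟩ <;>
    rw [best, h]
  exacts [P.zero_le, Nat.lt_succ_iff.1 hp]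

theorem IsPlan.update {p : ℕ → ℕ} (h : G.IsPlan k p P S) {q : ℕ} (hq : G.Attains k q) :
    G.IsPlan (k + 1) (Function.update p k q) (P + q) (S + G.slots k q) := by
  have hupdate {i : ℕ} (hi : i < k) : Function.update p k q i = p i :=
    Function.update_of_ne hi.ne _ _
  refine ⟨fun i hi => ?_, ?_, ?_⟩
  · rcases Nat.lt_succ_iff_lt_or_eq.1 hi with hik | rfl
    · rw [hupdate hik]
      exact h.attains i hik
    · rwa [Function.update_self]
  · rw [Finset.sum_range_succ, Function.update_self, ← h.sum_units,
      Finset.sum_congr rfl fun i hi => hupdate (Finset.mem_range.1 hi)]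
  · rw [Finset.sum_range_succ, Function.update_self, ← h.sum_slots,
      Finset.sum_congr rfl fun i hi => by rw [hupdate (Finset.mem_range.1 hi)]]

theorem sum_cost_update (G : Guess D N) (k : ℕ) (p : ℕ → ℕ) (q : ℕ) :
    ∑ i ∈ Finset.range (k + 1), G.cost i (Function.update p k q i) =
      ∑ i ∈ Finset.range k, G.cost i (p i) + G.cost k q := by
  rw [Finset.sum_range_succ, Function.update_self]
  congr 1
  exact Finset.sum_congr rfl fun i hi => by
    rw [Function.update_of_ne (Finset.mem_range.1 hi).ne]

theorem isPlan_plan (hbest : (G.best k P S).1 ≤ D.B) :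
    G.IsPlan k (G.plan k P S) P S ∧
      ∑ i ∈ Finset.range k, G.cost i (G.plan k P S i) = (G.best k P S).1 := by
  induction k generalizing P S with
  | zero =>
    rw [best] at hbest ⊢
    split_ifs at hbest ⊢ with h
    · obtain ⟨rfl, rfl⟩ := h
      exact ⟨⟨by simp, by simp, by simp⟩, by simp⟩
    · exact absurd hbest (lt_add_one _).not_ge
  | succ k ih =>
    rcases G.relax_eq_or (fun P' S' => (G.best k P' S').1) k P S (P + 1) with
      h | ⟨p, hp, hattains, hslots, h⟩
    · rw [best, h] at hbest
      exact absurd hbest (lt_add_one _).not_ge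
    · rw [← best] at h
      rw [h] at hbest ⊢
      obtain ⟨hplan, hcost⟩ := ih ((le_add_of_nonneg_right cost_nonneg).trans hbest)
      rw [plan, h]
      dsimp only
      refine ⟨?_, by rw [sum_cost_update, hcost]⟩
      convert hplan.update hattains using 1 <;> omega

theorem IsPlan.best_le {p : ℕ → ℕ} (h : G.IsPlan k p P S) :
    (G.best k P S).1 ≤ ∑ i ∈ Finset.range k, G.cost i (p i) := by
  induction k generalizing P S with
  | zero =>
    obtain ⟨-, hP, hS⟩ := h
    rw [Finset.sum_range_zero] at hP hS ⊢
    simp [best, ← hP, ← hS]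
  | succ k ih =>
    obtain ⟨hattains, hP, hS⟩ := h
    rw [Finset.sum_range_succ] at hP hS ⊢
    have hprev := ih (P := P - p k) (S := S - G.slots k (p k))
      ⟨fun i hi => hattains i (hi.trans k.lt_succ_self), by omega, by omega⟩
    refine le_trans ?_ (add_le_add_left hprev _)
    exact relax_fst_le (by omega) (hattains k k.lt_succ_self) (by omega)

open RatRAM in
theorem heightLE_best {β γ : ℕ} (hB : HeightLE β (D.B + 1))
    (hcost : ∀ i < k, ∀ p ≤ P, HeightLE γ (G.cost i p)) :
    HeightLE (β + k * γ) (G.best k P S).1 := by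
  induction k generalizing P S with
  | zero =>
    rw [best]
    split_ifs
    exacts [heightLE_zero, hB.mono (Nat.le_add_right _ _)]
  | succ k ih =>
    rcases G.relax_eq_or (fun P' S' => (G.best k P' S').1) k P S (P + 1) with
      h | ⟨p, hp, -, -, h⟩ <;>
      rw [best, h]
    · exact hB.mono (Nat.le_add_right _ _)
    · rw [Nat.succ_mul, ← add_assoc]
      exact (ih fun i hi q hq => hcost i (by omega) q (by omega)).add
        (hcost k (by omega) p (by omega))

end Assortment.Guess

/-! ### The program -/

namespace Assortment

open RatRAM

/-- The number of totals of revenue, counted in units, in the table of the dynamic program. -/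
def rows (N n : ℕ) : ℕ := N * n * n + 1

/-- The number of totals of slots in the table of the dynamic program. -/
def cols (N n : ℕ) : ℕ := N * n + 1

namespace Algorithm

open Expr Program Register

variable (N : ℕ)

/-- The index of a table cell, as an expression. -/
def cell (k P S : Expr) : Expr :=
  (k * (const N * var count * var count + 1) + P) * (const N * var count + 1) + S

/-- The current cell in the filling of the table. -/
def currentCell : Expr := cell N (var product + 1) (var units) (var slots)

/-- The sales that yield the current portion of revenue from the current product. -/
def portionSales : Expr := var portion * var unit / get price (var product)

/-- The slots that the current portion takes up. -/
def portionSlots : Expr :=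
  floor (portionSales * (const N * var count) / (var horizon - var outside))

/-- The cost of the current cell if it is obtained by means of the current portion. -/
def candidate : Expr :=
  get tableCost
      (cell N (var product) (var units - var portion) (var slots - portionSlots N)) +
    get unitCost (var product) * ceil portionSales

/-- Improves the current cell by means of the current portion. -/
def tryPortion : Program :=
  .ite (get price (var product) * (get attraction (var product) * var outside))
    (var portion * var unit) .skip
    (.ite (var slots) (portionSlots N) .skip
      (.ite (candidate N) (get tableCost (currentCell N))
        (.set tableCost (currentCell N) (candidate N) ;;
          .set tableUnits (currentCell N) (var portion))
        .skip))

/-- Computes the current cell from those of the preceding products. -/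
def fillCell : Program :=
  .set tableCost (currentCell N) (var budget + 1) ;;
  .set tableUnits (currentCell N) 0 ;;
  .forRange portion (var units + 1) (tryPortion N)

/-- Initializes the current cell of the table for no products. -/
def initCell : Program :=
  .set tableUnits (cell N 0 (var units) (var slots)) 0 ;;
  .ite 0 (var units + var slots)
    (.set tableCost (cell N 0 (var units) (var slots)) (var budget + 1))
    (.set tableCost (cell N 0 (var units) (var slots)) 0)

/-- Runs `P` for every pair of a row and a column. -/
def forCells (P : Program) : Program :=
  .forRange units (const N * var count * var count + 1)
    (.forRange slots (const N * var count + 1) P)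

/-- The dynamic program. -/
def fillTable : Program :=
  forCells N (initCell N) ;; .forRange product (var count) (forCells N (fillCell N))

/-- Outputs the number of units of one product, going backwards through the products. -/
def outputProduct : Program :=
  .assign product (var count - var level - 1) ;;
  .assign portion (get tableUnits (cell N (var product + 1) (var remUnits) (var remSlots))) ;;
  .set output (var product) (ceil portionSales) ;;
  .assign remUnits (var remUnits - var portion) ;;
  .assign remSlots (var remSlots - portionSlots N)

/-- Outputs the inventory of the plan in the current cell. -/
def outputPlan : Program :=
  .assign remUnits (var units) ;;
  .assign remSlots (var slots) ;;
  .forRange level (var count) (outputProduct N)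

/-- Outputs the plan in the current cell if it is affordable and improves on the record. -/
def inspectCell : Program :=
  .ite (var budget) (get tableCost (cell N (var count) (var units) (var slots))) .skip
    (.ite (var record) (var units * var unit)
      (.assign record (var units * var unit) ;; outputPlan N)
      .skip)

/-- Computes the largest sales of the current product alone that the attraction and the capacity
allow. -/
def initPeak : Program :=
  .ite (get attraction (var leader) * var outside) (var horizon - var outside)
    (.assign peak (get attraction (var leader) * var outside))
    (.assign peak (var horizon - var outside))

/-- Reduces these sales to what the budget admits. -/
def capPeak : Program :=
  .ite (var budget) (get unitCost (var leader) * ceil (var peak))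
    (.assign peak (floor (var budget / get unitCost (var leader)))) .skip

/-- Computes the unit of revenue of the current guess. -/
def setUnit : Program :=
  initPeak ;; capPeak ;;
  .assign unit (get price (var leader) * var peak / (const N * var count))

/-- Treats the current guess. -/
def tryGuess : Program :=
  setUnit N ;; .ite 0 (var unit) (fillTable N ;; forCells N (inspectCell N)) .skip

/-- The algorithm, once the data are in place. -/
def search : Program :=
  .assign outside (var horizon) ;;
  .loop (var horizon) (var outside * var bound)
    (.assign outside (var outside * const (shrink N)) ;;
      .forRange leader (var count) (tryGuess N))

end Algorithm

/-! ### The memory -/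

/-- The arrays that hold the data. -/
def dataArrays : Set ℕ :=
  {↑Register.price, ↑Register.attraction, ↑Register.unitCost, ↑Register.count, ↑Register.horizon,
    ↑Register.budget, ↑Register.bound}

/-- The data are in place. The variable `Register.bound` exceeds the total attraction, including
that of the outside option. -/
structure Loaded (D : BudgetData) (σ : Memory) : Prop where
  price : ∀ i < D.n, σ Register.price i = D.r i
  attraction : ∀ i < D.n, σ Register.attraction i = D.v i
  unitCost : ∀ i < D.n, σ Register.unitCost i = D.b i
  count : σ Register.count 0 = D.n
  horizon : σ Register.horizon 0 = D.T
  budget : σ Register.budget 0 = D.B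
  bound : σ Register.bound 0 = 2 + ∑ i ∈ Finset.range D.n, D.v i

/-- The data and the guess are in place. -/
structure Ready {D : BudgetData} {N : ℕ} (G : Guess D N) (σ : Memory) : Prop extends
    Loaded D σ where
  outside : σ Register.outside 0 = G.x₀
  unit : σ Register.unit 0 = G.g

/-- The index of the table cell for `P` units of revenue from the first `k` products in `S`
slots. -/
def cellIndex (N n k P S : ℕ) : ℕ := (k * rows N n + P) * cols N n + S

/-- The entry of the table of the dynamic program at the index `q`. -/
def Guess.tableau {D : BudgetData} {N : ℕ} (G : Guess D N) (q : ℕ) : ℚ × ℕ :=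
  G.best (q / cols N D.n / rows N D.n) (q / cols N D.n % rows N D.n) (q % cols N D.n)

/-- The first `m` cells of the table have been computed. -/
def Tabulated {D : BudgetData} {N : ℕ} (G : Guess D N) (m : ℕ) (σ : Memory) : Prop :=
  ∀ q < m, σ Register.tableCost q = (G.tableau q).1 ∧ σ Register.tableUnits q = (G.tableau q).2

section

variable {D : BudgetData} {N : ℕ} {G : Guess D N} {k P S m : ℕ} {σ : Memory}

theorem tableau_cellIndex (hP : P < rows N D.n) (hS : S < cols N D.n) :
    G.tableau (cellIndex N D.n k P S) = G.best k P S := by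
  have hrows := P.zero_le.trans_lt hP
  have hcols := S.zero_le.trans_lt hS
  rw [Guess.tableau, cellIndex, mul_comm _ (cols N D.n), Nat.mul_add_div hcols,
    Nat.div_eq_of_lt hS, add_zero, Nat.mul_add_mod, Nat.mod_eq_of_lt hS, mul_comm k,
    Nat.mul_add_div hrows, Nat.div_eq_of_lt hP, add_zero, Nat.mul_add_mod, Nat.mod_eq_of_lt hP]

theorem cellIndex_lt_of_lt {k' P' S' : ℕ} (hP : P < rows N D.n) (hS : S < cols N D.n)
    (hk : k < k') : cellIndex N D.n k P S < cellIndex N D.n k' P' S' := by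
  have hrow : k * rows N D.n + P + 1 ≤ k' * rows N D.n + P' :=
    calc k * rows N D.n + P + 1 ≤ (k + 1) * rows N D.n := by rw [Nat.succ_mul]; omega
      _ ≤ k' * rows N D.n + P' := (Nat.mul_le_mul_right _ hk).trans (Nat.le_add_right _ _)
  calc (k * rows N D.n + P) * cols N D.n + S < (k * rows N D.n + P + 1) * cols N D.n := by
        rw [Nat.succ_mul]; omega
    _ ≤ cellIndex N D.n k' P' S' := (Nat.mul_le_mul_right _ hrow).trans (Nat.le_add_right _ _)

theorem dependsOn_loaded : DependsOn (Loaded D) dataArrays :=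
  dependsOn_of_imp fun σ τ h hσ => by
    simp only [dataArrays, Set.mem_insert_iff, Set.mem_singleton_iff, forall_eq_or_imp,
      forall_eq] at h
    obtain ⟨hprice, hattraction, hunitCost, hcount, hhorizon, hbudget, hbound⟩ := h
    exact ⟨hprice ▸ hσ.price, hattraction ▸ hσ.attraction, hunitCost ▸ hσ.unitCost,
      hcount ▸ hσ.count, hhorizon ▸ hσ.horizon, hbudget ▸ hσ.budget, hbound ▸ hσ.bound⟩

theorem dependsOn_ready :
    DependsOn (Ready G) (dataArrays ∪ {↑Register.outside, ↑Register.unit}) :=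
  dependsOn_of_imp fun σ τ h hσ =>
    ⟨(dependsOn_loaded fun a ha => h a (.inl ha)).mp hσ.toLoaded,
      h Register.outside (by simp) ▸ hσ.outside, h Register.unit (by simp) ▸ hσ.unit⟩

theorem dependsOn_tabulated :
    DependsOn (Tabulated G m) {↑Register.tableCost, ↑Register.tableUnits} := fun σ τ h => by
  simp only [Tabulated, h Register.tableCost (by simp), h Register.tableUnits (by simp)]

end

end Assortment

/-! ### Correctness of the dynamic program -/

namespace Assortment

open RatRAM Algorithm

/-- Bounds for the numbers of iterations and for the heights of the numbers in the treatment of a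
guess. -/
structure Guess.Fits {D : BudgetData} {N : ℕ} (G : Guess D N) (R β : ℕ) : Prop where
  rows_le : rows N D.n ≤ R
  count_le : D.n ≤ R
  succ_le : R + 1 ≤ 2 ^ β
  budget : HeightLE β (D.B + 1)
  candidate : ∀ k < D.n, ∀ P < rows N D.n, ∀ S, ∀ p ≤ P,
    HeightLE β ((G.best k (P - p) S).1 + G.cost k p)
  revenue : ∀ P < rows N D.n, HeightLE β (P * G.g)
  sales : ∀ i < D.n, ∀ p < rows N D.n, HeightLE β ⌈G.amount i p⌉

/-- The cell for `P` units of revenue from the first `k + 1` products in `S` slots is the current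
one, the preceding cells have been computed, and less than `p` units of revenue from product `k`
have been tried. -/
structure Filling {D : BudgetData} {N : ℕ} (G : Guess D N) (k P S p : ℕ) (σ : Memory) : Prop extends
    Ready G σ where
  product : σ Register.product 0 = k
  units : σ Register.units 0 = P
  slots : σ Register.slots 0 = S
  tabulated : Tabulated G (cellIndex N D.n (k + 1) P S) σ
  tableCost : σ Register.tableCost (cellIndex N D.n (k + 1) P S) =
    (G.relax (fun P' S' => (G.best k P' S').1) k P S p).1
  tableUnits : σ Register.tableUnits (cellIndex N D.n (k + 1) P S) =
    (G.relax (fun P' S' => (G.best k P' S').1) k P S p).2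

variable {D : BudgetData} {N : ℕ} {G : Guess D N} {R β k m p P S : ℕ} {σ : Memory}

theorem cols_le_rows (N n : ℕ) : cols N n ≤ rows N n := by
  rcases n.eq_zero_or_pos with rfl | hn
  exacts [le_rfl, Nat.succ_le_succ (Nat.le_mul_of_pos_right _ hn)]

theorem Guess.Fits.heightLE_natCast (hG : G.Fits R β) (hP : P ≤ R) : HeightLE β (P : ℚ) :=
  RatRAM.heightLE_natCast.2 ((Nat.succ_le_succ hP).trans hG.succ_le)

theorem eval_cell {x y z : Expr} (hcount : σ Register.count 0 = D.n) (hx : x.eval σ = k)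
    (hy : y.eval σ = P) (hz : z.eval σ = S) :
    (cell N x y z).eval σ = cellIndex N D.n k P S := by
  simp [cell, cellIndex, rows, cols, hcount, hx, hy, hz]

theorem eval_get_cell {a : ℕ} {x y z : Expr} (hcount : σ Register.count 0 = D.n)
    (hx : x.eval σ = k) (hy : y.eval σ = P) (hz : z.eval σ = S) :
    (Expr.get a (cell N x y z)).eval σ = σ a (cellIndex N D.n k P S) := by
  rw [Expr.eval_get, eval_cell hcount hx hy hz, Nat.floor_natCast]

theorem Ready.eval_portionSales (hσ : Ready G σ) (hk : k < D.n)
    (hproduct : σ Register.product 0 = k) (hportion : σ Register.portion 0 = p) :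
    portionSales.eval σ = G.amount k p := by
  simp [portionSales, Guess.amount, hproduct, hportion, hσ.unit, hσ.price k hk]

theorem Ready.eval_portionSlots (hσ : Ready G σ) (hk : k < D.n)
    (hproduct : σ Register.product 0 = k) (hportion : σ Register.portion 0 = p) :
    (portionSlots N).eval σ = G.slots k p := by
  have hnonneg : 0 ≤ G.amount k p * (N * D.n) / (D.T - G.x₀) :=
    div_nonneg (mul_nonneg Guess.amount_nonneg (by positivity)) (sub_pos.2 G.x₀_lt).le
  simp [portionSlots, hσ.eval_portionSales hk hproduct hportion, hσ.count, hσ.horizon, hσ.outside,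
    Guess.slots, natCast_floor_eq_intCast_floor hnonneg]

theorem eval_currentCell (hcount : σ Register.count 0 = D.n) (hproduct : σ Register.product 0 = k)
    (hunits : σ Register.units 0 = P) (hslots : σ Register.slots 0 = S) :
    (currentCell N).eval σ = cellIndex N D.n (k + 1) P S :=
  eval_cell hcount (by simp [hproduct]) (by simp [hunits]) (by simp [hslots])

theorem Filling.eval_candidate (hσ : Filling G k P S p σ) (hk : k < D.n) (hP : P < rows N D.n)
    (hS : S < cols N D.n) (hportion : σ Register.portion 0 = p) (hp : p ≤ P)
    (hslots : G.slots k p ≤ S) :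
    (candidate N).eval σ = (G.best k (P - p) (S - G.slots k p)).1 + G.cost k p := by
  have hP' : P - p < rows N D.n := by omega
  have hS' : S - G.slots k p < cols N D.n := by omega
  rw [candidate, Expr.eval_add, Expr.eval_mul, Expr.eval_ceil,
    hσ.eval_portionSales hk hσ.product hportion,
    eval_get_cell hσ.count (k := k) (by simp [hσ.product]) (P := P - p) (S := S - G.slots k p)
      (by simp [hσ.units, hportion, hp])
      (by simp [hσ.slots, hσ.eval_portionSlots hk hσ.product hportion, hslots]),
    (hσ.tabulated _ (cellIndex_lt_of_lt hP' hS' k.lt_succ_self)).1, tableau_cellIndex hP' hS']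
  simp [hσ.product, hσ.unitCost k hk, Guess.cost]

/-- The arrays on which the treatment of a table cell depends. -/
def cellArrays : Set ℕ :=
  (dataArrays ∪ {↑Register.outside, ↑Register.unit}) ∪
    {↑Register.product, ↑Register.units, ↑Register.slots, ↑Register.tableCost,
      ↑Register.tableUnits}

theorem dependsOn_filling : DependsOn (Filling G k P S p) cellArrays :=
  dependsOn_of_imp fun σ τ h hσ => by
    have hproduct := h Register.product (by simp [cellArrays])
    have hunits := h Register.units (by simp [cellArrays])
    have hslots := h Register.slots (by simp [cellArrays])
    have hcost := h Register.tableCost (by simp [cellArrays])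
    have htable := h Register.tableUnits (by simp [cellArrays])
    exact ⟨(dependsOn_ready fun a ha => h a (.inl ha)).mp hσ.toReady, hproduct ▸ hσ.product,
      hunits ▸ hσ.units, hslots ▸ hσ.slots,
      (dependsOn_tabulated (by simp [hcost, htable])).mp hσ.tabulated,
      hcost ▸ hσ.tableCost, htable ▸ hσ.tableUnits⟩

theorem Ready.store (hσ : Ready G σ) {a : ℕ}
    (ha : a ∉ dataArrays ∪ {↑Register.outside, ↑Register.unit}) (i : ℕ) (q : ℚ) :
    Ready G (store σ a i q) :=
  (dependsOn_ready fun _ hb => store_of_ne σ (ne_of_mem_of_not_mem hb ha) i q).mpr hσ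

theorem Filling.of_not_improves (hσ : Filling G k P S p σ)
    (h : ¬ (G.Attains k p ∧ G.slots k p ≤ S ∧
      (G.best k (P - p) (S - G.slots k p)).1 + G.cost k p <
        (G.relax (fun P' S' => (G.best k P' S').1) k P S p).1)) :
    Filling G k P S (p + 1) σ :=
  { hσ with
    tableCost := by rw [Guess.relax, if_neg h, hσ.tableCost]
    tableUnits := by rw [Guess.relax, if_neg h, hσ.tableUnits] }

theorem Tabulated.store (hσ : Tabulated G m σ) {a i : ℕ} (hi : m ≤ i) (q : ℚ) :
    Tabulated G m (store σ a i q) := fun j hj => by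
  have hji : j ≠ i := (hj.trans_le hi).ne
  simpa [store_apply, hji] using hσ j hj

theorem Filling.improve (hσ : Filling G k P S p σ)
    (h : G.Attains k p ∧ G.slots k p ≤ S ∧
      (G.best k (P - p) (S - G.slots k p)).1 + G.cost k p <
        (G.relax (fun P' S' => (G.best k P' S').1) k P S p).1) :
    Filling G k P S (p + 1)
      (store (store σ Register.tableCost (cellIndex N D.n (k + 1) P S)
        ((G.best k (P - p) (S - G.slots k p)).1 + G.cost k p))
        Register.tableUnits (cellIndex N D.n (k + 1) P S) p) where
  toReady := (hσ.toReady.store (by simp [dataArrays]) _ _).store (by simp [dataArrays]) _ _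
  product := by simp [store_apply, hσ.product]
  units := by simp [store_apply, hσ.units]
  slots := by simp [store_apply, hσ.slots]
  tabulated := (hσ.tabulated.store le_rfl _).store le_rfl _
  tableCost := by rw [Guess.relax, if_pos h]; simp [store_apply]
  tableUnits := by rw [Guess.relax, if_pos h]; simp [store_apply]

theorem Filling.halts_improve (hG : G.Fits R β) (hk : k < D.n) (hP : P < rows N D.n)
    (hS : S < cols N D.n) (hp : p ≤ P) (hsmall : Small β σ) (hσ : Filling G k P S p σ)
    (hportion : σ Register.portion 0 = p)
    (h : G.Attains k p ∧ G.slots k p ≤ S ∧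
      (G.best k (P - p) (S - G.slots k p)).1 + G.cost k p <
        (G.relax (fun P' S' => (G.best k P' S').1) k P S p).1) :
    Halts R β (.set Register.tableCost (currentCell N) (candidate N) ;;
      .set Register.tableUnits (currentCell N) (.var Register.portion)) σ
      (Filling G k P S (p + 1)) := by
  have hcandidate := hσ.eval_candidate hk hP hS hportion hp h.2.1
  have hheight := hcandidate ▸ hG.candidate k hk P hP (S - G.slots k p) p hp
  have hrows := hG.rows_le
  have hcell {i : ℕ} {q : ℚ} : (currentCell N).eval (store σ Register.tableCost i q) =
      cellIndex N D.n (k + 1) P S :=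
    eval_currentCell (by simp [store_apply, hσ.count]) (by simp [store_apply, hσ.product])
      (by simp [store_apply, hσ.units]) (by simp [store_apply, hσ.slots])
  refine .seq (.set hsmall hheight (.set (hsmall.store hheight) ?_ ?_))
  · simpa [store_apply, hportion] using hG.heightLE_natCast (by omega)
  · rw [eval_currentCell hσ.count hσ.product hσ.units hσ.slots, hcell]
    simpa [store_apply, hcandidate, hportion] using hσ.improve h

theorem halts_tryPortion (hG : G.Fits R β) (hk : k < D.n) (hP : P < rows N D.n)
    (hS : S < cols N D.n) (hp : p ≤ P) (hsmall : Small β σ) (hσ : Filling G k P S p σ)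
    (hportion : σ Register.portion 0 = p) :
    Halts R β (tryPortion N) σ (Filling G k P S (p + 1)) := by
  have hattains : G.Attains k p ↔ (Expr.var Register.portion * Expr.var Register.unit).eval σ ≤
      (Expr.get Register.price (Expr.var Register.product) *
        (Expr.get Register.attraction (Expr.var Register.product) *
          Expr.var Register.outside)).eval σ := by
    simp [Guess.Attains, hportion, hσ.unit, hσ.product, hσ.price k hk, hσ.attraction k hk,
      hσ.outside]
  have hslots : G.slots k p ≤ S ↔
      (portionSlots N).eval σ ≤ (Expr.var Register.slots).eval σ := by
    simp [hσ.eval_portionSlots hk hσ.product hportion, hσ.slots]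
  have hcell := eval_currentCell (N := N) hσ.count hσ.product hσ.units hσ.slots
  have hcost : (Expr.get Register.tableCost (currentCell N)).eval σ =
      (G.relax (fun P' S' => (G.best k P' S').1) k P S p).1 := by
    rw [Expr.eval_get, hcell, Nat.floor_natCast, hσ.tableCost]
  have hkeep := fun h => Halts.skip (R := R) hsmall (hσ.of_not_improves h)
  refine .ite hsmall (fun hlt => hkeep fun h => hlt.not_ge (hattains.1 h.1)) fun hle => ?_
  refine .ite hsmall (fun hlt => hkeep fun h => hlt.not_ge (hslots.1 h.2.1)) fun hle' => ?_
  have hcandidate := hσ.eval_candidate hk hP hS hportion hp (hslots.2 hle')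
  refine .ite hsmall (fun hlt => ?_) fun hge => hkeep fun h => ?_
  · rw [hcost, hcandidate] at hlt
    exact hσ.halts_improve hG hk hP hS hp hsmall hportion ⟨hattains.2 hle, hslots.2 hle', hlt⟩
  · rw [hcost, hcandidate] at hge
    exact hge.not_gt h.2.2

theorem cellIndex_eq (N n k P S : ℕ) :
    cellIndex N n k P S = k * (rows N n * cols N n) + (P * cols N n + S) := by
  rw [cellIndex]
  ring

theorem Tabulated.succ (hσ : Tabulated G m σ) (hcost : σ Register.tableCost m = (G.tableau m).1)
    (hunits : σ Register.tableUnits m = (G.tableau m).2) : Tabulated G (m + 1) σ := fun q hq => by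
  rcases Nat.lt_succ_iff_lt_or_eq.1 hq with hq | rfl
  exacts [hσ q hq, ⟨hcost, hunits⟩]

theorem Filling.tabulated_succ (hP : P < rows N D.n) (hS : S < cols N D.n)
    (hσ : Filling G k P S (P + 1) σ) : Tabulated G (cellIndex N D.n (k + 1) P S + 1) σ :=
  hσ.tabulated.succ (by rw [hσ.tableCost, tableau_cellIndex hP hS, Guess.best])
    (by rw [hσ.tableUnits, tableau_cellIndex hP hS, Guess.best])

theorem halts_fillCell (hG : G.Fits R β) (hk : k < D.n) (hP : P < rows N D.n)
    (hS : S < cols N D.n) (hsmall : Small β σ) (hσ : Ready G σ)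
    (hproduct : σ Register.product 0 = k) (hunits : σ Register.units 0 = P)
    (hslots : σ Register.slots 0 = S) (htable : Tabulated G (cellIndex N D.n (k + 1) P S) σ) :
    Halts R β (fillCell N) σ fun τ =>
      Ready G τ ∧ Tabulated G (cellIndex N D.n (k + 1) P S + 1) τ := by
  have hrows := hG.rows_le
  have hbudget : HeightLE β ((Expr.var Register.budget + 1).eval σ) := by
    simpa [hσ.budget] using hG.budget
  have hzero {τ : Memory} : HeightLE β (Expr.eval τ 0) := by simpa using heightLE_zero
  have hcell {i : ℕ} {q : ℚ} : (currentCell N).eval (store σ Register.tableCost i q) =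
      cellIndex N D.n (k + 1) P S :=
    eval_currentCell (by simp [store_apply, hσ.count]) (by simp [store_apply, hproduct])
      (by simp [store_apply, hunits]) (by simp [store_apply, hslots])
  have hinit := hsmall.store (a := Register.tableCost) (k := ⌊(currentCell N).eval σ⌋₊) hbudget
  refine .seq (.set hsmall hbudget (.seq (.set hinit hzero ?_)))
  refine (Halts.forRange (Filling G k P S) (N := P + 1) (by omega)
    ((by omega : P + 1 + 1 ≤ R + 1).trans hG.succ_le) (hinit.store hzero) rfl
    (fun _ => dependsOn_filling) (by simp [cellArrays, dataArrays])
    (fun p τ hτ => by simp [hτ.units]) ?_ ?_).mono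
    fun τ _ hτ => ⟨hτ.toReady, hτ.tabulated_succ hP hS⟩
  · rw [eval_currentCell hσ.count hproduct hunits hslots, hcell]
    exact
      { toReady := (hσ.store (by simp [dataArrays]) _ _).store (by simp [dataArrays]) _ _
        product := by simp [store_apply, hproduct]
        units := by simp [store_apply, hunits]
        slots := by simp [store_apply, hslots]
        tabulated := (htable.store (by simp) _).store (by simp) _
        tableCost := by simp [store_apply, Guess.relax, hσ.budget]
        tableUnits := by simp [store_apply, Guess.relax] }
  · exact fun p hp τ hsmall' hτ hportion =>
      halts_tryPortion hG hk hP hS (Nat.lt_succ_iff.1 hp) hsmall' hτ hportion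

theorem halts_forCells {body : Program} (I : ℕ → Memory → Prop) {n : ℕ} (hrows : rows N n ≤ R)
    (hR : R + 1 ≤ 2 ^ β) (hσ : Small β σ) (hunits : body.writes Register.units = false)
    (hslots : body.writes Register.slots = false) {s : Set ℕ} (hI : ∀ m, DependsOn (I m) s)
    (hunits' : ↑Register.units ∉ s) (hslots' : ↑Register.slots ∉ s)
    (hcount : ∀ m τ, I m τ → τ Register.count 0 = n) (hzero : I 0 σ)
    (hstep : ∀ P < rows N n, ∀ S < cols N n, ∀ τ, Small β τ → I (P * cols N n + S) τ →
      τ Register.units 0 = P → τ Register.slots 0 = S →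
      Halts R β body τ (I (P * cols N n + S + 1))) :
    Halts R β (forCells N body) σ (I (rows N n * cols N n)) := by
  have hcols := (cols_le_rows N n).trans hrows
  have hdepends (P S : ℕ) : DependsOn (fun τ : Memory => I (P * cols N n + S) τ ∧
      τ Register.units 0 = P) (s ∪ {↑Register.units}) :=
    dependsOn_and (hI _) fun τ υ h => by rw [h _ rfl]
  refine .forRange (fun P => I (P * cols N n)) hrows ((Nat.succ_le_succ hrows).trans hR) hσ
    (by simp [Program.writes, Program.forRange, Program.assign, hunits])
    (fun P => hI _) hunits' (fun P τ hτ => by simp [rows, hcount _ τ hτ]) (by simpa using hzero)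
    fun P hP τ hτ hIτ hPτ => ?_
  refine (Halts.forRange (fun S τ => I (P * cols N n + S) τ ∧ τ Register.units 0 = P) hcols
    ((Nat.succ_le_succ hcols).trans hR) hτ hslots (hdepends P) (by simp [hslots'])
    (fun S τ hτ => by simp [cols, hcount _ τ hτ.1]) ⟨hIτ, hPτ⟩
    fun S hS υ hυ hIυ hSυ => ?_).mono fun υ _ hυ => by simpa only [Nat.succ_mul] using hυ.1
  exact (hstep P hP S hS υ hυ hIυ.1 hIυ.2 hSυ).frame.mono
    fun ω _ ⟨hframe, hω⟩ => ⟨hω, by rw [hframe _ hunits, hIυ.2]⟩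

theorem halts_initCell (hG : G.Fits R β) (hP : P < rows N D.n) (hS : S < cols N D.n)
    (hsmall : Small β σ) (hσ : Ready G σ) (hunits : σ Register.units 0 = P)
    (hslots : σ Register.slots 0 = S) (htable : Tabulated G (cellIndex N D.n 0 P S) σ) :
    Halts R β (initCell N) σ fun τ =>
      Ready G τ ∧ Tabulated G (cellIndex N D.n 0 P S + 1) τ := by
  have hcell {i : ℕ} {q : ℚ} : (cell N 0 (.var Register.units) (.var Register.slots)).eval
      (store σ Register.tableUnits i q) = cellIndex N D.n 0 P S :=
    eval_cell (by simp [store_apply, hσ.count]) (by simp) (by simp [store_apply, hunits])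
      (by simp [store_apply, hslots])
  have hcell₀ : (cell N 0 (.var Register.units) (.var Register.slots)).eval σ =
      cellIndex N D.n 0 P S :=
    eval_cell hσ.count (by simp) (by simp [hunits]) (by simp [hslots])
  have hstores {q : ℚ} (hq : (G.best 0 P S).1 = q) : Ready G (store (store σ Register.tableUnits
      (cellIndex N D.n 0 P S) 0) Register.tableCost (cellIndex N D.n 0 P S) q) ∧
      Tabulated G (cellIndex N D.n 0 P S + 1) (store (store σ Register.tableUnits
        (cellIndex N D.n 0 P S) 0) Register.tableCost (cellIndex N D.n 0 P S) q) := by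
    refine ⟨(hσ.store (by simp [dataArrays]) _ _).store (by simp [dataArrays]) _ _,
      ((htable.store le_rfl _).store le_rfl _).succ ?_ ?_⟩ <;>
      rw [tableau_cellIndex hP hS]
    · simp [store_apply, hq]
    · simp [store_apply, Guess.best]
  have hzero {τ : Memory} : HeightLE β (Expr.eval τ 0) := by simpa using heightLE_zero
  have hsmall' := hsmall.store (a := Register.tableUnits)
    (k := ⌊(cell N 0 (.var Register.units) (.var Register.slots)).eval σ⌋₊) (hzero (τ := σ))
  refine .seq (.set hsmall hzero (.ite hsmall' (fun hlt => .set hsmall' ?_ ?_)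
    fun hle => .set hsmall' hzero ?_))
  · simpa [store_apply, hσ.budget] using hG.budget
  · have hpos : ¬ (P = 0 ∧ S = 0) := by
      rintro ⟨rfl, rfl⟩
      simp [store_apply, hunits, hslots] at hlt
    simpa [hcell, hcell₀, store_apply, hσ.budget] using hstores (by simp [Guess.best, hpos])
  · have hle' : (P : ℚ) + S ≤ 0 := by simpa [store_apply, hunits, hslots] using hle
    have hPS : P = 0 ∧ S = 0 := by
      norm_cast at hle'
      omega
    simpa [hcell, hcell₀] using hstores (by simp [Guess.best, hPS])

theorem halts_fillTable (hG : G.Fits R β) (hsmall : Small β σ) (hσ : Ready G σ) :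
    Halts R β (fillTable N) σ fun τ =>
      Ready G τ ∧ Tabulated G ((D.n + 1) * (rows N D.n * cols N D.n)) τ := by
  have hcount := hG.count_le
  refine .seq ((halts_forCells (fun m τ => Ready G τ ∧ Tabulated G m τ) hG.rows_le hG.succ_le
    hsmall rfl rfl (fun m => dependsOn_and dependsOn_ready dependsOn_tabulated)
    (by simp [dataArrays]) (by simp [dataArrays]) (fun m τ hτ => hτ.1.count)
    ⟨hσ, fun q hq => absurd hq q.not_lt_zero⟩ fun P hP S hS τ hτ hIτ hPτ hSτ => ?_).mono
    fun τ hτ hIτ => ?_)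
  · simpa [cellIndex_eq] using
      halts_initCell hG hP hS hτ hIτ.1 hPτ hSτ (by simpa [cellIndex_eq] using hIτ.2)
  refine .forRange (fun k τ => Ready G τ ∧ Tabulated G ((k + 1) * (rows N D.n * cols N D.n)) τ)
    hcount ((Nat.succ_le_succ hcount).trans hG.succ_le) hτ rfl
    (fun k => dependsOn_and dependsOn_ready dependsOn_tabulated) (by simp [dataArrays])
    (fun k υ hυ => by simp [hυ.1.count]) (by simpa using hIτ) fun k hk υ hυ hIυ hkυ => ?_
  refine (halts_forCells (fun m ω => (Ready G ω ∧ ω Register.product 0 = k) ∧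
      Tabulated G ((k + 1) * (rows N D.n * cols N D.n) + m) ω) hG.rows_le hG.succ_le
    hυ rfl rfl (fun m => dependsOn_and (dependsOn_and dependsOn_ready (t := {↑Register.product})
      fun ω χ h => by rw [h _ rfl]) dependsOn_tabulated)
    (by simp [dataArrays]) (by simp [dataArrays]) (fun m ω hω => hω.1.1.count)
    ⟨⟨hIυ.1, hkυ⟩, hIυ.2⟩ fun P hP S hS ω hω hIω hPω hSω => ?_).mono
    fun ω _ hω => ⟨hω.1.1, by simpa only [Nat.succ_mul] using hω.2⟩
  refine (halts_fillCell hG hk hP hS hω hIω.1.1 hIω.1.2 hPω hSω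
    (by simpa only [cellIndex_eq] using hIω.2)).frame.mono fun χ _ ⟨hframe, hready, htable⟩ =>
    ⟨⟨hready, ?_⟩, by simpa only [cellIndex_eq, ← add_assoc] using htable⟩
  rw [hframe _ rfl, hIω.1.2]

end Assortment

/-! ### Sizes of the numbers -/

namespace Assortment

open RatRAM

/-- A bound for the heights of all numbers that the algorithm stores, if the heights of the data are
at most `m` and each loop has at most `R` iterations. The semiring is a parameter so that the same
expression serves as a polynomial. -/
def memoryHeight {A : Type*} [CommSemiring A] (R m : A) : A :=
  m + 1 + (R + 1) * (5 * m + 3 * R + (R * (R + 1) + 1))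

/-- The data have height at most `m`, and the loops have at most `R` iterations. -/
structure BudgetData.Fits (D : BudgetData) (N R m : ℕ) : Prop where
  one_lt : 1 < N
  le_bound : N ≤ R
  rows_le : rows N D.n ≤ R
  steps_lt : ∀ k, D.T < D.T * shrink N ^ k * (2 + ∑ i ∈ Finset.range D.n, D.v i) → k < R
  price : ∀ i < D.n, HeightLE m (D.r i)
  attraction : ∀ i < D.n, HeightLE m (D.v i)
  unitCost : ∀ i < D.n, HeightLE m (D.b i)
  horizon : HeightLE m D.T
  budget : HeightLE m D.B

theorem heightLE_natCast_of_le {k R : ℕ} (h : k ≤ R) : HeightLE R (k : ℚ) :=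
  heightLE_natCast.2 (h.trans_lt Nat.lt_two_pow_self)

theorem heightLE_shrink {N R : ℕ} (hN : 1 < N) (h : N ≤ R) : HeightLE (R + 1) (shrink N) := by
  have hshrink : shrink N = ((N - 1 : ℕ) : ℤ) / N := by
    rw [shrink, one_sub_div (by positivity)]
    push_cast [hN.le]
    rfl
  have := h.trans_lt Nat.lt_two_pow_self
  rw [hshrink]
  refine heightLE_div_natCast (by omega) ?_
  rw [Int.natAbs_natCast, pow_succ]
  omega

theorem count_le_rows {N : ℕ} (hN : 1 < N) (n : ℕ) : n ≤ rows N n :=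
  calc n ≤ n * n + 1 := n.le_mul_self.trans (Nat.le_succ _)
    _ ≤ rows N n := Nat.succ_le_succ (by rw [mul_assoc]; exact Nat.le_mul_of_pos_left _ (by omega))

namespace BudgetData.Fits

variable {D : BudgetData} {N R m : ℕ}

theorem count_le (hD : D.Fits N R m) : D.n ≤ R := (count_le_rows hD.one_lt _).trans hD.rows_le

theorem heightLE_outside (hD : D.Fits N R m) {k : ℕ} (hk : k ≤ R) :
    HeightLE (m + (R * (R + 1) + 1)) (D.T * shrink N ^ k) :=
  hD.horizon.mul (((heightLE_shrink hD.one_lt hD.le_bound).pow k).mono (by gcongr))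

variable {ξ j : ℕ} {x₀ : ℚ}

theorem heightLE_min (hD : D.Fits N R m) (hj : j < D.n) (hx₀ : HeightLE (m + ξ) x₀) :
    HeightLE (2 * m + ξ) (min (D.v j * x₀) (D.T - x₀)) := by
  rcases min_choice (D.v j * x₀) (D.T - x₀) with h | h <;> rw [h]
  exacts [((hD.attraction j hj).mul hx₀).mono (by omega), (hD.horizon.sub hx₀).mono (by omega)]

theorem heightLE_peak (hD : D.Fits N R m) (hj : j < D.n) (hx₀ : HeightLE (m + ξ) x₀) :
    HeightLE (2 * m + ξ) (D.peak j x₀) := by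
  unfold peak
  split_ifs
  exacts [(hD.budget.div (hD.unitCost j hj)).floor.mono (by omega), hD.heightLE_min hj hx₀]

theorem heightLE_unit (hD : D.Fits N R m) (hj : j < D.n) (hx₀ : HeightLE (m + ξ) x₀) :
    HeightLE (3 * m + 2 * R + ξ) (D.unit N j x₀) :=
  (((hD.price j hj).mul (hD.heightLE_peak hj hx₀)).div
    ((heightLE_natCast_of_le hD.le_bound).mul (heightLE_natCast_of_le hD.count_le))).mono
    (by omega)

theorem guess_fits (hD : D.Fits N R m) (G : Guess D N) (hj : j < D.n)
    (hx₀ : HeightLE (m + (R * (R + 1) + 1)) G.x₀) (hg : G.g = D.unit N j G.x₀) :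
    G.Fits R (memoryHeight R m) := by
  set ξ := R * (R + 1) + 1 with hξ
  have hunit : HeightLE (3 * m + 2 * R + ξ) G.g := hg ▸ hD.heightLE_unit hj hx₀
  have hrows := hD.rows_le
  have hrevenue (P : ℕ) (hP : P < rows N D.n) : HeightLE (3 * m + 3 * R + ξ) (P * G.g) :=
    ((heightLE_natCast_of_le (by omega : P ≤ R)).mul hunit).mono (by omega)
  have hsales (i : ℕ) (hi : i < D.n) (p : ℕ) (hp : p < rows N D.n) :
      HeightLE (4 * m + 3 * R + ξ) (⌈G.amount i p⌉ : ℤ) :=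
    (((hrevenue p hp).div (hD.price i hi)).mono (by omega)).ceil
  have hcost (i : ℕ) (hi : i < D.n) (p : ℕ) (hp : p < rows N D.n) :
      HeightLE (5 * m + 3 * R + ξ) (G.cost i p) :=
    ((hD.unitCost i hi).mul (hsales i hi p hp)).mono (by omega)
  have hbudget : HeightLE (m + 1) (D.B + 1) :=
    hD.budget.add (by simpa using heightLE_natCast_of_le le_rfl (k := 1))
  have hmemory : memoryHeight R m = m + 1 + (R * (5 * m + 3 * R + ξ) + (5 * m + 3 * R + ξ)) := by
    rw [memoryHeight, add_one_mul, hξ]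
  rw [hmemory]
  exact
    { rows_le := hrows
      count_le := hD.count_le
      succ_le := Nat.lt_two_pow_self.trans_le (Nat.pow_le_pow_right two_pos (by omega))
      budget := hbudget.mono (by omega)
      candidate := fun k hk P hP S p hp => by
        rw [← add_assoc]
        refine HeightLE.add (.mono (Guess.heightLE_best hbudget fun i hi q hq =>
          hcost i (hi.trans hk) q (by omega)) ?_) (hcost k hk p (by omega))
        gcongr
        exact hk.le.trans hD.count_le
      revenue := fun P hP => (hrevenue P hP).mono (by omega)
      sales := fun i hi p hp => (hsales i hi p hp).mono (by omega) }

end BudgetData.Fits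

end Assortment

/-! ### Correctness of the output -/

namespace Assortment

open RatRAM Algorithm

/-- The arrays that hold the data, the guess and the table. -/
def solvedArrays : Set ℕ :=
  (dataArrays ∪ {↑Register.outside, ↑Register.unit}) ∪ {↑Register.tableCost, ↑Register.tableUnits}

/-- The data and the guess are in place, and the whole table has been computed. -/
structure Solved {D : BudgetData} {N : ℕ} (G : Guess D N) (σ : Memory) : Prop extends
    Ready G σ where
  tabulated : Tabulated G ((D.n + 1) * (rows N D.n * cols N D.n)) σ

/-- In the plan for `P` units of revenue in `S` slots, the sales of the products from `k` on have
been output, and the rest of the plan is that of the remaining units and slots. -/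
structure Tracing {D : BudgetData} {N : ℕ} (G : Guess D N) (P S k : ℕ) (σ : Memory) : Prop where
  remaining : ∃ P' < rows N D.n, ∃ S' < cols N D.n, σ Register.remUnits 0 = P' ∧
    σ Register.remSlots 0 = S' ∧ ∀ i < k, G.plan D.n P S i = G.plan k P' S' i
  output : ∀ i < D.n, k ≤ i → σ Register.output i = ⌈G.amount i (G.plan D.n P S i)⌉

/-- The output is an affordable inventory that admits sales whose revenue is the record, up to one
part in `N`. -/
structure Recorded (D : BudgetData) (N : ℕ) (σ : Memory) : Prop where
  record_nonneg : 0 ≤ σ Register.record 0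
  output : ∃ (c : ℕ → ℕ) (x : ℕ → ℚ) (x₀ : ℚ), (∀ i < D.n, σ Register.output i = c i) ∧
    ∑ i ∈ Finset.range D.n, D.b i * c i ≤ D.B ∧
    IsSales (Finset.range D.n) D.v (fun i => (c i : ℚ)) D.T x x₀ ∧
    ∑ i ∈ Finset.range D.n, D.r i * x i = shrink N * σ Register.record 0

variable {D : BudgetData} {N : ℕ} {G : Guess D N} {R β k P S : ℕ} {σ : Memory}

theorem dependsOn_solved : DependsOn (Solved G) solvedArrays :=
  dependsOn_of_imp fun _ _ h hσ =>
    ⟨(dependsOn_ready fun a ha => h a (.inl ha)).mp hσ.toReady,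
      (dependsOn_tabulated fun a ha => h a (.inr ha)).mp hσ.tabulated⟩

theorem Solved.store (hσ : Solved G σ) {a : ℕ} (ha : a ∉ solvedArrays) (i : ℕ) (q : ℚ) :
    Solved G (store σ a i q) :=
  (dependsOn_solved fun _ hb => store_of_ne σ (ne_of_mem_of_not_mem hb ha) i q).mpr hσ

theorem dependsOn_tracing :
    DependsOn (Tracing G P S k) {↑Register.remUnits, ↑Register.remSlots, ↑Register.output} :=
  dependsOn_of_imp fun _ _ h hσ =>
    ⟨by simpa only [h Register.remUnits (by simp), h Register.remSlots (by simp)] using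
      hσ.remaining, by simpa only [h Register.output (by simp)] using hσ.output⟩

theorem dependsOn_recorded :
    DependsOn (Recorded D N) {↑Register.record, ↑Register.output} :=
  dependsOn_of_imp fun σ τ h hσ => by
    have hrecord := h Register.record (by simp)
    have houtput := h Register.output (by simp)
    exact ⟨hrecord ▸ hσ.record_nonneg, hrecord ▸ houtput ▸ hσ.output⟩

theorem Solved.table (hσ : Solved G σ) (hk : k ≤ D.n) (hP : P < rows N D.n)
    (hS : S < cols N D.n) :
    σ Register.tableCost (cellIndex N D.n k P S) = (G.best k P S).1 ∧
      σ Register.tableUnits (cellIndex N D.n k P S) = (G.best k P S).2 := by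
  rw [← tableau_cellIndex hP hS]
  refine hσ.tabulated _ ((cellIndex_lt_of_lt hP hS (Nat.lt_succ_of_le hk)
    (P' := 0) (S' := 0)).trans_eq ?_)
  simp [cellIndex_eq]

theorem slots_best_succ_le (G : Guess D N) (k P S : ℕ) :
    G.slots k (G.best (k + 1) P S).2 ≤ S := by
  rcases G.relax_eq_or (fun P' S' => (G.best k P' S').1) k P S (P + 1) with
    h | ⟨p, -, -, hp, h⟩ <;>
    rw [Guess.best, h]
  exacts [by simp [Guess.slots, Guess.amount], hp]

theorem Tracing.output_eq (hσ : Tracing G P S 0 σ) : ∀ i < D.n,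
    σ Register.output i = ⌈G.amount i (G.plan D.n P S i)⌉₊ := fun i hi => by
  rw [hσ.output i hi i.zero_le, natCast_ceil_eq_intCast_ceil Guess.amount_nonneg]

theorem Tracing.step {P' S' : ℕ} {τ : Memory} (hk : k < D.n)
    (hplan : ∀ i < k + 1, G.plan D.n P S i = G.plan (k + 1) P' S' i)
    (hP : P' < rows N D.n) (hS : S' < cols N D.n)
    (houtput : ∀ i < D.n, k + 1 ≤ i → σ Register.output i = ⌈G.amount i (G.plan D.n P S i)⌉)
    (hunits : τ Register.remUnits 0 = P' - (G.best (k + 1) P' S').2)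
    (hslots : τ Register.remSlots 0 = S' - G.slots k (G.best (k + 1) P' S').2)
    (hτ : ∀ i, τ Register.output i =
      if i = k then (⌈G.amount k (G.best (k + 1) P' S').2⌉ : ℚ) else σ Register.output i) :
    Tracing G P S k τ where
  remaining := by
    refine ⟨_, (Nat.sub_le _ _).trans_lt hP, _, (Nat.sub_le _ _).trans_lt hS,
      by rw [hunits, Nat.cast_sub (G.best_succ_snd_le k P' S')],
      by rw [hslots, Nat.cast_sub (slots_best_succ_le G k P' S')], fun i hi => ?_⟩
    rw [hplan i (by omega), Guess.plan]
    exact Function.update_of_ne hi.ne _ _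
  output i hi hki := by
    rw [hτ]
    split_ifs with h
    · subst h
      rw [hplan i i.lt_succ_self, Guess.plan, Function.update_self]
    · exact houtput i hi (by omega)

theorem halts_outputPortion {p : ℕ} (hG : G.Fits R β) (hk : k < D.n) (hP : P < rows N D.n)
    (hS : S < cols N D.n) (hp : p ≤ P) (hpS : G.slots k p ≤ S) (hsmall : Small β σ)
    (hσ : Ready G σ) (hproduct : σ Register.product 0 = k) (hportion : σ Register.portion 0 = p)
    (hunits : σ Register.remUnits 0 = P) (hslots : σ Register.remSlots 0 = S) :
    Halts R β (.set Register.output (.var Register.product) (.ceil portionSales) ;;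
      .assign Register.remUnits (.var Register.remUnits - .var Register.portion) ;;
      .assign Register.remSlots (.var Register.remSlots - portionSlots N)) σ fun τ =>
        τ Register.remUnits 0 = P - p ∧ τ Register.remSlots 0 = S - G.slots k p ∧
        ∀ i, τ Register.output i = if i = k then (⌈G.amount k p⌉ : ℚ) else σ Register.output i := by
  have hrows := hG.rows_le
  have hcols := cols_le_rows N D.n
  have hsales : (Expr.ceil portionSales).eval σ = (⌈G.amount k p⌉ : ℚ) := by
    rw [Expr.eval_ceil, hσ.eval_portionSales hk hproduct hportion]
  have hheight := hsales ▸ hG.sales k hk p (by omega)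
  refine .seq (.set hsmall hheight ?_)
  simp only [hsales, Expr.eval_var, hproduct, Nat.floor_natCast]
  set σ₁ := store σ Register.output k (⌈G.amount k p⌉ : ℚ) with hσ₁
  have hsmall₁ : Small β σ₁ := hsmall.store (hsales ▸ hheight)
  have hunits' : (Expr.var Register.remUnits - Expr.var Register.portion).eval σ₁ =
      (P - p : ℕ) := by
    simp [hσ₁, store_apply, hunits, hportion, hp]
  have hheight' := hunits' ▸ hG.heightLE_natCast (P := P - p) (by omega)
  refine .seq (.assign hsmall₁ hheight' ?_)
  set σ₂ := store σ₁ Register.remUnits 0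
    ((Expr.var Register.remUnits - Expr.var Register.portion).eval σ₁) with hσ₂
  have hready : Ready G σ₂ :=
    (hσ.store (by simp [dataArrays]) _ _).store (by simp [dataArrays]) _ _
  have hslots' : (Expr.var Register.remSlots - portionSlots N).eval σ₂ =
      (S - G.slots k p : ℕ) := by
    rw [Expr.eval_sub, hready.eval_portionSlots (p := p) hk
      (by simp [hσ₂, hσ₁, store_apply, hproduct]) (by simp [hσ₂, hσ₁, store_apply, hportion])]
    simp [hσ₂, hσ₁, store_apply, hslots, hpS]
  refine .assign (hsmall₁.store hheight')
    (hslots' ▸ hG.heightLE_natCast (P := S - G.slots k p) (by omega)) ?_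
  rw [hslots', hσ₂, hunits', hσ₁]
  refine ⟨?_, ?_, fun i => ?_⟩ <;> simp [store_apply, hp, hpS]

theorem halts_outputProduct (hG : G.Fits R β) (hk : k < D.n) (hsmall : Small β σ)
    (hσ : Solved G σ) (htracing : Tracing G P S (k + 1) σ)
    (hlevel : σ Register.level 0 = D.n - (k + 1)) :
    Halts R β (outputProduct N) σ (Tracing G P S k) := by
  obtain ⟨⟨P', hP, S', hS, hunits, hslots, hplan⟩, houtput⟩ := htracing
  set p := (G.best (k + 1) P' S').2 with hp_def
  have hp : p ≤ P' := G.best_succ_snd_le k P' S'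
  have hrows := hG.rows_le
  have hproduct : (Expr.var Register.count - Expr.var Register.level - 1).eval σ = k := by
    simp [hσ.count, hlevel]
  have hheight : HeightLE β (k : ℚ) := hG.heightLE_natCast (hk.le.trans hG.count_le)
  have hheight' : HeightLE β (p : ℚ) := hG.heightLE_natCast (by omega)
  refine .seq (.assign hsmall (hproduct ▸ hheight) ?_)
  rw [hproduct]
  set σ₁ := store σ Register.product 0 k with hσ₁
  have hready : Ready G σ₁ := hσ.toReady.store (by simp [dataArrays]) _ _
  have hportion : (Expr.get Register.tableUnits (cell N (.var Register.product + 1)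
      (.var Register.remUnits) (.var Register.remSlots))).eval σ₁ = p := by
    rw [eval_get_cell hready.count (k := k + 1) (P := P') (S := S') (by simp [hσ₁, store_apply])
      (by simp [hσ₁, store_apply, hunits]) (by simp [hσ₁, store_apply, hslots]), hp_def,
      ← (hσ.table hk hP hS).2]
    simp [hσ₁, store_apply]
  refine .seq (.assign (hsmall.store hheight) (hportion ▸ hheight') ?_)
  rw [hportion]
  refine (halts_outputPortion hG hk hP hS hp (slots_best_succ_le G k P' S')
    ((hsmall.store hheight).store hheight') (hready.store (by simp [dataArrays]) _ _)
    (by simp [store_apply]) (by simp [store_apply])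
    (by simp [store_apply, hunits]) (by simp [store_apply, hslots])).mono
    fun τ _ ⟨hτunits, hτslots, hτ⟩ => ?_
  exact Tracing.step hk hplan hP hS houtput hτunits hτslots
    fun i => by rw [hτ]; simp [store_apply, hp_def]

theorem halts_outputPlan (hG : G.Fits R β) (hP : P < rows N D.n) (hS : S < cols N D.n)
    (hsmall : Small β σ) (hσ : Solved G σ) (hunits : σ Register.units 0 = P)
    (hslots : σ Register.slots 0 = S) :
    Halts R β (outputPlan N) σ (Tracing G P S 0) := by
  have hrows := hG.rows_le
  have hcols := cols_le_rows N D.n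
  have hcount := hG.count_le
  have hP' : HeightLE β ((Expr.var Register.units).eval σ) := by
    simpa [hunits] using hG.heightLE_natCast (P := P) (by omega)
  have hS' : HeightLE β ((Expr.var Register.slots).eval
      (store σ Register.remUnits 0 ((Expr.var Register.units).eval σ))) := by
    simpa [store_apply, hslots] using hG.heightLE_natCast (P := S) (by omega)
  have hdepends (l : ℕ) := dependsOn_and (dependsOn_solved (G := G))
    (dependsOn_tracing (G := G) (P := P) (S := S) (k := D.n - l))
  refine .seq (.assign hsmall hP' (.seq (.assign (hsmall.store hP') hS' ?_)))
  refine (Halts.forRange (fun l τ => Solved G τ ∧ Tracing G P S (D.n - l) τ) hcount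
    ((Nat.succ_le_succ hcount).trans hG.succ_le) ((hsmall.store hP').store hS') rfl hdepends
    (by simp [solvedArrays, dataArrays]) (fun l τ hτ => by simp [hτ.1.count])
    ⟨(hσ.store (by simp [solvedArrays, dataArrays]) _ _).store
      (by simp [solvedArrays, dataArrays]) _ _,
      ⟨P, hP, S, hS, by simp [store_apply, hunits], by simp [store_apply, hslots], by simp⟩,
      fun i hi hni => absurd hi (by omega)⟩ fun l hl τ hτ ⟨hsolved, htracing⟩ hlevel => ?_).mono
    fun τ _ hτ => by simpa using hτ.2
  obtain ⟨k, hk⟩ := Nat.exists_eq_add_of_lt hl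
  rw [show D.n - l = k + 1 by omega] at htracing
  rw [show D.n - (l + 1) = k by omega]
  exact (halts_outputProduct hG (by omega) hτ hsolved htracing
    (by rw [hlevel, hk]; push_cast; ring)).keep dependsOn_solved
    (by simp [solvedArrays, dataArrays, outputProduct, Program.writes, Program.assign]) hsolved

end Assortment

namespace Assortment

open RatRAM Algorithm

/-- The value `a` is at least the revenue of every affordable plan in the first `m` cells of the
table for all products. -/
def Guess.DominatedBelow {D : BudgetData} {N : ℕ} (G : Guess D N) (m : ℕ) (a : ℚ) : Prop :=
  ∀ P < rows N D.n, ∀ S < cols N D.n, P * cols N D.n + S < m →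
    (G.best D.n P S).1 ≤ D.B → P * G.g ≤ a

variable {D : BudgetData} {N : ℕ} {G : Guess D N} {R β m P S : ℕ} {a : ℚ} {σ : Memory}

theorem Tracing.recorded (hσ : Tracing G P S 0 σ) (hS : S < cols N D.n)
    (hbest : (G.best D.n P S).1 ≤ D.B) (hrecord : σ Register.record 0 = P * G.g) :
    Recorded D N σ where
  record_nonneg := hrecord ▸ mul_nonneg P.cast_nonneg G.g_pos.le
  output := by
    obtain ⟨hplan, hcost⟩ := Guess.isPlan_plan hbest
    refine ⟨_, _, _, hσ.output_eq, ?_, hplan.isSales (Nat.lt_succ_iff.1 hS), ?_⟩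
    · simpa only [Guess.cost, ← natCast_ceil_eq_intCast_ceil Guess.amount_nonneg] using
        hcost.trans_le hbest
    · rw [hplan.revenue_eq, hrecord]

theorem halts_recordPlan (hG : G.Fits R β) (hP : P < rows N D.n) (hS : S < cols N D.n)
    (hsmall : Small β σ) (hσ : Solved G σ) (hunits : σ Register.units 0 = P)
    (hslots : σ Register.slots 0 = S) (hbest : (G.best D.n P S).1 ≤ D.B) :
    Halts R β (.assign Register.record (.var Register.units * .var Register.unit) ;; outputPlan N)
      σ fun τ => Solved G τ ∧ Recorded D N τ ∧ τ Register.record 0 = P * G.g := by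
  have hrevenue : (Expr.var Register.units * Expr.var Register.unit).eval σ = P * G.g := by
    simp [hunits, hσ.unit]
  have hheight := hrevenue ▸ hG.revenue P hP
  have hσ' := hσ.store (a := Register.record) (by simp [solvedArrays, dataArrays]) 0 (P * G.g)
  refine .seq (.assign hsmall hheight ?_)
  rw [hrevenue] at hheight ⊢
  refine ((halts_outputPlan hG hP hS (hsmall.store hheight) hσ' (by simp [store_apply, hunits])
    (by simp [store_apply, hslots])).keep dependsOn_solved (by
      simp [solvedArrays, dataArrays, outputPlan, outputProduct, Program.writes, Program.assign,
        Program.forRange]) hσ').frame.mono fun τ _ ⟨hframe, hτ, htracing⟩ => ?_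
  have hrecord : τ Register.record 0 = P * G.g := by rw [hframe _ rfl]; simp [store_apply]
  exact ⟨hτ, htracing.recorded hS hbest hrecord, hrecord⟩

theorem halts_inspectCell (hG : G.Fits R β) (hP : P < rows N D.n) (hS : S < cols N D.n)
    (hsmall : Small β σ) (hσ : Solved G σ) (hrecorded : Recorded D N σ)
    (hunits : σ Register.units 0 = P) (hslots : σ Register.slots 0 = S) :
    Halts R β (inspectCell N) σ fun τ => Solved G τ ∧ Recorded D N τ ∧
      σ Register.record 0 ≤ τ Register.record 0 ∧
      ((G.best D.n P S).1 ≤ D.B → P * G.g ≤ τ Register.record 0) := by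
  have hcost : (Expr.get Register.tableCost (cell N (.var Register.count) (.var Register.units)
      (.var Register.slots))).eval σ = (G.best D.n P S).1 := by
    rw [eval_get_cell hσ.count (k := D.n) (P := P) (S := S) (by simp [hσ.count]) (by simp [hunits])
      (by simp [hslots]), (hσ.table le_rfl hP hS).1]
  have hbudget : (Expr.var Register.budget).eval σ = D.B := by simp [hσ.budget]
  have hrevenue : (Expr.var Register.units * Expr.var Register.unit).eval σ = P * G.g := by
    simp [hunits, hσ.unit]
  refine .ite hsmall (fun hlt => .skip hsmall ⟨hσ, hrecorded, le_rfl, fun h => ?_⟩) fun hle => ?_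
  · rw [hcost, hbudget] at hlt
    exact absurd h hlt.not_ge
  rw [hcost, hbudget] at hle
  refine .ite hsmall (fun hlt => ?_) fun hge => .skip hsmall ⟨hσ, hrecorded, le_rfl, fun _ => ?_⟩
  · rw [Expr.eval_var, hrevenue] at hlt
    exact (halts_recordPlan hG hP hS hsmall hσ hunits hslots hle).mono
      fun τ _ ⟨hτ, hrecorded', hrecord⟩ =>
        ⟨hτ, hrecorded', hlt.le.trans_eq hrecord.symm, fun _ => hrecord.ge⟩
  · rwa [hrevenue, Expr.eval_var] at hge

theorem Guess.DominatedBelow.succ {a' : ℚ} (h : G.DominatedBelow (P * cols N D.n + S) a)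
    (ha : a ≤ a') (hS : S < cols N D.n) (hcell : (G.best D.n P S).1 ≤ D.B → P * G.g ≤ a') :
    G.DominatedBelow (P * cols N D.n + S + 1) a' := fun P' hP' S' hS' hlt hbest => by
  rcases Nat.lt_succ_iff_lt_or_eq.1 hlt with hlt | heq
  · exact (h P' hP' S' hS' hlt hbest).trans ha
  · have hrow {P S : ℕ} (hS : S < cols N D.n) : (P * cols N D.n + S) / cols N D.n = P := by
      rw [mul_comm, Nat.mul_add_div (S.zero_le.trans_lt hS), Nat.div_eq_of_lt hS, add_zero]
    obtain rfl : P' = P := by rw [← hrow (P := P') hS', heq, hrow hS]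
    obtain rfl : S' = S := Nat.add_left_cancel heq
    exact hcell hbest

theorem Guess.DominatedBelow.dominated (h : G.DominatedBelow (rows N D.n * cols N D.n) a) :
    G.Dominated a := fun p P S hplan hP hS hcost => by
  have hP' : P < rows N D.n := Nat.lt_succ_of_le hP
  refine h P hP' S (Nat.lt_succ_of_le hS) ?_ (hplan.best_le.trans hcost)
  calc P * cols N D.n + S < (P + 1) * cols N D.n := by
        rw [Nat.succ_mul]; exact Nat.add_lt_add_left (Nat.lt_succ_of_le hS) _
    _ ≤ rows N D.n * cols N D.n := Nat.mul_le_mul_right _ hP'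

theorem halts_inspectCells (hG : G.Fits R β) (hsmall : Small β σ) (hσ : Solved G σ)
    (hrecorded : Recorded D N σ) :
    Halts R β (forCells N (inspectCell N)) σ fun τ => Recorded D N τ ∧
      σ Register.record 0 ≤ τ Register.record 0 ∧ G.Dominated (τ Register.record 0) := by
  refine (halts_forCells (fun m τ => Solved G τ ∧ Recorded D N τ ∧
    σ Register.record 0 ≤ τ Register.record 0 ∧ G.DominatedBelow m (τ Register.record 0))
    hG.rows_le hG.succ_le hsmall rfl rfl (fun m => dependsOn_and dependsOn_solved
      (dependsOn_and dependsOn_recorded (t := {↑Register.record}) fun ω χ h => by rw [h _ rfl]))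
    (by simp [solvedArrays, dataArrays]) (by simp [solvedArrays, dataArrays])
    (fun m τ hτ => hτ.1.count)
    ⟨hσ, hrecorded, le_rfl, fun P _ S _ hlt => absurd hlt (Nat.not_lt_zero _)⟩
    fun P hP S hS τ hτ ⟨hsolved, hrecorded', hle, hdom⟩ hunits hslots => ?_).mono
    fun τ _ ⟨_, hrecorded', hle, hdom⟩ => ⟨hrecorded', hle, hdom.dominated⟩
  exact (halts_inspectCell hG hP hS hτ hsolved hrecorded' hunits hslots).mono
    fun υ _ ⟨hυ, hυ', hle', hcell⟩ => ⟨hυ, hυ', hle.trans hle', hdom.succ hle' hS hcell⟩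

theorem halts_treatGuess (hG : G.Fits R β) (hsmall : Small β σ) (hσ : Ready G σ)
    (hrecorded : Recorded D N σ) :
    Halts R β (fillTable N ;; forCells N (inspectCell N)) σ fun τ => Recorded D N τ ∧
      σ Register.record 0 ≤ τ Register.record 0 ∧ G.Dominated (τ Register.record 0) := by
  refine .seq ((halts_fillTable hG hsmall hσ).frame.mono fun τ hτ ⟨hframe, hready, htable⟩ => ?_)
  have hrecord := hframe Register.record rfl
  have houtput := hframe Register.output rfl
  rw [← hrecord]
  exact halts_inspectCells hG hτ ⟨hready, htable⟩
    (dependsOn_recorded (by simp [hrecord, houtput]) |>.mpr hrecorded)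

end Assortment

/-! ### Correctness of the search -/

namespace Assortment

open RatRAM Algorithm

variable {D : BudgetData} {N R m j : ℕ} {x₀ a : ℚ} {σ : Memory}

theorem le_memoryHeight (R m : ℕ) : 5 * m + 3 * R + (R * (R + 1) + 1) ≤ memoryHeight R m :=
  (Nat.le_mul_of_pos_left _ R.succ_pos).trans (Nat.le_add_left _ _)

theorem BudgetData.Dominated.mono (h : D.Dominated N j x₀ a) {a' : ℚ} (ha : a ≤ a') :
    D.Dominated N j x₀ a' :=
  fun G hx₀ hg p P S hplan hP hS hcost => (h G hx₀ hg p P S hplan hP hS hcost).trans ha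

theorem BudgetData.dominated_of_unit_nonpos (h : D.unit N j x₀ ≤ 0) : D.Dominated N j x₀ a :=
  fun G _ hg => absurd (hg ▸ G.g_pos) h.not_gt

theorem Guess.Dominated.budgetDominated {G : Guess D N} (h : G.Dominated a)
    (hg : G.g = D.unit N j G.x₀) : D.Dominated N j G.x₀ a := fun G' hx₀' hg' => by
  obtain rfl : G' = G := by
    cases G
    cases G'
    simp_all
  exact h

theorem Loaded.store (hσ : Loaded D σ) {a : ℕ} (ha : a ∉ dataArrays) (i : ℕ) (q : ℚ) :
    Loaded D (store σ a i q) :=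
  (dependsOn_loaded fun _ hb => store_of_ne σ (ne_of_mem_of_not_mem hb ha) i q).mpr hσ

theorem halts_initPeak (hD : D.Fits N R m) (hj : j < D.n) (hsmall : Small (memoryHeight R m) σ)
    (hσ : Loaded D σ) (hleader : σ Register.leader 0 = j)
    (hx₀ : HeightLE (m + (R * (R + 1) + 1)) (σ Register.outside 0)) :
    Halts R (memoryHeight R m) initPeak σ fun τ =>
      τ Register.peak 0 = min (D.v j * σ Register.outside 0) (D.T - σ Register.outside 0) := by
  have hattraction : (Expr.get Register.attraction (.var Register.leader) *
      Expr.var Register.outside).eval σ = D.v j * σ Register.outside 0 := by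
    simp [hleader, hσ.attraction j hj]
  have hcapacity : (Expr.var Register.horizon - Expr.var Register.outside).eval σ =
      D.T - σ Register.outside 0 := by
    simp [hσ.horizon]
  have hheight {q : ℚ} (hq : q = min (D.v j * σ Register.outside 0) (D.T - σ Register.outside 0)) :
      HeightLE (memoryHeight R m) q :=
    hq ▸ (hD.heightLE_min hj hx₀).mono ((by omega : _ ≤ _).trans (le_memoryHeight R m))
  refine .ite hsmall (fun hlt => ?_) fun hge => ?_
  · rw [hattraction, hcapacity] at hlt
    have hq := hattraction.trans (min_eq_left hlt.le).symm
    exact .assign hsmall (hheight hq) (by simpa [store_apply] using hq)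
  · rw [hattraction, hcapacity] at hge
    have hq := hcapacity.trans (min_eq_right hge).symm
    exact .assign hsmall (hheight hq) (by simpa [store_apply] using hq)

theorem halts_capPeak (hD : D.Fits N R m) (hj : j < D.n) (hsmall : Small (memoryHeight R m) σ)
    (hσ : Loaded D σ) (hleader : σ Register.leader 0 = j)
    (hx₀ : HeightLE (m + (R * (R + 1) + 1)) x₀)
    (hpeak : σ Register.peak 0 = min (D.v j * x₀) (D.T - x₀)) :
    Halts R (memoryHeight R m) capPeak σ fun τ => τ Register.peak 0 = D.peak j x₀ := by
  have hheight := (hD.heightLE_peak hj hx₀).mono ((by omega : _ ≤ _).trans (le_memoryHeight R m))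
  have hexceeds : (Expr.var Register.budget).eval σ <
      (Expr.get Register.unitCost (.var Register.leader) * .ceil (.var Register.peak)).eval σ ↔
      D.B < D.b j * ⌈min (D.v j * x₀) (D.T - x₀)⌉ := by
    simp [hσ.budget, hleader, hσ.unitCost j hj, hpeak]
  refine .ite hsmall (fun hlt => ?_) fun hge => .skip hsmall ?_
  · rw [hexceeds] at hlt
    have hq : (Expr.floor (Expr.var Register.budget /
        .get Register.unitCost (.var Register.leader))).eval σ = D.peak j x₀ := by
      simp [hσ.budget, hleader, hσ.unitCost j hj, BudgetData.peak, hlt]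
    exact .assign hsmall (hq ▸ hheight) (by simp [store_apply, hq])
  · rw [← not_lt, hexceeds] at hge
    rw [hpeak, BudgetData.peak, if_neg hge]

theorem halts_setUnit (hD : D.Fits N R m) (hj : j < D.n) (hsmall : Small (memoryHeight R m) σ)
    (hσ : Loaded D σ) (hleader : σ Register.leader 0 = j) (houtside : σ Register.outside 0 = x₀)
    (hx₀ : HeightLE (m + (R * (R + 1) + 1)) x₀) :
    Halts R (memoryHeight R m) (setUnit N) σ fun τ => τ Register.unit 0 = D.unit N j x₀ := by
  subst houtside
  have hdepends : DependsOn (fun τ => Loaded D τ ∧ τ Register.leader 0 = j) _ :=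
    dependsOn_and dependsOn_loaded (t := {↑Register.leader}) fun ω χ h => by rw [h _ rfl]
  refine .seq (((halts_initPeak hD hj hsmall hσ hleader hx₀).keep hdepends
    (by simp [dataArrays, initPeak, Program.writes, Program.assign]) ⟨hσ, hleader⟩).mono
    fun τ hτ ⟨⟨hloaded, hleader'⟩, hpeak⟩ => .seq
      (((halts_capPeak hD hj hτ hloaded hleader' hx₀ hpeak).keep hdepends
    (by simp [dataArrays, capPeak, Program.writes, Program.assign]) ⟨hloaded, hleader'⟩).mono
    fun υ hυ ⟨⟨hloaded', hleader''⟩, hpeak'⟩ => ?_))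
  have hunit : (Expr.get Register.price (.var Register.leader) * .var Register.peak /
      (.const N * .var Register.count)).eval υ = D.unit N j (σ Register.outside 0) := by
    simp [hleader'', hloaded'.price j hj, hpeak', hloaded'.count, BudgetData.unit]
  exact .assign hυ (hunit ▸ (hD.heightLE_unit hj hx₀).mono
    ((by omega : _ ≤ _).trans (le_memoryHeight R m))) (by simp [store_apply, hunit])

theorem halts_tryGuess (hD : D.Fits N R m) (hj : j < D.n) (hsmall : Small (memoryHeight R m) σ)
    (hσ : Loaded D σ) (hrecorded : Recorded D N σ) (hleader : σ Register.leader 0 = j)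
    (houtside : σ Register.outside 0 = x₀) (hx₀ : HeightLE (m + (R * (R + 1) + 1)) x₀)
    (hx₀_nonneg : 0 ≤ x₀) (hx₀_lt : x₀ < D.T) :
    Halts R (memoryHeight R m) (tryGuess N) σ fun τ => Recorded D N τ ∧
      σ Register.record 0 ≤ τ Register.record 0 ∧ D.Dominated N j x₀ (τ Register.record 0) := by
  refine .seq (((halts_setUnit hD hj hsmall hσ hleader houtside hx₀).keep
    (p := fun τ => Loaded D τ ∧ Recorded D N τ) (dependsOn_and dependsOn_loaded dependsOn_recorded)
    (by simp [dataArrays, setUnit, initPeak, capPeak, Program.writes, Program.assign])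
    ⟨hσ, hrecorded⟩).frame.mono fun τ hτ ⟨hframe, ⟨hloaded, hrecorded'⟩, hunit⟩ => ?_)
  have houtside' : τ Register.outside 0 = x₀ := by rw [hframe _ rfl, houtside]
  rw [← hframe Register.record rfl]
  refine .ite hτ (fun hlt => ?_) fun hge => .skip hτ ⟨hrecorded', le_rfl, ?_⟩
  · have hpos : 0 < D.unit N j x₀ := by simpa [hunit] using hlt
    let G : Guess D N := ⟨x₀, D.unit N j x₀, hD.one_lt, hx₀_nonneg, hx₀_lt, hpos⟩
    exact (halts_treatGuess (hD.guess_fits G hj hx₀ rfl) hτ ⟨hloaded, houtside', hunit⟩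
      hrecorded').mono fun υ _ ⟨hυ, hle, hdom⟩ => ⟨hυ, hle, hdom.budgetDominated rfl⟩
  · exact BudgetData.dominated_of_unit_nonpos (by simpa [hunit] using hge)

theorem writes_tryGuess {a : ℕ} (ha : a ∈ dataArrays ∪ {↑Register.outside}) :
    (tryGuess N).writes a = false := by
  revert a
  simp [dataArrays, tryGuess, setUnit, initPeak, capPeak, fillTable, forCells, initCell, fillCell,
    tryPortion, inspectCell, outputPlan, outputProduct, Program.writes, Program.assign,
    Program.forRange]

theorem halts_tryLeaders (hD : D.Fits N R m) (hsmall : Small (memoryHeight R m) σ)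
    (hσ : Loaded D σ) (hrecorded : Recorded D N σ) (houtside : σ Register.outside 0 = x₀)
    (hx₀ : HeightLE (m + (R * (R + 1) + 1)) x₀) (hx₀_nonneg : 0 ≤ x₀) (hx₀_lt : x₀ < D.T) :
    Halts R (memoryHeight R m) (.forRange Register.leader (.var Register.count) (tryGuess N)) σ
      fun τ => Recorded D N τ ∧ σ Register.record 0 ≤ τ Register.record 0 ∧
        ∀ j < D.n, D.Dominated N j x₀ (τ Register.record 0) := by
  have hcount := hD.count_le
  have hdepends : DependsOn (fun τ => Loaded D τ ∧ τ Register.outside 0 = x₀) _ :=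
    dependsOn_and dependsOn_loaded (t := {↑Register.outside}) fun ω χ h => by rw [h _ rfl]
  refine (Halts.forRange (fun l τ => (Loaded D τ ∧ τ Register.outside 0 = x₀) ∧ Recorded D N τ ∧
      σ Register.record 0 ≤ τ Register.record 0 ∧
      ∀ j < l, D.Dominated N j x₀ (τ Register.record 0)) hcount
    (hcount.trans_lt (Nat.lt_two_pow_self.trans_le (Nat.pow_le_pow_right two_pos ?_))) hsmall rfl
    (fun l => dependsOn_and hdepends (dependsOn_and dependsOn_recorded (t := {↑Register.record})
      fun ω χ h => by rw [h _ rfl])) (by simp [dataArrays]) (fun l τ hτ => by simp [hτ.1.1.count])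
    ⟨⟨hσ, houtside⟩, hrecorded, le_rfl, fun j hj => absurd hj j.not_lt_zero⟩
    fun l hl τ hτ ⟨hdata, hrecorded', hle, hdom⟩ hleader => ?_).mono fun τ _ hτ => hτ.2
  · exact (by omega : R ≤ _).trans (le_memoryHeight R m)
  · refine ((halts_tryGuess hD hl hτ hdata.1 hrecorded' hleader hdata.2 hx₀ hx₀_nonneg
      hx₀_lt).keep hdepends (fun _ => writes_tryGuess) hdata).mono
      fun υ _ ⟨hdata', hυ', hle', hdom'⟩ => ⟨hdata', hυ', hle.trans hle', fun j hj => ?_⟩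
    rcases Nat.lt_succ_iff_lt_or_eq.1 hj with hj | rfl
    exacts [(hdom j hj).mono hle', hdom']

/-- The record dominates all guesses whose sales `T * shrink N ^ (k + 1)` of the outside option are
among the first `K` ones. -/
def BudgetData.DominatedUpTo (D : BudgetData) (N K : ℕ) (a : ℚ) : Prop :=
  ∀ k < K, ∀ j < D.n, D.Dominated N j (D.T * shrink N ^ (k + 1)) a

theorem halts_step {k : ℕ} (hD : D.Fits N R m) (hsmall : Small (memoryHeight R m) σ)
    (hσ : Loaded D σ) (hrecorded : Recorded D N σ)
    (houtside : σ Register.outside 0 = D.T * shrink N ^ k)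
    (hk : D.T < D.T * shrink N ^ k * (2 + ∑ i ∈ Finset.range D.n, D.v i))
    (hdom : D.DominatedUpTo N k (σ Register.record 0)) :
    Halts R (memoryHeight R m)
      (.assign Register.outside (.var Register.outside * .const (shrink N)) ;;
        .forRange Register.leader (.var Register.count) (tryGuess N)) σ fun τ =>
      (Loaded D τ ∧ τ Register.outside 0 = D.T * shrink N ^ (k + 1)) ∧ Recorded D N τ ∧
        D.DominatedUpTo N (k + 1) (τ Register.record 0) := by
  have hT : 0 < D.T := D.T_nonneg.lt_of_ne fun h => by simp [← h] at hk
  have hshrink := shrink_pos hD.one_lt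
  have hlt : D.T * shrink N ^ (k + 1) < D.T :=
    mul_lt_of_lt_one_right hT (pow_lt_one₀ hshrink.le (shrink_lt_one hD.one_lt) k.succ_ne_zero)
  have houtside' : (Expr.var Register.outside * Expr.const (shrink N)).eval σ =
      D.T * shrink N ^ (k + 1) := by
    simp [houtside, pow_succ, mul_assoc]
  have hheight := hD.heightLE_outside (hD.steps_lt k hk)
  have hheight' := hheight.mono ((by omega : _ ≤ _).trans (le_memoryHeight R m))
  refine .seq (.assign hsmall (houtside' ▸ hheight') ?_)
  rw [houtside']
  have hloaded := hσ.store (a := Register.outside) (by simp [dataArrays]) 0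
    (D.T * shrink N ^ (k + 1))
  have hrecorded' : Recorded D N (store σ Register.outside 0 (D.T * shrink N ^ (k + 1))) :=
    (dependsOn_recorded fun b hb => store_of_ne σ (ne_of_mem_of_not_mem hb (by simp)) _ _).mpr
      hrecorded
  refine ((halts_tryLeaders hD (hsmall.store hheight') hloaded hrecorded' (by simp [store_apply])
    hheight (by positivity) hlt).keep
    (p := fun τ => Loaded D τ ∧ τ Register.outside 0 = D.T * shrink N ^ (k + 1))
    (dependsOn_and dependsOn_loaded (t := {↑Register.outside}) fun ω χ h => by rw [h _ rfl])
    (fun a ha => ?_) ⟨hloaded, by simp [store_apply]⟩).mono fun τ _ ⟨hdata, hτ, hle, hdom'⟩ =>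
      ⟨hdata, hτ, fun i hi j hj => ?_⟩
  · have hleader := ne_of_mem_of_not_mem ha (by simp [dataArrays] : ↑Register.leader ∉ _)
    simp [Program.writes, Program.forRange, Program.assign, writes_tryGuess ha, hleader]
  rcases Nat.lt_succ_iff_lt_or_eq.1 hi with hi | rfl
  · exact (hdom i hi j hj).mono (by simpa [store_apply] using hle)
  · exact hdom' j hj

theorem halts_search (hD : D.Fits N R m) (hsmall : Small (memoryHeight R m) σ) (hσ : Loaded D σ)
    (hrecorded : Recorded D N σ) :
    Halts R (memoryHeight R m) (search N) σ fun τ => Recorded D N τ ∧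
      ∀ (c : ℕ → ℕ) (x : ℕ → ℝ) (x₀ : ℝ), ∑ i ∈ Finset.range D.n, D.b i * c i ≤ D.B →
        D.AdmitsSales c x x₀ →
        shrink N ^ 2 * ∑ i ∈ Finset.range D.n, D.r i * x i ≤ τ Register.record 0 := by
  set V := 2 + ∑ i ∈ Finset.range D.n, D.v i with hV_def
  have hV : 0 ≤ V := add_nonneg two_pos.le (Finset.sum_nonneg fun i _ => D.v_nonneg i)
  have hhorizon : (Expr.var Register.horizon).eval σ = D.T := by simp [hσ.horizon]
  have hheight : HeightLE (memoryHeight R m) D.T :=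
    hD.horizon.mono ((by omega : _ ≤ _).trans (le_memoryHeight R m))
  refine .seq (.assign hsmall (hhorizon ▸ hheight) ?_)
  rw [hhorizon]
  refine .loop (fun k τ => (Loaded D τ ∧ τ Register.outside 0 = D.T * shrink N ^ k) ∧
    Recorded D N τ ∧ D.DominatedUpTo N k (τ Register.record 0)) le_rfl (hsmall.store hheight)
    ⟨⟨hσ.store (by simp [dataArrays]) _ _, by simp [store_apply]⟩,
      (dependsOn_recorded fun b hb => store_of_ne σ (ne_of_mem_of_not_mem hb (by simp)) _ _).mpr
        hrecorded, fun i hi => absurd hi i.not_lt_zero⟩ ?_ ?_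
  · rintro k τ hτ ⟨⟨hloaded, houtside⟩, hrecorded', hdom⟩ hlt
    have hk : D.T < D.T * shrink N ^ k * V := by
      simpa [hloaded.horizon, houtside, hloaded.bound] using hlt
    exact ⟨hD.steps_lt k hk, halts_step hD hτ hloaded hrecorded' houtside hk hdom⟩
  · rintro k τ ⟨⟨hloaded, houtside⟩, hrecorded', hdom⟩ hge
    have hk : D.T * shrink N ^ k * V ≤ D.T := by
      simpa [hloaded.horizon, houtside, hloaded.bound] using hge
    refine ⟨hrecorded', fun c x x₀ hc hx => ?_⟩
    have := hx.revenue_le_of_dominated hD.one_lt hrecorded'.record_nonneg (V := V)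
      (by rw [hV_def]; linarith) (fun j hj i hi => hdom i ?_ j hj) (by exact_mod_cast hc)
    · exact_mod_cast this
    · by_contra! hki
      refine (hi.trans_le (le_trans ?_ hk)).false
      gcongr ?_ * V
      exact mul_le_mul_of_nonneg_left (pow_le_pow_of_le_one (shrink_pos hD.one_lt).le
        (shrink_lt_one hD.one_lt).le hki) D.T_nonneg

end Assortment

/-! ### Loading the data -/

namespace Assortment

open RatRAM

namespace Algorithm

open Expr Program Register

/-- Appends the current product to the data. Its unit cost is the value of `b`. -/
def loadProduct (b : Expr) : Program :=
  .set price (var product) (get input (2 + var product)) ;;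
  .set attraction (var product) (get input (2 + var input + var product)) ;;
  .set unitCost (var product) b ;;
  .assign bound (var bound + get attraction (var product)) ;;
  .assign count (var product + 1)

/-- Copies the data from the input. The budget is the value of `B`, and the unit cost of the
current product is that of `b`. -/
def load (b B : Expr) : Program :=
  .assign horizon (get input 1) ;;
  .assign budget B ;;
  .assign bound 2 ;;
  .forRange product (var input) (loadProduct b)

end Algorithm

open Algorithm

/-- The input consists of the data, where the expressions `b` and `B` tell the unit costs and the
budget. -/
structure Given (D : BudgetData) (b B : Expr) (σ : Memory) : Prop where
  count : σ Register.input 0 = D.n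
  horizon : σ Register.input 1 = D.T
  price : ∀ i < D.n, σ Register.input (2 + i) = D.r i
  attraction : ∀ i < D.n, σ Register.input (2 + D.n + i) = D.v i
  unitCost : ∀ i < D.n, ∀ τ : Memory, τ Register.input = σ Register.input →
    τ Register.product 0 = i → b.eval τ = D.b i
  budget : ∀ τ : Memory, τ Register.input = σ Register.input → B.eval τ = D.B

/-- The data of the first `k` products. -/
def BudgetData.take (D : BudgetData) (k : ℕ) : BudgetData := { D with n := k }

variable {D : BudgetData} {b B : Expr} {N R m k : ℕ} {σ : Memory}

theorem dependsOn_given : DependsOn (Given D b B) {↑Register.input} :=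
  dependsOn_of_imp fun σ τ h hσ => by
    have hinput : σ Register.input = τ Register.input := h _ rfl
    exact ⟨hinput ▸ hσ.count, hinput ▸ hσ.horizon, hinput ▸ hσ.price, hinput ▸ hσ.attraction,
      hinput ▸ hσ.unitCost, hinput ▸ hσ.budget⟩

theorem BudgetData.Fits.heightLE_bound (hD : D.Fits N R m) (hk : k ≤ D.n) :
    HeightLE (memoryHeight R m) (2 + ∑ i ∈ Finset.range k, D.v i) := by
  refine (HeightLE.add (m := 2) (heightLE_natCast (k := 2).2 (by norm_num))
    (heightLE_sum_range fun i hi => hD.attraction i (hi.trans_le hk))).mono ?_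
  have hkm : k * m ≤ R * m := Nat.mul_le_mul_right m (hk.trans hD.count_le)
  rw [memoryHeight]
  nlinarith [Nat.zero_le (R * (R * (R + 1))), Nat.zero_le (R * R)]

theorem halts_loadProduct (hD : D.Fits N R m) (hk : k < D.n)
    (hsmall : Small (memoryHeight R m) σ) (hgiven : Given D b B σ) (hσ : Loaded (D.take k) σ)
    (hproduct : σ Register.product 0 = k) :
    Halts R (memoryHeight R m) (loadProduct b) σ (Loaded (D.take (k + 1))) := by
  have hmono {q : ℚ} (hq : HeightLE m q) : HeightLE (memoryHeight R m) q :=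
    hq.mono ((by omega : _ ≤ _).trans (le_memoryHeight R m))
  have hbound := hD.heightLE_bound (k := k + 1) hk
  have hcount : HeightLE (memoryHeight R m) ((k + 1 : ℕ) : ℚ) :=
    (heightLE_natCast_of_le (hk.trans_le hD.count_le)).mono
      ((by omega : R ≤ _).trans (le_memoryHeight R m))
  refine .seq (.set_of_eval_eq (k := k) hsmall (by simp [hproduct])
    ((Expr.eval_get_of_eval_eq (by simp [hproduct])).trans (hgiven.price k hk))
    (hmono (hD.price k hk)) fun hτ => ?_)
  refine .seq (.set_of_eval_eq (k := k) hτ (by simp [store_apply, hproduct])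
    ((Expr.eval_get_of_eval_eq (k := 2 + D.n + k)
      (by simp [store_apply, hproduct, hgiven.count])).trans
      (by simpa [store_apply] using hgiven.attraction k hk))
    (hmono (hD.attraction k hk)) fun hυ => ?_)
  refine .seq (.set_of_eval_eq (k := k) hυ (by simp [store_apply, hproduct])
    (hgiven.unitCost k hk _ (by simp [store_of_ne]) (by simp [store_apply, hproduct]))
    (hmono (hD.unitCost k hk)) fun hφ => ?_)
  refine .seq (.set_of_eval_eq (k := 0) hφ (by simp) (by
    simp [store_apply, hproduct, hσ.bound, BudgetData.take, Finset.sum_range_succ, add_assoc])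
    hbound fun hχ => ?_)
  refine .set_of_eval_eq (k := 0) hχ (by simp) (by simp [store_apply, hproduct]) hcount fun _ => ?_
  refine ⟨fun i hi => ?_, fun i hi => ?_, fun i hi => ?_, ?_, ?_, ?_, ?_⟩
  · rcases Nat.lt_succ_iff_lt_or_eq.1 hi with hi | rfl
    · simpa [store_apply, BudgetData.take, hi.ne] using hσ.price i hi
    · simp [store_apply, BudgetData.take]
  · rcases Nat.lt_succ_iff_lt_or_eq.1 hi with hi | rfl
    · simpa [store_apply, BudgetData.take, hi.ne] using hσ.attraction i hi
    · simp [store_apply, BudgetData.take]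
  · rcases Nat.lt_succ_iff_lt_or_eq.1 hi with hi | rfl
    · simpa [store_apply, BudgetData.take, hi.ne] using hσ.unitCost i hi
    · simp [store_apply, BudgetData.take]
  · simp [store_apply, BudgetData.take]
  · simpa [store_apply, BudgetData.take] using hσ.horizon
  · simpa [store_apply, BudgetData.take] using hσ.budget
  · simp [store_apply, BudgetData.take]

theorem halts_load (hD : D.Fits N R m) (hsmall : Small (memoryHeight R m) σ)
    (hgiven : Given D b B σ) (hcount : σ Register.count 0 = 0) :
    Halts R (memoryHeight R m) (load b B) σ (Loaded D) := by
  have hmono {q : ℚ} (hq : HeightLE m q) : HeightLE (memoryHeight R m) q :=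
    hq.mono ((by omega : _ ≤ _).trans (le_memoryHeight R m))
  have hbound := hD.heightLE_bound D.n.zero_le
  rw [Finset.sum_range_zero, add_zero] at hbound
  refine .seq (.set_of_eval_eq (k := 0) hsmall (by simp)
    ((Expr.eval_get_of_eval_eq (by simp)).trans hgiven.horizon) (hmono hD.horizon) fun hτ => ?_)
  refine .seq (.set_of_eval_eq (k := 0) hτ (by simp)
    (hgiven.budget _ (by simp [store_of_ne])) (hmono hD.budget) fun hυ => ?_)
  refine .seq (.set_of_eval_eq (k := 0) hυ (by simp) (by simp) hbound fun hφ => ?_)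
  refine (Halts.forRange (fun k τ => Given D b B τ ∧ Loaded (D.take k) τ) hD.count_le
    (hD.count_le.trans_lt (Nat.lt_two_pow_self.trans_le (Nat.pow_le_pow_right two_pos
      ((by omega : R ≤ _).trans (le_memoryHeight R m))))) hφ rfl
    (fun k => dependsOn_and dependsOn_given dependsOn_loaded) (by simp [dataArrays])
    (fun k τ hτ => by simp [hτ.1.count])
    ⟨(dependsOn_given fun a ha => ?_).mpr hgiven, ?_⟩
    fun k hk τ hτ ⟨hgiven', hloaded⟩ hproduct => ?_).mono fun τ _ hτ => hτ.2
  · obtain rfl : a = Register.input := ha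
    simp [store_of_ne]
  · constructor <;> simp [store_apply, BudgetData.take, hcount]
  · exact (halts_loadProduct hD hk hτ hgiven' hloaded hproduct).keep dependsOn_given
      (by rintro _ rfl; rfl) hgiven'

end Assortment

/-! ### Polynomial bounds -/

namespace RatRAM

theorem HeightLE.le {m : ℕ} {x : ℚ} (hx : HeightLE m x) : x ≤ 2 ^ m := by
  have hnum : x ≤ x.num.natAbs := by
    rw [Nat.cast_natAbs, Int.cast_abs, ← Rat.mul_den_eq_num, abs_mul, Nat.abs_cast]
    exact (le_abs_self x).trans
      (le_mul_of_one_le_right (abs_nonneg x) (by exact_mod_cast x.den_pos))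
  exact hnum.trans (by exact_mod_cast (Nat.le_add_right _ _).trans hx)

theorem small_initial (l : List ℚ) : Small (bitLength l) (initial l) := by
  intro a i
  unfold initial
  split_ifs with ha
  · rcases lt_or_ge i l.length with hi | hi
    · have hmem := List.mem_map_of_mem (f := fun q => bits q + 1) (List.getElem_mem hi)
      rw [List.getD_eq_getElem _ _ hi]
      exact (heightLE_bits _).mono ((Nat.le_succ _).trans (List.le_sum_of_mem hmem))
    · rw [List.getD_eq_default _ _ hi]
      exact heightLE_zero
  · exact heightLE_zero

theorem length_le_bitLength (l : List ℚ) : l.length ≤ bitLength l := by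
  simp [bitLength]

theorem Small.mono {m m' : ℕ} {σ : Memory} (hσ : Small m σ) (h : m ≤ m') : Small m' σ :=
  fun a i => (hσ a i).mono h

end RatRAM

namespace Assortment

open RatRAM

/-- A polynomial bound for the number of iterations of every loop. The coefficients are arbitrary,
since the bound is needed both for numbers and as a polynomial. -/
def iterations {A : Type*} [CommSemiring A] (N : ℕ) (m : A) : A := N * (m * m + 2)

variable {N m k : ℕ}

theorem shrink_pow_self_le (hN : 1 < N) : shrink N ^ N ≤ 1 / 2 := by
  have hN' : (1 : ℚ) < N := by exact_mod_cast hN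
  have hbernoulli : 2 ≤ (1 + 1 / N : ℚ) ^ N := by
    have hN_inv := one_div_pos.2 (one_pos.trans hN')
    have := one_add_mul_le_pow (a := 1 / (N : ℚ)) (by linarith) N
    rwa [mul_one_div_cancel (by positivity), one_add_one_eq_two] at this
  rw [le_div_iff₀ two_pos]
  calc shrink N ^ N * 2
      ≤ shrink N ^ N * (1 + 1 / N) ^ N :=
        mul_le_mul_of_nonneg_left hbernoulli (pow_nonneg (shrink_pos hN).le N)
    _ = (1 - (1 / N) ^ 2) ^ N := by rw [← mul_pow, shrink]; ring
    _ ≤ 1 := pow_le_one₀ (by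
      rw [sub_nonneg]
      exact pow_le_one₀ (by positivity) ((div_le_one (by positivity)).2 hN'.le))
      (sub_le_self _ (by positivity))

theorem shrink_pow_iterations_le (hN : 1 < N) (hk : iterations N m ≤ k) :
    shrink N ^ k * 2 ^ (m * m + 2) ≤ 1 := by
  calc shrink N ^ k * 2 ^ (m * m + 2)
      ≤ (shrink N ^ N) ^ (m * m + 2) * 2 ^ (m * m + 2) := by
        rw [← pow_mul]
        gcongr ?_ * _
        exact pow_le_pow_of_le_one (shrink_pos hN).le (shrink_lt_one hN).le hk
    _ ≤ (1 / 2) ^ (m * m + 2) * 2 ^ (m * m + 2) := by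
        gcongr
        · exact pow_nonneg (shrink_pos hN).le _
        · exact shrink_pow_self_le hN
    _ = 1 := by rw [← mul_pow]; norm_num

theorem BudgetData.fits {D : BudgetData} (hN : 1 < N) (hn : D.n ≤ m)
    (hr : ∀ i < D.n, HeightLE m (D.r i)) (hv : ∀ i < D.n, HeightLE m (D.v i))
    (hb : ∀ i < D.n, HeightLE m (D.b i)) (hT : HeightLE m D.T) (hB : HeightLE m D.B) :
    D.Fits N (iterations N m) m where
  one_lt := hN
  le_bound := Nat.le_mul_of_pos_right _ (by omega)
  rows_le := by
    have := Nat.mul_le_mul_left N (Nat.mul_le_mul hn hn)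
    rw [rows, iterations, Nat.cast_id, mul_assoc]
    nlinarith
  steps_lt k hk := by
    by_contra! hle
    have hV : 2 + ∑ i ∈ Finset.range D.n, D.v i ≤ 2 ^ (m * m + 2) :=
      ((((heightLE_natCast (m := 2) (k := 2)).2 (by norm_num)).add
        (heightLE_sum_range hv)).mono (by nlinarith)).le
    refine hk.not_ge ?_
    rw [mul_assoc]
    refine mul_le_of_le_one_right D.T_nonneg (le_trans ?_ (shrink_pow_iterations_le hN hle))
    exact mul_le_mul_of_nonneg_left hV (pow_nonneg (shrink_pos hN).le k)
  price := hr
  attraction := hv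
  unitCost := hb
  horizon := hT
  budget := hB

end Assortment

/-! ### Approximation of the fluid revenue -/

namespace Assortment

open RatRAM Algorithm

/-- The whole algorithm. The unit cost of the current product is the value of `b`, and the budget is
that of `B`. -/
def Algorithm.solve (N : ℕ) (b B : Expr) : Program := load b B ;; search N

/-- The fluid revenue of the inventory `c`. -/
noncomputable def BudgetData.fluidRevenue (D : BudgetData) (c : ℕ → ℕ) : ℝ :=
  fLP (fun i : Fin D.n => (D.r i : ℝ)) (fun i => (D.v i : ℝ)) (fun i => (c i : ℝ)) D.T

variable {D : BudgetData} {b B : Expr} {N R m : ℕ} {σ : Memory} {c : ℕ → ℕ}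

theorem BudgetData.admitsSales_iff {x : ℕ → ℝ} {x₀ : ℝ} :
    D.AdmitsSales c x x₀ ↔ IsSales Finset.univ (fun i : Fin D.n => (D.v i : ℝ))
      (fun i => (c i : ℝ)) D.T (fun i => x i) x₀ := by
  constructor <;> rintro ⟨h₁, h₂, h₃, h₄, h₅⟩ <;>
    simp only [Finset.mem_range, Finset.mem_univ, true_imp_iff, Finset.sum_range] at h₁ h₂ h₃ h₅
  · exact ⟨fun i _ => h₁ i i.2, fun i _ => h₂ i i.2, fun i _ => h₃ i i.2, h₄, h₅⟩
  · simp only [Fin.forall_iff] at h₁ h₂ h₃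
    exact ⟨by simpa, by simpa, by simpa, h₄, by simpa only [Finset.sum_range]⟩

theorem BudgetData.AdmitsSales.revenue_le_fluidRevenue {x : ℕ → ℝ} {x₀ : ℝ}
    (h : D.AdmitsSales c x x₀) : ∑ i ∈ Finset.range D.n, D.r i * x i ≤ D.fluidRevenue c := by
  rw [Finset.sum_range]
  exact (BudgetData.admitsSales_iff.1 h).revenue_le_fLP
    (fun i => by exact_mod_cast D.r_nonneg i) fun i => by exact_mod_cast D.v_nonneg i

theorem BudgetData.fluidRevenue_nonneg : 0 ≤ D.fluidRevenue c := by
  have hsales : D.AdmitsSales c 0 0 :=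
    ⟨by simp, by simp, by simp, le_rfl, by simpa using D.T_nonneg⟩
  simpa using hsales.revenue_le_fluidRevenue

theorem BudgetData.fluidRevenue_le {A : ℝ} (hA : 0 ≤ A)
    (h : ∀ x x₀, D.AdmitsSales c x x₀ → ∑ i ∈ Finset.range D.n, D.r i * x i ≤ A) :
    D.fluidRevenue c ≤ A := by
  refine fLP_le (fun i => by exact_mod_cast D.v_nonneg i) (by exact_mod_cast D.T_nonneg) hA
    fun x x₀ hx => ?_
  have hextend (i : Fin D.n) : Function.extend Fin.val x 0 i = x i :=
    Fin.val_injective.extend_apply x 0 i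
  simpa only [Finset.sum_range, hextend] using
    h (Function.extend Fin.val x 0) x₀ (BudgetData.admitsSales_iff.2 (by simpa only [hextend]))

theorem recorded_of_eq_zero (hrecord : σ Register.record 0 = 0)
    (houtput : ∀ i < D.n, σ Register.output i = 0) : Recorded D N σ where
  record_nonneg := hrecord.ge
  output := ⟨0, 0, 0, fun i hi => by simpa using houtput i hi, by simpa using D.B_nonneg,
    ⟨by simp, by simp, by simp, le_rfl, by simpa using D.T_nonneg⟩, by simp [hrecord]⟩

theorem Recorded.exists_fluidRevenue (hσ : Recorded D N σ) :
    ∃ c : ℕ → ℕ, (∀ i < D.n, σ Register.output i = c i) ∧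
      ∑ i ∈ Finset.range D.n, D.b i * c i ≤ D.B ∧
      ((shrink N * σ Register.record 0 : ℚ) : ℝ) ≤ D.fluidRevenue c := by
  obtain ⟨c, x, x₀, houtput, hcost, hx, hrevenue⟩ := hσ.output
  have hsales : D.AdmitsSales c (fun i => x i) x₀ :=
    ⟨fun i hi => by exact_mod_cast hx.nonneg i hi,
      fun i hi => by exact_mod_cast hx.le_inventory i hi,
      fun i hi => by exact_mod_cast hx.le_attraction i hi, by exact_mod_cast hx.outside_nonneg,
      by exact_mod_cast hx.total_le⟩
  refine ⟨c, houtput, hcost, ?_⟩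
  rw [← hrevenue]
  exact_mod_cast hsales.revenue_le_fluidRevenue

theorem halts_solve (hD : D.Fits N R m) (hsmall : Small (memoryHeight R m) σ)
    (hgiven : Given D b B σ) (hzero : ∀ a ≠ (Register.input : ℕ), ∀ i, σ a i = 0) :
    Halts R (memoryHeight R m) (solve N b B) σ fun τ => ∃ c : ℕ → ℕ,
      (∀ i < D.n, τ Register.output i = c i) ∧ ∑ i ∈ Finset.range D.n, D.b i * c i ≤ D.B ∧
      ∀ c' : ℕ → ℕ, ∑ i ∈ Finset.range D.n, D.b i * c' i ≤ D.B →
        shrink N ^ 3 * D.fluidRevenue c' ≤ D.fluidRevenue c := by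
  have hrecorded : Recorded D N σ :=
    recorded_of_eq_zero (hzero _ (by simp) 0) fun i _ => hzero _ (by simp) i
  refine .seq (((halts_load hD hsmall hgiven (hzero _ (by simp) 0)).keep dependsOn_recorded
    (by rintro _ (rfl | rfl) <;> rfl) hrecorded).mono fun τ hτ ⟨hrecorded', hloaded⟩ => ?_)
  refine (halts_search hD hτ hloaded hrecorded').mono fun υ _ ⟨hυ, hbest⟩ => ?_
  obtain ⟨c, houtput, hcost, hc⟩ := hυ.exists_fluidRevenue
  refine ⟨c, houtput, hcost, fun c' hc' => ?_⟩
  have hθ : (0 : ℝ) < shrink N := by exact_mod_cast shrink_pos hD.one_lt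
  have hrecord : (0 : ℝ) ≤ υ Register.record 0 := by exact_mod_cast hυ.record_nonneg
  have hrevenue : D.fluidRevenue c' ≤ υ Register.record 0 / (shrink N : ℝ) ^ 2 :=
    BudgetData.fluidRevenue_le (by positivity) fun x x₀ hx =>
      (le_div_iff₀' (by positivity)).2 (hbest c' x x₀ hc' hx)
  calc (shrink N : ℝ) ^ 3 * D.fluidRevenue c'
      = shrink N * (shrink N ^ 2 * D.fluidRevenue c') := by ring
    _ ≤ shrink N * (υ Register.record 0 : ℝ) := by
        gcongr
        exact (le_div_iff₀' (by positivity)).1 hrevenue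
    _ ≤ D.fluidRevenue c := by exact_mod_cast hc

end Assortment

/-! ### Encoded instances -/

theorem MaxProblem.PolyTimeApprox.mono {M : MaxProblem} {ρ ρ' : ℝ} (h : M.PolyTimeApprox ρ)
    (hρ : ρ' ≤ ρ) (hM : ∀ I s, 0 ≤ M.value I s) : M.PolyTimeApprox ρ' := by
  obtain ⟨P, p, hP⟩ := h
  refine ⟨P, p, fun I => ?_⟩
  obtain ⟨s, hs, hcomputes, hbest⟩ := hP I
  exact ⟨s, hs, hcomputes, fun s' hs' =>
    (mul_le_mul_of_nonneg_right hρ (hM I s')).trans (hbest s' hs')⟩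

namespace Assortment

open RatRAM Algorithm Expr

section Encoding

variable (M : Market) (tail : List ℚ)

theorem Market.length_encode : M.encode.length = 2 + 2 * M.n := by
  simp only [encode, List.length_cons, List.length_append, List.length_ofFn]
  omega

theorem Market.getD_encode_append_price (i : Fin M.n) :
    (M.encode ++ tail).getD (2 + i) 0 = M.r i := by
  simp only [encode, List.cons_append, List.append_assoc, add_comm 2, List.getD_cons_succ]
  rw [List.getD_append _ _ _ _ (by simp)]
  simp

theorem Market.getD_encode_append_attraction (i : Fin M.n) :
    (M.encode ++ tail).getD (2 + M.n + i) 0 = M.v i := by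
  rw [add_assoc, add_comm 2]
  simp only [encode, List.cons_append, List.append_assoc, List.getD_cons_succ]
  rw [List.getD_append_right _ _ _ _ (by simp), List.getD_append _ _ _ _ (by simp)]
  simp

theorem Market.getD_encode_append (i : ℕ) :
    (M.encode ++ tail).getD (2 + 2 * M.n + i) 0 = tail.getD i 0 := by
  rw [← M.length_encode, List.getD_append_right _ _ _ _ (Nat.le_add_right _ _),
    Nat.add_sub_cancel_left]

end Encoding

/-- The data of an instance. The products beyond the last one are worthless and free. -/
noncomputable def BudgetInst.data (I : BudgetInst) : BudgetData where
  n := I.n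
  r := Function.extend Fin.val I.r 0
  v := Function.extend Fin.val I.v 0
  b := Function.extend Fin.val I.b 0
  T := I.T
  B := I.B
  r_nonneg := Function.extend_nonneg I.r_nonneg le_rfl
  v_nonneg := Function.extend_nonneg I.v_nonneg le_rfl
  b_nonneg := Function.extend_nonneg I.b_nonneg le_rfl
  T_nonneg := I.T_nonneg
  B_nonneg := I.B_nonneg

/-- A bound on the number of units is a budget, with unit costs `1`. -/
def CardInst.toBudgetInst (I : CardInst) : BudgetInst where
  toMarket := I.toMarket
  b _ := 1
  B := I.K
  b_nonneg _ := zero_le_one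
  B_nonneg := I.K.cast_nonneg

/-- The time bound of the algorithm. -/
noncomputable def Algorithm.solveTime (N : ℕ) (b B : Expr) : Polynomial ℕ :=
  (solve N b B).costPoly.comp (iterations N .X) * (memoryHeight (iterations N .X) .X + 1)

namespace BudgetInst

variable (I : BudgetInst) {N : ℕ} {b B : Expr} {l tail : List ℚ}

@[simp] theorem data_r (i : Fin I.n) : I.data.r i = I.r i := Fin.val_injective.extend_apply _ _ i

@[simp] theorem data_v (i : Fin I.n) : I.data.v i = I.v i := Fin.val_injective.extend_apply _ _ i

@[simp] theorem data_b (i : Fin I.n) : I.data.b i = I.b i := Fin.val_injective.extend_apply _ _ i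

theorem fluidRevenue_data (c : ℕ → ℕ) :
    I.data.fluidRevenue c = I.fluidRevenue fun i => c i := by
  have hr : (fun i : Fin I.n => (I.data.r i : ℝ)) = fun i => (I.r i : ℝ) := by simp only [data_r]
  have hv : (fun i : Fin I.n => (I.data.v i : ℝ)) = fun i => (I.v i : ℝ) := by simp only [data_v]
  exact congr_arg₂ (fun r v => fLP r v (fun i => (c i : ℝ)) I.T) hr hv

theorem sum_data_b (c : ℕ → ℕ) :
    ∑ i ∈ Finset.range I.data.n, I.data.b i * c i = ∑ i, I.b i * (c i : ℚ) := by
  change ∑ i ∈ Finset.range I.n, _ = _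
  simp only [Finset.sum_range, data_b]

theorem fluidRevenue_nonneg (c : Fin I.n → ℕ) : 0 ≤ I.fluidRevenue c := by
  have := I.data.fluidRevenue_nonneg (c := Function.extend Fin.val c 0)
  rw [fluidRevenue_data] at this
  simpa only [Fin.val_injective.extend_apply] using this

theorem given
    (hb : ∀ (i : Fin I.n) (τ : Memory),
      τ Register.input = initial (I.encode ++ tail) Register.input →
        τ Register.product 0 = i → b.eval τ = I.b i)
    (hB : ∀ τ : Memory, τ Register.input = initial (I.encode ++ tail) Register.input →
      B.eval τ = I.B) : Given I.data b B (initial (I.encode ++ tail)) where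
  count := rfl
  horizon := rfl
  price i hi := (I.getD_encode_append_price tail ⟨i, hi⟩).trans (I.data_r ⟨i, hi⟩).symm
  attraction i hi := (I.getD_encode_append_attraction tail ⟨i, hi⟩).trans (I.data_v ⟨i, hi⟩).symm
  unitCost i hi τ hτ hproduct := (hb ⟨i, hi⟩ τ hτ hproduct).trans (I.data_b ⟨i, hi⟩).symm
  budget := hB

theorem fits_data (hN : 1 < N) (hn : I.n ≤ l.length) (hb : ∀ i, HeightLE (bitLength l) (I.b i))
    (hB : HeightLE (bitLength l) I.B) (hgiven : Given I.data b B (initial l)) :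
    I.data.Fits N (iterations N (bitLength l)) (bitLength l) :=
  BudgetData.fits hN (hn.trans (length_le_bitLength l))
    (fun i hi => hgiven.price i hi ▸ small_initial l _ _)
    (fun i hi => hgiven.attraction i hi ▸ small_initial l _ _)
    (fun i hi => I.data_b ⟨i, hi⟩ ▸ hb ⟨i, hi⟩) (hgiven.horizon ▸ small_initial l _ _) hB

theorem exists_approx (hN : 1 < N) (hn : I.n ≤ l.length)
    (hb : ∀ i, HeightLE (bitLength l) (I.b i)) (hB : HeightLE (bitLength l) I.B)
    (hgiven : Given I.data b B (initial l)) :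
    ∃ c : Fin I.n → ℕ, ∑ i, I.b i * (c i : ℚ) ≤ I.B ∧
      (solve N b B).Computes l (List.ofFn fun i => (c i : ℚ))
        ((solveTime N b B).eval (bitLength l)) ∧
      ∀ c' : Fin I.n → ℕ, ∑ i, I.b i * (c' i : ℚ) ≤ I.B →
        (shrink N : ℝ) ^ 3 * I.fluidRevenue c' ≤ I.fluidRevenue c := by
  have hsmall : Small (memoryHeight (iterations N (bitLength l)) (bitLength l)) (initial l) :=
    (small_initial l).mono ((by omega : _ ≤ _).trans (le_memoryHeight _ _))
  obtain ⟨τ, s, hexec, hs, -, c, houtput, hcost, hbest⟩ :=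
    halts_solve (I.fits_data hN hn hb hB hgiven) hsmall hgiven fun a ha i => if_neg ha
  refine ⟨fun i => c i, (I.sum_data_b c).symm.trans_le hcost,
    ⟨τ, s, hexec, hs.trans_eq ?_, fun i hi => ?_⟩, fun c' hc' => ?_⟩
  · simp [solveTime, memoryHeight, iterations, Polynomial.eval_comp]
  · rw [List.length_ofFn] at hi
    exact (houtput i hi).trans (by simp)
  · have hextend (i : Fin I.n) : Function.extend Fin.val c' 0 i = c' i :=
      Fin.val_injective.extend_apply c' 0 i
    simpa only [fluidRevenue_data, hextend] using
      hbest (Function.extend Fin.val c' 0) (by simpa only [sum_data_b, hextend])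

end BudgetInst

theorem budgetProblem_polyTimeApprox_shrink {N : ℕ} (hN : 1 < N) :
    budgetProblem.PolyTimeApprox ((shrink N : ℝ) ^ 3) := by
  set b := get Register.input (2 + 2 * var Register.input + var Register.product)
  set B := get Register.input (2 + 3 * var Register.input)
  refine ⟨solve N b B, solveTime N b B, fun I => ?_⟩
  set l := I.encode ++ (List.ofFn I.b ++ [I.B])
  have hcost (i : Fin I.n) : initial l Register.input (2 + 2 * I.n + i) = I.b i :=
    (I.getD_encode_append (List.ofFn I.b ++ [I.B]) i).trans
      ((List.getD_append _ _ _ _ (by simp)).trans (by simp))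
  have hbudget : initial l Register.input (2 + 2 * I.n + I.n) = I.B :=
    (I.getD_encode_append (List.ofFn I.b ++ [I.B]) I.n).trans
      ((List.getD_append_right _ _ _ _ (by simp)).trans (by simp))
  have hcount {τ : Memory} (hτ : τ Register.input = initial l Register.input) :
      τ Register.input 0 = I.n := congr_fun hτ 0
  exact I.exists_approx (l := l) hN (by simp [l, I.length_encode]; omega)
    (fun i => hcost i ▸ small_initial l _ _) (hbudget ▸ small_initial l _ _)
    (I.given
      (fun i τ hτ hproduct => (eval_get_of_eval_eq (by simp [hcount hτ, hproduct])).trans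
        ((congr_fun hτ _).trans (hcost i)))
      fun τ hτ => (eval_get_of_eval_eq (by simp [hcount hτ]; ring)).trans
        ((congr_fun hτ _).trans hbudget))

theorem cardProblem_polyTimeApprox_shrink {N : ℕ} (hN : 1 < N) :
    cardProblem.PolyTimeApprox ((shrink N : ℝ) ^ 3) := by
  set B := get Register.input (2 + 2 * var Register.input)
  refine ⟨solve N 1 B, solveTime N 1 B, fun I => ?_⟩
  set l := I.encode ++ [(I.K : ℚ)]
  have hbound : initial l Register.input (2 + 2 * I.n) = I.K :=
    I.getD_encode_append [(I.K : ℚ)] 0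
  have hcost (c : Fin I.n → ℕ) :
      ∑ i, I.toBudgetInst.b i * (c i : ℚ) ≤ I.toBudgetInst.B ↔ ∑ i, c i ≤ I.K := by
    simp only [CardInst.toBudgetInst, one_mul]
    exact_mod_cast Iff.rfl
  have hcount {τ : Memory} (hτ : τ Register.input = initial l Register.input) :
      τ Register.input 0 = I.n := congr_fun hτ 0
  have hlength : I.n < l.length := by simp [l, I.length_encode]; omega
  have hone : HeightLE (bitLength l) 1 := by
    exact_mod_cast heightLE_natCast_of_le (k := 1) (hlength.pos.trans_le (length_le_bitLength l))
  obtain ⟨c, hc, hcomputes, hbest⟩ := I.toBudgetInst.exists_approx (l := l) (b := 1) (B := B) hN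
    hlength.le (fun _ => hone) (hbound.subst (motive := HeightLE _) (small_initial l _ _))
    (I.toBudgetInst.given (fun _ _ _ _ => by simp [CardInst.toBudgetInst])
      fun τ hτ => (eval_get_of_eval_eq (by simp [hcount hτ])).trans
        ((congr_fun hτ _).trans hbound))
  exact ⟨c, (hcost c).1 hc, hcomputes, fun c' hc' => hbest c' ((hcost c').2 hc')⟩

theorem exists_le_shrink_pow {ρ : ℝ} (hρ : ρ < 1) : ∃ N, 1 < N ∧ ρ ≤ (shrink N : ℝ) ^ 3 := by
  obtain ⟨N, hN⟩ := exists_nat_gt (max 1 (3 / (1 - ρ)))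
  rw [max_lt_iff, div_lt_iff₀ (sub_pos.2 hρ)] at hN
  have hpos : (0 : ℝ) < N := one_pos.trans hN.1
  have hinv : (1 : ℝ) / N < 1 := (div_lt_one hpos).2 hN.1
  refine ⟨N, by exact_mod_cast hN.1, ?_⟩
  calc ρ ≤ 1 + (3 : ℕ) * (-(1 / N)) := by
        have : 3 / (N : ℝ) ≤ 1 - ρ := (div_le_iff₀ hpos).2 (by linarith)
        linarith [(div_eq_mul_one_div 3 (N : ℝ)).symm.trans_le this]
    _ ≤ (1 + -(1 / N)) ^ 3 := one_add_mul_le_pow (by linarith) 3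
    _ = (shrink N : ℝ) ^ 3 := by simp [shrink, sub_eq_add_neg]

end Assortment

theorem theorem1_general {ρ : ℝ} (hρ : ρ < 1) :
    Assortment.cardProblem.PolyTimeApprox ρ ∧ Assortment.budgetProblem.PolyTimeApprox ρ := by
  obtain ⟨N, hN, hle⟩ := Assortment.exists_le_shrink_pow hρ
  exact ⟨(Assortment.cardProblem_polyTimeApprox_shrink hN).mono hle fun I =>
      I.toBudgetInst.fluidRevenue_nonneg,
    (Assortment.budgetProblem_polyTimeApprox_shrink hN).mono hle fun I => I.fluidRevenue_nonneg⟩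

theorem theorem1 (ε : ℝ) (hε₀ : 0 < ε) (hε₁ : ε < 1) :
    Assortment.cardProblem.PolyTimeApprox (1 - 1 / Real.exp 1 - ε) ∧
      Assortment.budgetProblem.PolyTimeApprox (1 - 1 / Real.exp 1 - ε) :=
  theorem1_general (by linarith [one_div_pos.2 (Real.exp_pos 1)])
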